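/- Let $d\ge 1$, $1<\alpha<2$, $\gamma=\alpha/2$, $\Omega=[0,1)^d$, and let $\mu\in L_\infty(\mathbb R^d\times\mathbb R^d)$ satisfy $0<\mu_-\le\mu(x,y)\le\mu_+<\infty$, $\mu(x,y)=\mu(y,x)$ and $\mu(x+m,y+n)=\mu(x,y)$ for $m,n\in\mathbb Z^d$ (for almost all $x,y$). Let $\widetilde H^\gamma(\Omega)$ be the space of functions in $L_2(\Omega)$ whose $\mathbb Z^d$-periodic extension is in $H^\gamma_{\rm loc}(\mathbb R^d)$; functions on $\Omega$ are always extended periodically. For $\xi\in\mathbb R^d$ let $\mathbb A(\xi)$ be the self-adjoint operator in $L_2(\Omega)$ generated by the closed form $$a(\xi)[u,u]=\frac12\int_{\mathbb R^d}dy\int_\Omega dx\,\mu(x,y)\frac{|e^{i\langle\xi,x\rangle}u(x)-e^{i\langle\xi,y\rangle}u(y)|^2}{|x-y|^{d+\alpha}},\qquad u\in\widetilde H^\gamma(\Omega).$$ Put $c_0=\int_{\mathbb R^d}\frac{1-\cos z_1}{|z|^{d+\alpha}}dz$, $\mu^0=\int_\Omega\int_\Omega\mu(x,y)\,dx\,dy$,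 $\mu_*(z)=\int_\Omega\mu(x,z+x)\,dx-\mu^0$, and let $P=(\cdot,\mathbf 1_\Omega)\mathbf 1_\Omega$ be the orthogonal projection of $L_2(\Omega)$ onto the constants. For $k=1,\dots,d$ there is a unique $v_k\in\widetilde H^\gamma(\Omega)$ with $\int_\Omega v_k\,dx=0$ and $$\int_{\mathbb R^d}dy\int_\Omega dx\,\frac{\mu(x,y)}{|x-y|^{d+\alpha}}\bigl(v_k(x)-v_k(y)+x_k-y_k\bigr)\overline{(\eta(x)-\eta(y))}=0\quad\text{for all }\eta\in\widetilde H^\gamma(\Omega).$$ Let $g^0=\{g^0_{jk}\}$ be the matrix $$g^0_{jk}=\frac14\int_{\mathbb R^d}dy\int_\Omega dx\,\frac{\mu(x,y)}{|x-y|^{d+\alpha}}\bigl((x_j-y_j)(v_k(x)-v_k(y))+(x_k-y_k)(v_j(x)-v_j(y))\bigr)+\sum_{n\in\mathbb Z^d}\int_{\Omega+n}\frac{\mu_*(z)z_jz_k}{2|z|^{d+\alpha}}dz .$$ Let $\delta_*=\min\{\delta_0,\delta_2\}$ with $\delta_0=\pi\bigl(\tfrac{\mu_-}{3\mu_+}\bigr)^{1/\alpha}$,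 $\delta_2=\bigl(\tfrac{\mu^0c_0}{2C_{12}}\bigr)^{1/(2-\alpha)}$, where, with $\omega_d=2\pi^{d/2}/\Gamma(d/2)$, $d_0=\mu_-c_0\pi^\alpha$, $\kappa=3+3\mu_+/d_0$, $\ell=\tfrac{d_0(2\pi+2)}3$ and $R=\frac{\sqrt d\,2^{1/(d+\alpha)}}{2^{1/(d+\alpha)}-1}$, $$C_{12}=d\,C_7+c_4\mu_+,\qquad C_7=\kappa^2c_3^2\mu_+^{-1}\Bigl(1+\bigl(\mu_++\tfrac{2d_0}3\bigr)\kappa\mu_+^{-1}\Bigr)\frac{\ell d_0}{3\pi},$$ $$c_3=\Bigl(\frac{\omega_d}{2(2-\alpha)}\Bigr)^{1/2}+\frac{\omega_d}{\alpha-1},\qquad c_4=\omega_d\Bigl(\frac{(R+\sqrt d)^{2-\alpha}}{2(2-\alpha)}+\frac{d+\alpha+1}{(\alpha-1)R^{\alpha-1}}\Bigr).$$ Let $N\ge1$ be an integer with $2-\frac1N<\alpha<2$. Then for all $\varepsilon>0$ and all $\xi\in\mathbb R^d$ with $|\xi|\le\delta_*$, $$\Bigl\|(\mathbb A(\xi)+\varepsilon^\alpha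 I)^{-1}-(\mu^0c_0|\xi|^\alpha+\varepsilon^\alpha)^{-1}P-\sum_{m=1}^NK_m(\xi,\varepsilon)P\Bigr\|_{L_2(\Omega)\to L_2(\Omega)}\le C_{16}(N)\begin{cases}\varepsilon^{1-\alpha},&2-\frac1N<\alpha\le2-\frac1{N+1},\\ \varepsilon^{(N+1)(2-\alpha)-\alpha},&2-\frac1{N+1}<\alpha<2,\end{cases}$$ where $K_m(\xi,\varepsilon)=(-1)^m\langle g^0\xi,\xi\rangle^m(\mu^0c_0|\xi|^\alpha+\varepsilon^\alpha)^{-m-1}$ and the constant $C_{16}(N)$ depends only on $d,\alpha,\mu_-,\mu_+,N$. -/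

import Mathlib

open MeasureTheory

namespace LevyHomog

/-! ### The periodicity cell, periodic extension, and the jump measure -/

/-- The Euclidean space of dimension `d`. -/
abbrev E (d : ℕ) : Type := EuclideanSpace ℝ (Fin d)

/-- The periodicity cell `Ω = [0,1)^d` of the lattice `ℤ^d`. -/
def unitCell (d : ℕ) : Set (E d) := {x | ∀ i, x i ∈ Set.Ico (0 : ℝ) 1}

/-- The complex Hilbert space `L₂(Ω)`. -/
abbrev L2Cell (d : ℕ) : Type := Lp ℂ 2 ((volume : Measure (E d)).restrict (unitCell d))

/-- The point of `ℝ^d` given by an integer vector. -/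
noncomputable def latticePt {d : ℕ} (n : Fin d → ℤ) : E d :=
  WithLp.toLp 2 fun i => (n i : ℝ)

/-- The representative in `Ω` of a point modulo `ℤ^d` (coordinatewise fractional part). -/
noncomputable def toCell {d : ℕ} (x : E d) : E d :=
  WithLp.toLp 2 fun i => Int.fract (x i)

/-- The `ℤ^d`-periodic extension to `ℝ^d` of a function in `L₂(Ω)`. -/
noncomputable def perExt {d : ℕ} (u : L2Cell d) : E d → ℂ := fun x => u (toCell x)

/-- The measure `|x - y|^{-(d+α)} dx dy` on pairs `(x, y)` with `x ∈ Ω`, `y ∈ ℝ^d`. -/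
noncomputable def jumpMeasure (d : ℕ) (α : ℝ) : Measure (E d × E d) :=
  (((volume : Measure (E d)).restrict (unitCell d)).prod volume).withDensity
    fun p => ENNReal.ofReal (‖p.1 - p.2‖ ^ (-((d : ℝ) + α)))

/-- The admissible coefficients: `μ ∈ L_∞(ℝ^d × ℝ^d)` with `μlo ≤ μ ≤ μhi`, symmetric, and
`ℤ^d`-periodic in each variable (all relations almost everywhere). -/
structure IsCoefficient {d : ℕ} (μlo μhi : ℝ) (μ : E d → E d → ℝ) : Prop where
  aemeasurable : AEMeasurable (fun p : E d × E d => μ p.1 p.2) volume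
  bounds : ∀ᵐ p : E d × E d, μlo ≤ μ p.1 p.2 ∧ μ p.1 p.2 ≤ μhi
  symm : ∀ᵐ p : E d × E d, μ p.1 p.2 = μ p.2 p.1
  periodic : ∀ m n : Fin d → ℤ,
    ∀ᵐ p : E d × E d, μ (p.1 + latticePt m) (p.2 + latticePt n) = μ p.1 p.2

/-! ### Auxiliary facts on the periodic extension -/

lemma measurable_toCell {d : ℕ} : Measurable (toCell : E d → E d) := by
  unfold toCell
  refine (WithLp.measurable_toLp 2 _).comp ?_
  refine measurable_pi_lambda _ fun i => ?_
  exact measurable_fract.comp (by fun_prop)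

lemma toCell_mem {d : ℕ} (x : E d) : toCell x ∈ unitCell d := fun _ =>
  ⟨Int.fract_nonneg _, Int.fract_lt_one _⟩

lemma toCell_eq_self {d : ℕ} {x : E d} (hx : x ∈ unitCell d) : toCell x = x := by
  ext i
  exact Int.fract_eq_self.2 (hx i)

lemma measurableSet_unitCell {d : ℕ} : MeasurableSet (unitCell d) := by
  have : unitCell d = ⋂ i, {x : E d | x i ∈ Set.Ico (0 : ℝ) 1} := by
    ext x; simp [unitCell]
  rw [this]
  refine MeasurableSet.iInter fun i => ?_
  have h : Measurable fun x : E d => x i := by fun_prop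
  exact h measurableSet_Ico

lemma volume_restrict_unitCell_ne_top (d : ℕ) :
    ((volume : Measure (E d)).restrict (unitCell d)) (unitCell d) ≠ ⊤ := by
  rw [Measure.restrict_apply_self]
  have hb : Bornology.IsBounded (unitCell d) := by
    refine (Metric.isBounded_closedBall (x := (0 : E d)) (r := Real.sqrt d)).subset fun x hx => ?_
    rw [mem_closedBall_zero_iff, EuclideanSpace.norm_eq]
    refine Real.sqrt_le_sqrt ?_
    calc ∑ i, ‖x i‖ ^ 2 ≤ ∑ _i : Fin d, (1 : ℝ) := by
          refine Finset.sum_le_sum fun i _ => ?_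
          have h1 := (hx i).1
          have h2 := (hx i).2
          rw [Real.norm_of_nonneg h1]
          exact pow_le_one₀ h1 h2.le
      _ = d := by simp
  exact hb.measure_lt_top.ne

lemma quasiMeasurePreserving_toCell {d : ℕ} :
    Measure.QuasiMeasurePreserving (toCell : E d → E d) volume
      ((volume : Measure (E d)).restrict (unitCell d)) := by
  refine ⟨measurable_toCell, ?_⟩
  refine Measure.AbsolutelyContinuous.mk fun s hs h0 => ?_
  rw [Measure.map_apply measurable_toCell hs]
  rw [Measure.restrict_apply hs] at h0
  have hsub : toCell ⁻¹' s ⊆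
      ⋃ n : Fin d → ℤ, (fun x : E d => x + (-latticePt n)) ⁻¹' (s ∩ unitCell d) := by
    intro x hx
    refine Set.mem_iUnion.2 ⟨fun i => ⌊x i⌋, ?_⟩
    have hx' : x + (-latticePt fun i => ⌊x i⌋) = toCell x := by
      ext i
      simp [latticePt, toCell, Int.fract, sub_eq_add_neg]
    change x + (-latticePt fun i => ⌊x i⌋) ∈ s ∩ unitCell d
    rw [hx']
    exact ⟨hx, toCell_mem x⟩
  refine measure_mono_null hsub (measure_iUnion_null fun n => ?_)
  rw [measure_preimage_add_right]
  exact h0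

lemma stronglyMeasurable_perExt {d : ℕ} (u : L2Cell d) : StronglyMeasurable (perExt u) :=
  (Lp.stronglyMeasurable u).comp_measurable measurable_toCell

lemma perExt_add {d : ℕ} (u v : L2Cell d) :
    ∀ᵐ x : E d, perExt (u + v) x = perExt u x + perExt v x := by
  filter_upwards [quasiMeasurePreserving_toCell.ae (Lp.coeFn_add u v)] with x hx
  exact hx

lemma perExt_smul {d : ℕ} (c : ℂ) (u : L2Cell d) :
    ∀ᵐ x : E d, perExt (c • u) x = c * perExt u x := by
  filter_upwards [quasiMeasurePreserving_toCell.ae (Lp.coeFn_smul c u)] with x hx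
  exact hx

lemma perExt_zero {d : ℕ} : ∀ᵐ x : E d, perExt (0 : L2Cell d) x = 0 := by
  filter_upwards [quasiMeasurePreserving_toCell.ae
    (Lp.coeFn_zero ℂ 2 ((volume : Measure (E d)).restrict (unitCell d)))] with x hx
  exact hx

lemma jumpMeasure_ac (d : ℕ) (α : ℝ) :
    jumpMeasure d α ≪ (volume : Measure (E d)).prod volume :=
  (withDensity_absolutelyContinuous _ _).trans
    (Measure.AbsolutelyContinuous.prod Measure.absolutelyContinuous_restrict
      Measure.AbsolutelyContinuous.rfl)

lemma ae_jump_of_ae {d : ℕ} {α : ℝ} {P : E d → Prop} (h : ∀ᵐ x : E d, P x) :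
    ∀ᵐ p ∂(jumpMeasure d α), P p.1 ∧ P p.2 := by
  refine (jumpMeasure_ac d α).ae_le ?_
  filter_upwards [Measure.quasiMeasurePreserving_fst.ae h,
    Measure.quasiMeasurePreserving_snd.ae h] with p h1 h2
  exact ⟨h1, h2⟩

/-! ### The form domain and the quasi-periodic form -/

/-- The twisted difference `e^{i⟨ξ,x⟩} u(x) - e^{i⟨ξ,y⟩} u(y)`, with `u` extended periodically. -/
noncomputable def twistDiff {d : ℕ} (ξ : E d) (u : L2Cell d) (p : E d × E d) : ℂ :=
  Complex.exp (Complex.I * (inner ℝ ξ p.1 : ℝ)) * perExt u p.1 -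
    Complex.exp (Complex.I * (inner ℝ ξ p.2 : ℝ)) * perExt u p.2

lemma twistDiff_add {d : ℕ} {α : ℝ} (ξ : E d) (u v : L2Cell d) :
    twistDiff ξ (u + v) =ᵐ[jumpMeasure d α] twistDiff ξ u + twistDiff ξ v := by
  filter_upwards [ae_jump_of_ae (α := α) (perExt_add u v)] with p hp
  simp only [twistDiff, Pi.add_apply, hp.1, hp.2]
  ring

lemma twistDiff_smul {d : ℕ} {α : ℝ} (ξ : E d) (c : ℂ) (u : L2Cell d) :
    twistDiff ξ (c • u) =ᵐ[jumpMeasure d α] c • twistDiff ξ u := by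
  filter_upwards [ae_jump_of_ae (α := α) (perExt_smul c u)] with p hp
  simp only [twistDiff, Pi.smul_apply, smul_eq_mul, hp.1, hp.2]
  ring

lemma twistDiff_zero {d : ℕ} {α : ℝ} (ξ : E d) :
    twistDiff ξ (0 : L2Cell d) =ᵐ[jumpMeasure d α] 0 := by
  filter_upwards [ae_jump_of_ae (α := α) (perExt_zero (d := d))] with p hp
  simp [twistDiff, hp.1, hp.2]

lemma stronglyMeasurable_twistDiff {d : ℕ} (ξ : E d) (u : L2Cell d) :
    StronglyMeasurable (twistDiff ξ u) := by
  have h1 : StronglyMeasurable fun p : E d × E d => perExt u p.1 :=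
    (stronglyMeasurable_perExt u).comp_measurable measurable_fst
  have h2 : StronglyMeasurable fun p : E d × E d => perExt u p.2 :=
    (stronglyMeasurable_perExt u).comp_measurable measurable_snd
  have e1 : StronglyMeasurable fun p : E d × E d =>
      Complex.exp (Complex.I * (inner ℝ ξ p.1 : ℝ)) :=
    Continuous.stronglyMeasurable (by fun_prop)
  have e2 : StronglyMeasurable fun p : E d × E d =>
      Complex.exp (Complex.I * (inner ℝ ξ p.2 : ℝ)) :=
    Continuous.stronglyMeasurable (by fun_prop)
  exact (e1.mul h1).sub (e2.mul h2)

/-- The space of `ℤ^d`-periodic functions of class `H^{α/2}` (for `0 < α < 2`), as a subspace of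
`L₂(Ω)`: the periodic extension has finite Slobodeckij energy
`∫_Ω dx ∫_{ℝ^d} dy |u(x) - u(y)|² |x - y|^{-(d+α)}`. -/
noncomputable def formDomain (d : ℕ) (α : ℝ) : Submodule ℂ (L2Cell d) where
  carrier := {u | MemLp (fun p : E d × E d => perExt u p.1 - perExt u p.2) 2 (jumpMeasure d α)}
  add_mem' := by
    intro u v hu hv
    refine (MemLp.add hu hv).ae_eq ?_
    filter_upwards [ae_jump_of_ae (α := α) (perExt_add u v)] with p hp
    simp only [Pi.add_apply, hp.1, hp.2]
    ring
  zero_mem' := by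
    refine (MemLp.zero (ε := ℂ)).ae_eq ?_
    filter_upwards [ae_jump_of_ae (α := α) (perExt_zero (d := d))] with p hp
    simp [hp.1, hp.2]
  smul_mem' := by
    intro c u hu
    refine (MemLp.const_smul hu c).ae_eq ?_
    filter_upwards [ae_jump_of_ae (α := α) (perExt_smul c u)] with p hp
    simp only [Pi.smul_apply, smul_eq_mul, hp.1, hp.2]
    ring

/-- The sesquilinear form
`a(ξ)[u,v] = ½ ∫_Ω dx ∫_{ℝ^d} dy μ(x,y) |x-y|^{-(d+α)}
  (e^{i⟨ξ,x⟩}u(x) - e^{i⟨ξ,y⟩}u(y)) conj(e^{i⟨ξ,x⟩}v(x) - e^{i⟨ξ,y⟩}v(y))`,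
linear in `u` and antilinear in `v`. -/
noncomputable def form {d : ℕ} (μ : E d → E d → ℝ) (α : ℝ) (ξ : E d) (u v : L2Cell d) : ℂ :=
  (1 / 2 : ℂ) * ∫ p, (μ p.1 p.2 : ℂ) * (twistDiff ξ u p * starRingEnd ℂ (twistDiff ξ v p))
    ∂(jumpMeasure d α)

lemma nontrivial_E (d : ℕ) [NeZero d] : Nontrivial (E d) := by
  have : Nonempty (Fin d) := ⟨0⟩
  infer_instance

/-- Integrability of `min(1,|z|²) |z|^{-(d+α)}` over `ℝ^d` for `0 < α < 2`. -/
lemma integrable_levy {d : ℕ} [NeZero d] {α : ℝ} (h0 : 0 < α) (h2 : α < 2) :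
    Integrable (fun z : E d => min 1 (‖z‖ ^ 2) * ‖z‖ ^ (-((d : ℝ) + α))) volume := by
  have := nontrivial_E d
  have hd : 1 ≤ d := Nat.one_le_iff_ne_zero.2 (NeZero.ne d)
  refine (integrable_fun_norm_addHaar (E := E d) volume
    (f := fun r : ℝ => min 1 (r ^ 2) * r ^ (-((d : ℝ) + α)))).2 ?_
  simp only [finrank_euclideanSpace, Fintype.card_fin]
  have key : ∀ r : ℝ, 0 < r → ∀ s : ℝ,
      (r ^ (d - 1)) • (r ^ s * r ^ (-((d : ℝ) + α))) = r ^ (s - 1 - α) := by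
    intro r hr s
    rw [smul_eq_mul, ← Real.rpow_natCast, ← Real.rpow_add hr, ← Real.rpow_add hr]
    congr 1
    push_cast [Nat.cast_sub hd]
    ring
  rw [← Set.Ioc_union_Ioi_eq_Ioi (zero_le_one' ℝ)]
  refine IntegrableOn.union ?_ ?_
  · have h : IntegrableOn (fun r : ℝ => r ^ (2 - 1 - α)) (Set.Ioc 0 1) :=
      (intervalIntegrable_iff_integrableOn_Ioc_of_le zero_le_one).1
        (intervalIntegral.intervalIntegrable_rpow' (by linarith))
    refine h.congr_fun (fun r hr => ?_) measurableSet_Ioc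
    have h1 : r ^ 2 ≤ 1 := pow_le_one₀ hr.1.le hr.2
    have := key r hr.1 2
    simp only [min_eq_right h1]
    rw [← this, Real.rpow_two]
  · have h : IntegrableOn (fun r : ℝ => r ^ (0 - 1 - α)) (Set.Ioi 1) :=
      integrableOn_Ioi_rpow_of_lt (by linarith) one_pos
    refine h.congr_fun (fun r hr => ?_) measurableSet_Ioi
    have hr' : (1 : ℝ) < r := hr
    have h1 : 1 ≤ r ^ 2 := one_le_pow₀ hr'.le
    have := key r (by linarith) 0
    simp only [min_eq_left h1]
    rw [← this, Real.rpow_zero]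

lemma norm_twist_sub_sq_le {d : ℕ} (ξ x y : E d) :
    ‖Complex.exp (Complex.I * (inner ℝ ξ x : ℝ)) -
      Complex.exp (Complex.I * (inner ℝ ξ y : ℝ))‖ ^ 2 ≤
      (4 + ‖ξ‖ ^ 2) * min 1 (‖x - y‖ ^ 2) := by
  have hfac : Complex.exp (Complex.I * (inner ℝ ξ x : ℝ)) -
      Complex.exp (Complex.I * (inner ℝ ξ y : ℝ)) =
      Complex.exp (Complex.I * (inner ℝ ξ y : ℝ)) *
        (Complex.exp (Complex.I * (inner ℝ ξ (x - y) : ℝ)) - 1) := by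
    rw [mul_sub, ← Complex.exp_add, inner_sub_right]
    push_cast
    ring_nf
  have h1 : ‖Complex.exp (Complex.I * (inner ℝ ξ y : ℝ))‖ = 1 := by
    rw [mul_comm]; exact Complex.norm_exp_ofReal_mul_I _
  have h1' : ‖Complex.exp (Complex.I * (inner ℝ ξ (x - y) : ℝ))‖ = 1 := by
    rw [mul_comm]; exact Complex.norm_exp_ofReal_mul_I _
  rw [hfac, norm_mul, h1, one_mul]
  set A := ‖Complex.exp (Complex.I * (inner ℝ ξ (x - y) : ℝ)) - 1‖ with hA
  have hA0 : 0 ≤ A := norm_nonneg _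
  have hA2 : A ≤ 2 := by
    refine (norm_sub_le _ _).trans ?_
    rw [h1', norm_one]; norm_num
  have hA3 : A ≤ ‖ξ‖ * ‖x - y‖ :=
    Real.norm_exp_I_mul_ofReal_sub_one_le.trans (norm_inner_le_norm _ _)
  rcases le_total 1 (‖x - y‖ ^ 2) with h | h
  · rw [min_eq_left h]
    nlinarith [sq_nonneg ‖ξ‖]
  · rw [min_eq_right h]
    have : A ^ 2 ≤ (‖ξ‖ * ‖x - y‖) ^ 2 := pow_le_pow_left₀ hA0 hA3 2
    nlinarith [sq_nonneg ‖x - y‖]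

/-- On the form domain the twisted differences are square integrable, for every `ξ`. -/
lemma memLp_twistDiff {d : ℕ} [NeZero d] {α : ℝ} (h0 : 0 < α) (h2 : α < 2) (ξ : E d)
    {u : L2Cell d} (hu : u ∈ formDomain d α) :
    MemLp (twistDiff ξ u) 2 (jumpMeasure d α) := by
  have h1 : StronglyMeasurable fun p : E d × E d => perExt u p.1 :=
    (stronglyMeasurable_perExt u).comp_measurable measurable_fst
  have e1 : StronglyMeasurable fun p : E d × E d =>
      Complex.exp (Complex.I * (inner ℝ ξ p.1 : ℝ)) :=
    Continuous.stronglyMeasurable (by fun_prop)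
  have e2 : StronglyMeasurable fun p : E d × E d =>
      Complex.exp (Complex.I * (inner ℝ ξ p.2 : ℝ)) :=
    Continuous.stronglyMeasurable (by fun_prop)
  set A : E d × E d → ℂ := fun p =>
    Complex.exp (Complex.I * (inner ℝ ξ p.2 : ℝ)) * (perExt u p.1 - perExt u p.2) with hA
  set B : E d × E d → ℂ := fun p =>
    (Complex.exp (Complex.I * (inner ℝ ξ p.1 : ℝ)) -
      Complex.exp (Complex.I * (inner ℝ ξ p.2 : ℝ))) * perExt u p.1 with hB
  have hsum : twistDiff ξ u = A + B := by
    funext p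
    simp only [twistDiff, hA, hB, Pi.add_apply]
    ring
  have hu' : MemLp (fun p : E d × E d => perExt u p.1 - perExt u p.2) 2 (jumpMeasure d α) := hu
  have hAm : MemLp A 2 (jumpMeasure d α) := by
    refine hu'.of_le (e2.aestronglyMeasurable.mul hu'.1) (Filter.Eventually.of_forall fun p => ?_)
    have : ‖Complex.exp (Complex.I * (inner ℝ ξ p.2 : ℝ))‖ = 1 := by
      rw [mul_comm]; exact Complex.norm_exp_ofReal_mul_I _
    simp only [hA, norm_mul, this, one_mul, le_refl]
  have hBs : StronglyMeasurable B := (e1.sub e2).mul h1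
  have hBm : MemLp B 2 (jumpMeasure d α) := by
    rw [memLp_two_iff_integrable_sq_norm hBs.aestronglyMeasurable]
    unfold jumpMeasure
    rw [integrable_withDensity_iff_integrable_smul' (by fun_prop)
      (Filter.Eventually.of_forall fun p => ENNReal.ofReal_lt_top)]
    have hF : Integrable (fun x : E d => ‖perExt u x‖ ^ 2) (volume.restrict (unitCell d)) := by
      have h := (memLp_two_iff_integrable_sq_norm (Lp.memLp u).1).1 (Lp.memLp u)
      refine h.congr ?_
      filter_upwards [ae_restrict_mem measurableSet_unitCell] with x hx
      rw [perExt, toCell_eq_self hx]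
    have hconv := (hF.convolution_integrand (ContinuousLinearMap.mul ℝ ℝ)
      (integrable_levy (d := d) h0 h2)).swap
    refine (hconv.const_mul (4 + ‖ξ‖ ^ 2)).mono' ?_ (Filter.Eventually.of_forall fun p => ?_)
    · have hw : Measurable fun p : E d × E d =>
          (ENNReal.ofReal (‖p.1 - p.2‖ ^ (-((d : ℝ) + α)))).toReal := by fun_prop
      have hB2 : Measurable fun p => ‖B p‖ ^ 2 := (hBs.norm.pow 2).measurable
      exact (hw.mul hB2).aestronglyMeasurable
    · have hw : 0 ≤ ‖p.1 - p.2‖ ^ (-((d : ℝ) + α)) := Real.rpow_nonneg (norm_nonneg _) _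
      rw [ENNReal.toReal_ofReal hw, smul_eq_mul, norm_mul, Real.norm_of_nonneg hw, norm_pow,
        norm_norm]
      simp only [Function.comp, Prod.swap, ContinuousLinearMap.mul_apply', hB, norm_mul, mul_pow,
        norm_sub_rev p.2 p.1]
      have h3 := norm_twist_sub_sq_le ξ p.1 p.2
      have h4 : 0 ≤ ‖p.1 - p.2‖ ^ (-((d : ℝ) + α)) * ‖perExt u p.1‖ ^ 2 := by positivity
      have h5 := mul_le_mul_of_nonneg_left h3 h4
      calc _ = ‖p.1 - p.2‖ ^ (-((d : ℝ) + α)) * ‖perExt u p.1‖ ^ 2 *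
            ‖Complex.exp (Complex.I * (inner ℝ ξ p.1 : ℝ)) -
              Complex.exp (Complex.I * (inner ℝ ξ p.2 : ℝ))‖ ^ 2 := by ring
        _ ≤ _ := h5
        _ = _ := by ring
  rw [hsum]
  exact hAm.add hBm

lemma IsCoefficient.ae_jump {d : ℕ} {μlo μhi : ℝ} {μ : E d → E d → ℝ}
    (hμ : IsCoefficient μlo μhi μ) (α : ℝ) :
    AEStronglyMeasurable (fun p : E d × E d => (μ p.1 p.2 : ℂ)) (jumpMeasure d α) ∧
      ∀ᵐ p ∂(jumpMeasure d α), ‖(μ p.1 p.2 : ℂ)‖ ≤ max |μlo| |μhi| := by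
  constructor
  · have h : AEMeasurable (fun p : E d × E d => (μ p.1 p.2 : ℂ)) volume :=
      Complex.measurable_ofReal.comp_aemeasurable hμ.aemeasurable
    exact h.aestronglyMeasurable.mono_ac (jumpMeasure_ac d α)
  · filter_upwards [(jumpMeasure_ac d α).ae_le hμ.bounds] with p hp
    rw [Complex.norm_real, Real.norm_eq_abs]
    exact abs_le_max_abs_abs hp.1 hp.2

/-- The integral in the form converges absolutely on the form domain. -/
lemma integrable_form {d : ℕ} [NeZero d] {α : ℝ} (h0 : 0 < α) (h2 : α < 2) {μlo μhi : ℝ}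
    {μ : E d → E d → ℝ} (hμ : IsCoefficient μlo μhi μ) (ξ : E d) {u v : L2Cell d}
    (hu : u ∈ formDomain d α) (hv : v ∈ formDomain d α) :
    Integrable (fun p => (μ p.1 p.2 : ℂ) *
      (twistDiff ξ u p * starRingEnd ℂ (twistDiff ξ v p))) (jumpMeasure d α) := by
  refine Integrable.bdd_mul (c := max |μlo| |μhi|) ?_ (hμ.ae_jump α).1 (hμ.ae_jump α).2
  exact (memLp_twistDiff h0 h2 ξ hu).integrable_mul (memLp_twistDiff h0 h2 ξ hv).star

/-! ### The operator generated by the form and its resolvent -/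

/-- The graph of the operator generated by the form `a(ξ)`: the pairs `(u, f)` with `u` in the form
domain and `a(ξ)[u,η] = (f,η)` for all `η` in the form domain. -/
noncomputable def operatorGraph {d : ℕ} [NeZero d] {α : ℝ} (hα : α ∈ Set.Ioo (1 : ℝ) 2)
    {μlo μhi : ℝ} {μ : E d → E d → ℝ} (hμ : IsCoefficient μlo μhi μ) (ξ : E d) :
    Submodule ℂ (L2Cell d × L2Cell d) where
  carrier := {q | q.1 ∈ formDomain d α ∧
    ∀ η ∈ formDomain d α, form μ α ξ q.1 η = inner ℂ η q.2}
  add_mem' := by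
    rintro ⟨u, f⟩ ⟨v, g⟩ ⟨hu, hf⟩ ⟨hv, hg⟩
    refine ⟨add_mem hu hv, fun η hη => ?_⟩
    have h0 : 0 < α := by linarith [hα.1]
    simp only [Prod.fst_add, Prod.snd_add, inner_add_right] at *
    rw [← hf η hη, ← hg η hη]
    unfold form
    rw [← mul_add, ← integral_add (integrable_form h0 hα.2 hμ ξ hu hη)
      (integrable_form h0 hα.2 hμ ξ hv hη)]
    congr 1
    refine integral_congr_ae ?_
    filter_upwards [twistDiff_add (α := α) ξ u v] with p hp
    rw [hp, Pi.add_apply]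
    ring
  zero_mem' := by
    refine ⟨zero_mem _, fun η _ => ?_⟩
    simp only [Prod.fst_zero, Prod.snd_zero, inner_zero_right]
    unfold form
    have h : (fun p => (μ p.1 p.2 : ℂ) *
        (twistDiff ξ (0 : L2Cell d) p * starRingEnd ℂ (twistDiff ξ η p)))
        =ᵐ[jumpMeasure d α] 0 := by
      filter_upwards [twistDiff_zero (α := α) ξ] with p hp
      simp [hp]
    rw [integral_eq_zero_of_ae h, mul_zero]
  smul_mem' := by
    rintro c ⟨u, f⟩ ⟨hu, hf⟩
    refine ⟨Submodule.smul_mem _ c hu, fun η hη => ?_⟩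
    simp only [Prod.smul_fst, Prod.smul_snd, inner_smul_right] at *
    rw [← hf η hη]
    unfold form
    have h : ∫ p, (μ p.1 p.2 : ℂ) *
          (twistDiff ξ (c • u) p * starRingEnd ℂ (twistDiff ξ η p)) ∂(jumpMeasure d α) =
        c * ∫ p, (μ p.1 p.2 : ℂ) *
          (twistDiff ξ u p * starRingEnd ℂ (twistDiff ξ η p)) ∂(jumpMeasure d α) := by
      rw [← integral_const_mul]
      refine integral_congr_ae ?_
      filter_upwards [twistDiff_smul (α := α) ξ c u] with p hp
      rw [hp, Pi.smul_apply, smul_eq_mul]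
      ring
    rw [h]
    ring

lemma ae_mem_interior_unitCell {d : ℕ} :
    ∀ᵐ x : E d, x ∈ unitCell d → x ∈ interior (unitCell d) := by
  have hc : Convex ℝ (unitCell d) := by
    intro x hx y hy a b ha hb hab i
    exact convex_Ico (0 : ℝ) 1 (hx i) (hy i) ha hb hab
  have h0 := hc.addHaar_frontier (volume : Measure (E d))
  have h1 : ∀ᵐ x : E d, x ∉ frontier (unitCell d) := measure_eq_zero_iff_ae_notMem.1 h0
  filter_upwards [h1] with x hx hxc
  by_contra hni
  exact hx ⟨subset_closure hxc, hni⟩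

/-- Lipschitz functions supported in the cell belong to the form domain. -/
lemma mem_formDomain_of_lipschitz {d : ℕ} [NeZero d] {α : ℝ} (h0 : 0 < α) (h2 : α < 2)
    {g : E d → ℂ} {L : NNReal} (hg : LipschitzWith L g) (hs : Function.support g ⊆ unitCell d)
    {M : ℝ} (hM : ∀ x, ‖g x‖ ≤ M) (u : L2Cell d)
    (hu : ∀ᵐ x ∂((volume : Measure (E d)).restrict (unitCell d)), u x = g x) :
    u ∈ formDomain d α := by
  have hu1 : ∀ᵐ x : E d, perExt u x = g (toCell x) := by
    filter_upwards [quasiMeasurePreserving_toCell.ae hu] with x hx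
    exact hx
  have hshift : ∀ x y : E d, ‖g (toCell x)‖ ≤ L * ‖x - y‖ ∨
      ‖g (toCell x) - g (toCell y)‖ ≤ L * ‖x - y‖ := by
    intro x y
    set t : E d := x - toCell x with ht
    have hx : toCell x = x - t := by simp [ht]
    by_cases hy : y - t ∈ unitCell d
    · right
      have hyt : toCell y = y - t := by
        ext i
        have h1 := (hy i).1
        have h2 := (hy i).2
        have h3 : (y - t) i = y i - ⌊x i⌋ := by
          change y i - (x i - Int.fract (x i)) = y i - ⌊x i⌋
          rw [Int.self_sub_fract]
        rw [h3] at h1 h2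
        have : ⌊y i⌋ = ⌊x i⌋ := by
          rw [Int.floor_eq_iff]; constructor <;> linarith
        change y i - ⌊y i⌋ = (y - t) i
        rw [this, h3]
      have := hg.dist_le_mul (x - t) (y - t)
      rw [hx, hyt]
      simpa [dist_eq_norm] using this
    · left
      have hz : g (y - t) = 0 := by
        by_contra hne
        exact hy (hs hne)
      have := hg.dist_le_mul (x - t) (y - t)
      rw [hz] at this
      rw [hx]
      simpa [dist_eq_norm] using this
  have hb : ∀ x y : E d, ‖g (toCell x) - g (toCell y)‖ ≤ 2 * L * ‖x - y‖ := by
    intro x y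
    have hLn : 0 ≤ (L : ℝ) * ‖x - y‖ := by positivity
    rcases hshift x y with h | h
    · rcases hshift y x with h' | h'
      · rw [norm_sub_rev y x] at h'
        linarith [norm_sub_le (g (toCell x)) (g (toCell y))]
      · rw [norm_sub_rev, norm_sub_rev x y]; rw [norm_sub_rev x y] at hLn; linarith
    · linarith
  have hM0 : 0 ≤ M := (norm_nonneg _).trans (hM 0)
  have hsq : ∀ x y : E d, ‖g (toCell x) - g (toCell y)‖ ^ 2 ≤
      (4 * M ^ 2 + 4 * L ^ 2) * min 1 (‖x - y‖ ^ 2) := by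
    intro x y
    have hn := norm_nonneg (g (toCell x) - g (toCell y))
    rcases le_total 1 (‖x - y‖ ^ 2) with h | h
    · rw [min_eq_left h]
      have : ‖g (toCell x) - g (toCell y)‖ ≤ 2 * M := by
        linarith [norm_sub_le (g (toCell x)) (g (toCell y)), hM (toCell x), hM (toCell y)]
      nlinarith [sq_nonneg (L : ℝ)]
    · rw [min_eq_right h]
      have h1 := pow_le_pow_left₀ hn (hb x y) 2
      nlinarith [mul_nonneg (sq_nonneg M) (sq_nonneg ‖x - y‖)]
  change MemLp (fun p : E d × E d => perExt u p.1 - perExt u p.2) 2 (jumpMeasure d α)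
  have h1 : StronglyMeasurable fun p : E d × E d => perExt u p.1 :=
    (stronglyMeasurable_perExt u).comp_measurable measurable_fst
  have h1' : StronglyMeasurable fun p : E d × E d => perExt u p.2 :=
    (stronglyMeasurable_perExt u).comp_measurable measurable_snd
  have hms := h1.sub h1'
  refine (memLp_two_iff_integrable_sq_norm hms.aestronglyMeasurable).2 ?_
  have hae := ae_jump_of_ae (α := α) hu1
  have hint : Integrable (fun p : E d × E d =>
      (4 * M ^ 2 + 4 * (L : ℝ) ^ 2) * min 1 (‖p.1 - p.2‖ ^ 2)) (jumpMeasure d α) := by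
    unfold jumpMeasure
    rw [integrable_withDensity_iff_integrable_smul' (by fun_prop)
      (Filter.Eventually.of_forall fun p => ENNReal.ofReal_lt_top)]
    have hF : Integrable (fun _ : E d => (1 : ℝ)) (volume.restrict (unitCell d)) := by
      have := volume_restrict_unitCell_ne_top d
      rw [Measure.restrict_apply_self] at this
      exact integrableOn_const this
    have hconv := (hF.convolution_integrand (ContinuousLinearMap.mul ℝ ℝ)
      (integrable_levy (d := d) h0 h2)).swap
    refine (hconv.const_mul (4 * M ^ 2 + 4 * (L : ℝ) ^ 2)).congr
      (Filter.Eventually.of_forall fun p => ?_)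
    have hw : 0 ≤ ‖p.1 - p.2‖ ^ (-((d : ℝ) + α)) := Real.rpow_nonneg (norm_nonneg _) _
    simp only [ENNReal.toReal_ofReal hw, smul_eq_mul, Function.comp, Prod.swap,
      ContinuousLinearMap.mul_apply', norm_sub_rev p.2 p.1]
    ring
  refine hint.mono' (hms.norm.pow 2).aestronglyMeasurable ?_
  filter_upwards [hae] with p hp
  simp only [Pi.sub_apply, hp.1, hp.2, norm_pow, norm_norm]
  exact hsq p.1 p.2

/-- The form domain is dense: only `0` is orthogonal to it. -/
lemma eq_zero_of_orthogonal_formDomain {d : ℕ} [NeZero d] {α : ℝ} (h0 : 0 < α) (h2 : α < 2)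
    (f : L2Cell d) (hf : ∀ η ∈ formDomain d α, inner ℂ η f = 0) : f = 0 := by
  have hfin : IsFiniteMeasure ((volume : Measure (E d)).restrict (unitCell d)) :=
    ⟨by have := volume_restrict_unitCell_ne_top d
        rw [Measure.restrict_apply_self] at this
        rw [Measure.restrict_apply_univ]
        exact this.lt_top⟩
  have hfi : IntegrableOn f (unitCell d) volume :=
    (Lp.memLp f).integrable (by norm_num)
  have key := isOpen_interior.ae_eq_zero_of_integral_contDiff_smul_eq_zero (f := (f : E d → ℂ))
    (μ := volume) (U := interior (unitCell d))
    ((hfi.mono_set interior_subset).locallyIntegrableOn) (fun g hgs hgc hgt => by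
      obtain ⟨L, hL⟩ := hgs.lipschitzWith_of_hasCompactSupport hgc (by simp)
      obtain ⟨M, hM⟩ := hgc.exists_bound_of_continuous hgs.continuous
      have hsupp : Function.support g ⊆ unitCell d :=
        (subset_tsupport g).trans (hgt.trans interior_subset)
      have hgc' : Continuous fun x => (g x : ℂ) := Complex.continuous_ofReal.comp hgs.continuous
      have hmem : MemLp (fun x => (g x : ℂ)) 2
          ((volume : Measure (E d)).restrict (unitCell d)) :=
        MemLp.of_bound hgc'.aestronglyMeasurable M
          (Filter.Eventually.of_forall fun x => by simpa using hM x)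
      have hη : hmem.toLp ∈ formDomain d α := by
        refine mem_formDomain_of_lipschitz h0 h2 (g := fun x => (g x : ℂ)) (L := L) (M := M)
          ?_ ?_ ?_ _ hmem.coeFn_toLp
        · refine LipschitzWith.of_dist_le_mul fun x y => ?_
          have := hL.dist_le_mul x y
          rwa [dist_eq_norm, ← Complex.ofReal_sub, Complex.norm_real, ← dist_eq_norm]
        · intro x hx
          exact hsupp fun h => hx (by simp [h])
        · intro x; simpa using hM x
      have h3 := hf _ hη
      rw [L2.inner_def] at h3
      have h4 : ∫ x in unitCell d, g x • f x = 0 := by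
        rw [← h3]
        refine integral_congr_ae ?_
        filter_upwards [hmem.coeFn_toLp] with x hx
        rw [hx]
        simp [mul_comm]
      rw [← h4]
      symm
      refine setIntegral_eq_integral_of_forall_compl_eq_zero fun x hx => ?_
      have : g x = 0 := by
        by_contra hne
        exact hx (hsupp hne)
      simp [this])
  refine (Lp.eq_zero_iff_ae_eq_zero).2 ?_
  filter_upwards [ae_restrict_mem measurableSet_unitCell, ae_restrict_of_ae key,
    ae_restrict_of_ae (ae_mem_interior_unitCell (d := d))] with x hx h3 h4
  exact h3 (h4 hx)

/-- The graph is that of a (single-valued) operator. -/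
lemma operatorGraph_single_valued {d : ℕ} [NeZero d] {α : ℝ} (hα : α ∈ Set.Ioo (1 : ℝ) 2)
    {μlo μhi : ℝ} {μ : E d → E d → ℝ} (hμ : IsCoefficient μlo μhi μ) (ξ : E d)
    (q : L2Cell d × L2Cell d) (hq : q ∈ operatorGraph hα hμ ξ) (hq0 : q.1 = 0) : q.2 = 0 := by
  refine eq_zero_of_orthogonal_formDomain (by linarith [hα.1]) hα.2 q.2 fun η hη => ?_
  have h0 : ((0 : L2Cell d), (0 : L2Cell d)) ∈ operatorGraph hα hμ ξ := zero_mem _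
  have h1 := hq.2 η hη
  have h2 := h0.2 η hη
  rw [hq0] at h1
  rw [← h1, h2, inner_zero_right]

/-- The operator `𝔸(ξ)` in `L₂(Ω)` generated by the form `a(ξ)`: its domain consists of those `u` in
the form domain for which there is `f ∈ L₂(Ω)` with `a(ξ)[u,η] = (f,η)` for all `η` in the form
domain, and then `𝔸(ξ)u = f`. (Such an `f` is unique, because the form domain is dense.) -/
noncomputable def levyOperator {d : ℕ} [NeZero d] {α : ℝ} (hα : α ∈ Set.Ioo (1 : ℝ) 2)
    {μlo μhi : ℝ} {μ : E d → E d → ℝ} (hμ : IsCoefficient μlo μhi μ) (ξ : E d) :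
    L2Cell d →ₗ.[ℂ] L2Cell d :=
  (operatorGraph hα hμ ξ).toLinearPMap

/-- `R` is the everywhere defined bounded inverse `(A + sI)⁻¹` of the (unbounded) operator
`A + sI`. -/
def IsInverseOfShift {H : Type*} [NormedAddCommGroup H] [NormedSpace ℂ H]
    (A : H →ₗ.[ℂ] H) (s : ℝ) (R : H →L[ℂ] H) : Prop :=
  (∀ f : H, ∃ u : A.domain, (u : H) = R f ∧ A u + (s : ℂ) • (u : H) = f) ∧
    ∀ u : A.domain, R (A u + (s : ℂ) • (u : H)) = u

/-! ### The effective characteristics -/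

/-- The constant `c₀(d,α) = ∫ (1 - cos z₁) |z|^{-(d+α)} dz`. -/
noncomputable def c0 (d : ℕ) [NeZero d] (α : ℝ) : ℝ :=
  ∫ z : E d, (1 - Real.cos (z 0)) / ‖z‖ ^ ((d : ℝ) + α)

/-- The mean value `μ⁰` of the coefficient over `Ω × Ω`. -/
noncomputable def muZero {d : ℕ} (μ : E d → E d → ℝ) : ℝ :=
  ∫ p, μ p.1 p.2 ∂((volume.restrict (unitCell d)).prod (volume.restrict (unitCell d)))

/-- The function `μ_*(z) = ∫_Ω μ(x, z + x) dx - μ⁰`. -/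
noncomputable def muStar {d : ℕ} (μ : E d → E d → ℝ) (z : E d) : ℝ :=
  (∫ x in unitCell d, μ x (z + x)) - muZero μ

/-- `v` solves the `k`-th auxiliary problem: `v` is periodic of class `H^{α/2}`, has zero mean, and
`∫_Ω dx ∫_{ℝ^d} dy μ(x,y) |x-y|^{-(d+α)} (v(x) - v(y) + x_k - y_k) conj(η(x) - η(y)) = 0`
for all periodic `η` of class `H^{α/2}`. -/
def IsCellSolution {d : ℕ} (μ : E d → E d → ℝ) (α : ℝ) (k : Fin d) (v : L2Cell d) : Prop :=
  v ∈ formDomain d α ∧ (∫ x in unitCell d, v x) = 0 ∧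
    ∀ η ∈ formDomain d α,
      ∫ p, (μ p.1 p.2 : ℂ) * ((perExt v p.1 - perExt v p.2 + ((p.1 k - p.2 k : ℝ) : ℂ)) *
        starRingEnd ℂ (perExt η p.1 - perExt η p.2)) ∂(jumpMeasure d α) = 0

/-- The matrix `g⁰`, built from the solutions `v k` of the auxiliary problems. The last integral over
`ℝ^d` is the sum of the integrals over the cells `Ω + n`. (The entries are real numbers, since the
`v k` are real-valued; they are kept in `ℂ` because the `v k` are elements of the complex space.) -/
noncomputable def gZero {d : ℕ} (μ : E d → E d → ℝ) (α : ℝ) (v : Fin d → L2Cell d) :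
    Matrix (Fin d) (Fin d) ℂ := fun j k =>
  (1 / 4 : ℂ) * (∫ p, (μ p.1 p.2 : ℂ) *
      (((p.1 j - p.2 j : ℝ) : ℂ) * (perExt (v k) p.1 - perExt (v k) p.2) +
        ((p.1 k - p.2 k : ℝ) : ℂ) * (perExt (v j) p.1 - perExt (v j) p.2)) ∂(jumpMeasure d α)) +
  ((∑' n : Fin d → ℤ, ∫ z in {z : E d | z - latticePt n ∈ unitCell d},
      muStar μ z * z j * z k / (2 * ‖z‖ ^ ((d : ℝ) + α)) : ℝ) : ℂ)

/-- The quadratic form `⟨gξ,ξ⟩`. -/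
def matForm {d : ℕ} (g : Matrix (Fin d) (Fin d) ℂ) (ξ : E d) : ℂ :=
  ∑ j, ∑ k, g j k * (ξ k : ℂ) * (ξ j : ℂ)

/-- The function `𝟏_Ω` in `L₂(Ω)`. -/
noncomputable def oneCell (d : ℕ) : L2Cell d :=
  indicatorConstLp 2 (measurableSet_unitCell (d := d)) (volume_restrict_unitCell_ne_top d) (1 : ℂ)

/-- The orthogonal projection `P = (·, 𝟏_Ω) 𝟏_Ω` of `L₂(Ω)` onto the constants. -/
noncomputable def P (d : ℕ) : L2Cell d →L[ℂ] L2Cell d :=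
  (innerSL ℂ (oneCell d)).smulRight (oneCell d)

/-- The symbol `μ⁰ c₀ |ξ|^α + ε^α` of the shifted effective operator. -/
noncomputable def effSymbol {d : ℕ} [NeZero d] (μ : E d → E d → ℝ) (α : ℝ) (ξ : E d) (ε : ℝ) : ℝ :=
  muZero μ * c0 d α * ‖ξ‖ ^ α + ε ^ α

/-- The functions `K_m(ξ,ε) = (-1)^m ⟨g⁰ξ,ξ⟩^m (μ⁰ c₀ |ξ|^α + ε^α)^{-m-1}`, where `g = g⁰`. -/
noncomputable def corrK {d : ℕ} [NeZero d] (μ : E d → E d → ℝ) (α : ℝ)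
    (g : Matrix (Fin d) (Fin d) ℂ) (m : ℕ) (ξ : E d) (ε : ℝ) : ℂ :=
  (-1) ^ m * matForm g ξ ^ m * ((effSymbol μ α ξ ε : ℂ)⁻¹) ^ (m + 1)

/-! ### The radius `δ_*` -/

/-- The surface area `ω_d = 2 π^{d/2} / Γ(d/2)` of the unit sphere in `ℝ^d`. -/
noncomputable def sphereArea (d : ℕ) : ℝ := 2 * Real.pi ^ ((d : ℝ) / 2) / Real.Gamma ((d : ℝ) / 2)

/-- `c₃ = (ω_d / (2(2-α)))^{1/2} + ω_d / (α-1)`. -/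
noncomputable def c3 (d : ℕ) (α : ℝ) : ℝ :=
  Real.sqrt (sphereArea d / (2 * (2 - α))) + sphereArea d / (α - 1)

/-- `R(d,α) = √d 2^{1/(d+α)} / (2^{1/(d+α)} - 1)`. -/
noncomputable def radR (d : ℕ) (α : ℝ) : ℝ :=
  Real.sqrt d * 2 ^ (1 / ((d : ℝ) + α)) / (2 ^ (1 / ((d : ℝ) + α)) - 1)

/-- `c₄ = ω_d ((R+√d)^{2-α} / (2(2-α)) + (d+α+1) / ((α-1) R^{α-1}))`. -/
noncomputable def c4 (d : ℕ) (α : ℝ) : ℝ :=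
  sphereArea d * ((radR d α + Real.sqrt d) ^ (2 - α) / (2 * (2 - α)) +
    ((d : ℝ) + α + 1) / ((α - 1) * radR d α ^ (α - 1)))

/-- `d₀ = μlo c₀ π^α`. -/
noncomputable def gapD0 (d : ℕ) [NeZero d] (α μlo : ℝ) : ℝ := μlo * c0 d α * Real.pi ^ α

/-- `C₇ = κ² c₃² μhi⁻¹ (1 + (μhi + 2d₀/3) κ μhi⁻¹) l d₀ / (3π)`, with `κ = 3 + 3 μhi / d₀` and
`l = d₀ (2π+2) / 3`. -/
noncomputable def C7 (d : ℕ) [NeZero d] (α μlo μhi : ℝ) : ℝ :=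
  let d0 := gapD0 d α μlo
  let κ := 3 + 3 * μhi / d0
  let l := d0 * (2 * Real.pi + 2) / 3
  κ ^ 2 * c3 d α ^ 2 * μhi⁻¹ * (1 + (μhi + 2 * d0 / 3) * κ * μhi⁻¹) * (l * d0 / (3 * Real.pi))

/-- `C₁₂ = d C₇ + c₄ μhi`. -/
noncomputable def C12 (d : ℕ) [NeZero d] (α μlo μhi : ℝ) : ℝ :=
  d * C7 d α μlo μhi + c4 d α * μhi

/-- `δ₀ = π (μlo / (3 μhi))^{1/α}`. -/
noncomputable def delta0 (α μlo μhi : ℝ) : ℝ := Real.pi * (μlo / (3 * μhi)) ^ (1 / α)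

/-- `δ_* = min(δ₀, δ₂)` with `δ₂ = (μ⁰ c₀ / (2 C₁₂))^{1/(2-α)}`. -/
noncomputable def deltaStar {d : ℕ} [NeZero d] (α μlo μhi : ℝ) (μ : E d → E d → ℝ) : ℝ :=
  min (delta0 α μlo μhi)
    ((muZero μ * c0 d α / (2 * C12 d α μlo μhi)) ^ (1 / (2 - α)))

end LevyHomog

/-!
Threshold approximation for a periodic Lévy-type operator `𝔸(ξ)` at small quasimomenta.

The proof works with the weak form of the resolvent equation and two test functions; neither
spectral projections nor Fourier series are needed. For `s = ε^α` and `f ∈ L₂(Ω)`, let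
`u = (𝔸(ξ) + s)⁻¹ f`, and split `u = c 𝟏 + r` with `r` of mean zero.

* *The mean zero part.* On functions of mean zero the form `a(ξ)` is bounded below by the square of
  the `H^{α/2}` seminorm when `|ξ|` is small: a Poincaré inequality holds (`norm_le_seminormH`), and
  the twist by `e^{i⟨ξ,x⟩}` is a small perturbation (`re_form_self_ge_seminormH`). Moreover
  `a(ξ)[𝟏, r] = O(|ξ|)` (`norm_form_one_le`); this uses `α > 1`. Testing with `r` bounds the seminorm
  of `r` by `‖f‖ + |c||ξ|`.
* *The constant part.* The test function is the corrected constant `φ = 𝟏 + i ∑ ξ_k v_k`. The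
  equations of the `v_k` cancel the term of `a(ξ)[φ, r]` that is linear in `ξ`, which leaves
  `O(|ξ|^α)` (`norm_form_corrected_le`). The value `a(ξ)[𝟏, φ]` is
  `μ⁰c₀|ξ|^α + ⟨g⁰ξ,ξ⟩ + O(|ξ|^{1+α})` (`norm_form_oneCell_corrected_sub_le`). Here
  `a(ξ)[𝟏, 𝟏]` is the integral of `1 - cos⟨ξ,z⟩` against the averaged coefficient `μ⁰ + μ_*(z)`.
  The part with `μ⁰` gives `μ⁰c₀|ξ|^α` by rotation and scaling (`integral_one_sub_cos`). In the
  other part the function `μ_*` has mean zero on every cell (`integral_muStar_cellAt`), so that the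
  sum over the cells gains one power of decay; this makes the series in `g⁰` convergent and lets
  `1 - cos⟨ξ,z⟩` be replaced by `⟨ξ,z⟩²/2`, although the kernel has no second moment
  (`summable_muStar_cosRem`, `norm_form_oneCell_sub_le`).

Together, with `S = μ⁰c₀|ξ|^α + ε^α`, the resolvent is `(S + ⟨g⁰ξ,ξ⟩)⁻¹ P` up to `O(1 + |ξ|/S)`
(`norm_resolvent_sub_le`). The terms `K_m` are those of the geometric series for
`(S + ⟨g⁰ξ,ξ⟩)⁻¹` (`norm_inv_add_sub_sum_le`), whose remainder after `N` terms is
`O(|ξ|^{(N+1)(2-α)}/S)` because `|⟨g⁰ξ,ξ⟩|/S = O(|ξ|^{2-α})`. Both errors are at most a constant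
times `ε^{β-α}` with `β = min(1, (N+1)(2-α))`, by the interpolation `|ξ|^β/S ≤ C ε^{β-α}`
(`rpow_div_le`).

This covers `ε ≤ 1` and `|ξ| ≤ δ` with a radius `δ` that depends only on `d, α, μ₋, μ₊`. For `ε ≥ 1`
all terms are `O(ε^{-α})`. For `δ ≤ |ξ| ≤ δ_*`, the inequality `δ_* ≤ π` keeps `ξ` away from the
nonzero points of the dual lattice, the form has a positive lower bound
(`norm_sq_mul_le_sq_lpNorm_twistDiff`), and all terms are bounded. In both cases the triangle
inequality is enough (`norm_sub_sub_sum_le`).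

The resolvent and the `v_k` come from the Riesz representation theorem in the energy space, realized
as a closed graph (`exists_weak_resolvent`, `existsUnique_isCellSolution`).
-/

open scoped ENNReal

namespace LevyHomog

/-! ### The Lévy measure and the change of variables `y = x + z` -/

/-- The Lévy measure `|z|^{-(d+α)} dz` on `ℝ^d`. -/
noncomputable def levyMeasure (d : ℕ) (α : ℝ) : Measure (E d) :=
  volume.withDensity fun z => ENNReal.ofReal (‖z‖ ^ (-((d : ℝ) + α)))

instance sigmaFinite_levyMeasure (d : ℕ) (α : ℝ) : SigmaFinite (levyMeasure d α) :=
  SigmaFinite.withDensity_ofReal _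

instance isProbabilityMeasure_cell (d : ℕ) :
    IsProbabilityMeasure ((volume : Measure (E d)).restrict (unitCell d)) := by
  constructor
  rw [Measure.restrict_apply_univ]
  have h : unitCell d = (WithLp.ofLp : E d → Fin d → ℝ) ⁻¹'
      (Set.univ.pi fun _ => Set.Ico (0 : ℝ) 1) := by
    ext x; simp [unitCell]
  rw [h, (PiLp.volume_preserving_ofLp (Fin d)).measure_preimage
    (MeasurableSet.univ_pi fun _ => measurableSet_Ico).nullMeasurableSet, Real.volume_pi_Ico]
  simp

/-- Integration against the jump measure amounts to integrating over a base point `x ∈ Ω` and a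
displacement `z` distributed according to the Lévy measure. -/
lemma measurePreserving_jump (d : ℕ) (α : ℝ) :
    MeasurePreserving (fun q : E d × E d => (q.1, q.1 + q.2))
      (((volume : Measure (E d)).restrict (unitCell d)).prod (levyMeasure d α))
      (jumpMeasure d α) := by
  have hT := measurePreserving_prod_add ((volume : Measure (E d)).restrict (unitCell d))
    (volume : Measure (E d))
  refine ⟨hT.measurable, ?_⟩
  have hw : Measurable fun z : E d => ENNReal.ofReal (‖z‖ ^ (-((d : ℝ) + α))) := by fun_prop
  unfold levyMeasure jumpMeasure
  rw [prod_withDensity_right hw]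
  ext s hs
  rw [Measure.map_apply hT.measurable hs, withDensity_apply _ (hT.measurable hs),
    withDensity_apply _ hs]
  have := hT.setLIntegral_comp_preimage hs
    (f := fun p : E d × E d => ENNReal.ofReal (‖p.1 - p.2‖ ^ (-((d : ℝ) + α)))) (by fun_prop)
  rw [← this]
  simp

/-! ### The lattice of cells and periodicity -/

/-- The translate `Ω + n` of the periodicity cell. -/
def cellAt {d : ℕ} (n : Fin d → ℤ) : Set (E d) := {z | z - latticePt n ∈ unitCell d}

lemma measurableSet_cellAt {d : ℕ} (n : Fin d → ℤ) : MeasurableSet (cellAt n) :=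
  (measurable_id.sub_const (latticePt n)) measurableSet_unitCell

lemma mem_cellAt_iff {d : ℕ} {n : Fin d → ℤ} {z : E d} :
    z ∈ cellAt n ↔ n = fun i => ⌊z i⌋ := by
  constructor
  · intro h
    funext i
    have h1 := (h i).1
    have h2 := (h i).2
    simp only [latticePt, PiLp.sub_apply] at h1 h2
    symm
    rw [Int.floor_eq_iff]
    constructor <;> linarith
  · rintro rfl i
    simp only [latticePt, PiLp.sub_apply, Set.mem_Ico]
    constructor
    · linarith [Int.floor_le (z i)]
    · linarith [Int.lt_floor_add_one (z i)]

lemma iUnion_cellAt {d : ℕ} : ⋃ n : Fin d → ℤ, cellAt n = Set.univ :=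
  Set.eq_univ_of_forall fun z => Set.mem_iUnion.2 ⟨fun i => ⌊z i⌋, mem_cellAt_iff.2 rfl⟩

lemma pairwise_disjoint_cellAt {d : ℕ} :
    Pairwise (Function.onFun Disjoint (cellAt : (Fin d → ℤ) → Set (E d))) := by
  intro m n hmn
  refine Set.disjoint_left.2 fun z hm hn => hmn ?_
  rw [mem_cellAt_iff.1 hm, mem_cellAt_iff.1 hn]

lemma toCell_add_latticePt {d : ℕ} (x : E d) (n : Fin d → ℤ) :
    toCell (x + latticePt n) = toCell x := by
  ext i; simp [toCell, latticePt]

lemma lintegral_eq_tsum_cellAt {d : ℕ} (f : E d → ℝ≥0∞) (μ : Measure (E d)) :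
    ∫⁻ z, f z ∂μ = ∑' n : Fin d → ℤ, ∫⁻ z in cellAt n, f z ∂μ := by
  rw [← lintegral_iUnion measurableSet_cellAt pairwise_disjoint_cellAt, iUnion_cellAt,
    Measure.restrict_univ]

lemma setLIntegral_cellAt {d : ℕ} (f : E d → ℝ≥0∞) (n : Fin d → ℤ) :
    ∫⁻ z in cellAt n, f z = ∫⁻ x in unitCell d, f (x + latticePt n) := by
  have h : MeasurePreserving (fun x : E d => x + latticePt n) volume volume :=
    measurePreserving_add_right volume (latticePt n)
  have h2 := h.setLIntegral_comp_preimage_emb (measurableEmbedding_addRight (latticePt n))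
    f (cellAt n)
  rw [← h2]
  have : (fun x : E d => x + latticePt n) ⁻¹' cellAt n = unitCell d := by
    ext x; simp [cellAt]
  rw [this]

/-- The integral of a periodic function over a translate of the cell does not depend on the
translate. -/
lemma lintegral_cell_translate {d : ℕ} {F : E d → ℝ≥0∞} (hF : Measurable F) (a : E d) :
    ∫⁻ x in unitCell d, F (toCell (x + a)) = ∫⁻ x in unitCell d, F x := by
  set S : Set (E d) := {y | y - a ∈ unitCell d} with hS
  have hSm : MeasurableSet S := (measurable_id.sub_const a) measurableSet_unitCell
  have h1 : ∫⁻ x in unitCell d, F (toCell (x + a)) = ∫⁻ y in S, F (toCell y) := by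
    have h : MeasurePreserving (fun x : E d => x + a) volume volume :=
      measurePreserving_add_right volume a
    have h2 := h.setLIntegral_comp_preimage_emb (measurableEmbedding_addRight a)
      (fun y => F (toCell y)) S
    rw [← h2]
    have : (fun x : E d => x + a) ⁻¹' S = unitCell d := by
      ext x; simp [hS]
    rw [this]
  have hFt : Measurable fun y : E d => F (toCell y) := hF.comp measurable_toCell
  rw [h1, ← lintegral_indicator hSm, lintegral_eq_tsum_cellAt]
  simp_rw [setLIntegral_cellAt]
  rw [← lintegral_tsum]
  · refine setLIntegral_congr_fun measurableSet_unitCell fun x hx => ?_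
    change ∑' n : Fin d → ℤ, S.indicator (fun y => F (toCell y)) (x + latticePt n) = F x
    rw [tsum_eq_single (fun i => -⌊x i - a i⌋)]
    · rw [Set.indicator_of_mem, toCell_add_latticePt, toCell_eq_self hx]
      intro i
      have : (x + latticePt (fun i => -⌊x i - a i⌋) - a) i = Int.fract (x i - a i) := by
        simp only [latticePt, Int.cast_neg, PiLp.sub_apply, PiLp.add_apply, Int.fract]; ring
      rw [this]
      exact ⟨Int.fract_nonneg _, Int.fract_lt_one _⟩
    · intro n hn
      rw [Set.indicator_of_notMem]
      intro hm
      refine hn (funext fun i => ?_)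
      have h1 := (hm i).1
      have h2 := (hm i).2
      simp only [latticePt, PiLp.sub_apply, PiLp.add_apply] at h1 h2
      have h3 : ⌊x i - a i⌋ = -n i := by
        rw [Int.floor_eq_iff]
        push_cast
        constructor <;> linarith
      rw [h3, neg_neg]
  · intro n
    exact ((hFt.indicator hSm).comp (measurable_add_const _)).aemeasurable

lemma lintegral_jump_fst {d : ℕ} {α : ℝ} {F h : E d → ℝ≥0∞} (hF : Measurable F)
    (hh : Measurable h) :
    ∫⁻ p, F p.1 * h (p.2 - p.1) ∂(jumpMeasure d α) =
      (∫⁻ x in unitCell d, F x) * ∫⁻ z, h z ∂(levyMeasure d α) := by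
  rw [← (measurePreserving_jump d α).lintegral_comp (by fun_prop)]
  simp only [add_sub_cancel_left]
  exact lintegral_prod_mul hF.aemeasurable hh.aemeasurable

lemma lintegral_jump_snd {d : ℕ} {α : ℝ} {F h : E d → ℝ≥0∞} (hF : Measurable F)
    (hh : Measurable h) :
    ∫⁻ p, F (toCell p.2) * h (p.2 - p.1) ∂(jumpMeasure d α) =
      (∫⁻ x in unitCell d, F x) * ∫⁻ z, h z ∂(levyMeasure d α) := by
  have hFt : Measurable fun y : E d => F (toCell y) := hF.comp measurable_toCell
  rw [← (measurePreserving_jump d α).lintegral_comp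
    (f := fun p : E d × E d => F (toCell p.2) * h (p.2 - p.1))
    ((hFt.comp measurable_snd).mul (hh.comp (by fun_prop)))]
  simp only [add_sub_cancel_left]
  rw [lintegral_prod_symm]
  · rw [← lintegral_const_mul _ hh]
    refine lintegral_congr fun z => ?_
    have hm : Measurable fun x : E d => F (toCell (x + z)) :=
      hFt.comp (measurable_add_const z)
    change ∫⁻ x in unitCell d, F (toCell (x + z)) * h z = _
    rw [lintegral_mul_const _ hm, lintegral_cell_translate hF]
  · exact ((hFt.comp (by fun_prop)).mul (hh.comp measurable_snd)).aemeasurable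

/-! ### The weight `min(t, t²)` and its Lévy integral -/

/-- The weight `min(t, t²)`, which controls first and second order Taylor remainders of `e^{it}`,
and which is integrable against the Lévy measure because `1 < α < 2`. -/
noncomputable def taylorWeight (t : ℝ) : ℝ := min t (t ^ 2)

lemma taylorWeight_nonneg {t : ℝ} (ht : 0 ≤ t) : 0 ≤ taylorWeight t :=
  le_min ht (sq_nonneg t)

lemma measurable_taylorWeight : Measurable taylorWeight := by
  unfold taylorWeight; fun_prop

lemma taylorWeight_mono {a b : ℝ} (ha : 0 ≤ a) (hab : a ≤ b) :
    taylorWeight a ≤ taylorWeight b :=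
  min_le_min hab (pow_le_pow_left₀ ha hab 2)

lemma integrable_taylorWeight {d : ℕ} [NeZero d] {α : ℝ} (hα : α ∈ Set.Ioo (1 : ℝ) 2) :
    Integrable (fun z : E d => taylorWeight ‖z‖ * ‖z‖ ^ (-((d : ℝ) + α))) volume := by
  have := nontrivial_E d
  have hd : 1 ≤ d := Nat.one_le_iff_ne_zero.2 (NeZero.ne d)
  refine (integrable_fun_norm_addHaar (E := E d) volume
    (f := fun r : ℝ => taylorWeight r * r ^ (-((d : ℝ) + α)))).2 ?_
  simp only [finrank_euclideanSpace, Fintype.card_fin]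
  have key : ∀ r : ℝ, 0 < r → ∀ s : ℝ,
      (r ^ (d - 1)) • (r ^ s * r ^ (-((d : ℝ) + α))) = r ^ (s - 1 - α) := by
    intro r hr s
    rw [smul_eq_mul, ← Real.rpow_natCast, ← Real.rpow_add hr, ← Real.rpow_add hr]
    congr 1
    push_cast [Nat.cast_sub hd]
    ring
  rw [← Set.Ioc_union_Ioi_eq_Ioi (zero_le_one' ℝ)]
  refine IntegrableOn.union ?_ ?_
  · have h : IntegrableOn (fun r : ℝ => r ^ (2 - 1 - α)) (Set.Ioc 0 1) :=
      (intervalIntegrable_iff_integrableOn_Ioc_of_le zero_le_one).1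
        (intervalIntegral.intervalIntegrable_rpow' (by linarith [hα.2]))
    refine h.congr_fun (fun r hr => ?_) measurableSet_Ioc
    have h1 : r ^ 2 ≤ r := by nlinarith [hr.1, hr.2]
    have := key r hr.1 2
    simp only [taylorWeight, min_eq_right h1]
    rw [← this, Real.rpow_two]
  · have h : IntegrableOn (fun r : ℝ => r ^ (1 - 1 - α)) (Set.Ioi 1) :=
      integrableOn_Ioi_rpow_of_lt (by linarith [hα.1]) one_pos
    refine h.congr_fun (fun r hr => ?_) measurableSet_Ioi
    have hr' : (1 : ℝ) < r := hr
    have h1 : r ≤ r ^ 2 := by nlinarith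
    have := key r (by linarith) 1
    simp only [taylorWeight, min_eq_left h1]
    rw [← this, Real.rpow_one]

/-- The Lévy integral of `min(|z|, |z|²)`. -/
noncomputable def weightInt (d : ℕ) (α : ℝ) : ℝ :=
  ∫ z : E d, taylorWeight ‖z‖ * ‖z‖ ^ (-((d : ℝ) + α))

lemma weightInt_nonneg (d : ℕ) (α : ℝ) : 0 ≤ weightInt d α :=
  integral_nonneg fun z => mul_nonneg (taylorWeight_nonneg (norm_nonneg z))
    (Real.rpow_nonneg (norm_nonneg z) _)

lemma lintegral_levy {d : ℕ} {α : ℝ} {h : E d → ℝ≥0∞} (hh : Measurable h) :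
    ∫⁻ z, h z ∂(levyMeasure d α) =
      ∫⁻ z, h z * ENNReal.ofReal (‖z‖ ^ (-((d : ℝ) + α))) := by
  unfold levyMeasure
  rw [lintegral_withDensity_eq_lintegral_mul _ (by fun_prop) hh]
  simp only [Pi.mul_apply, mul_comm]

/-- Homogeneity of the Lévy measure. -/
lemma lintegral_levy_smul {d : ℕ} {α : ℝ} {h : E d → ℝ≥0∞} (hh : Measurable h) {t : ℝ}
    (ht : 0 < t) :
    ∫⁻ z, h (t • z) ∂(levyMeasure d α) =
      ENNReal.ofReal (t ^ α) * ∫⁻ z, h z ∂(levyMeasure d α) := by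
  have hG : Measurable fun z : E d => h z * ENNReal.ofReal (‖z‖ ^ (-((d : ℝ) + α))) := by
    fun_prop
  rw [lintegral_levy hh, lintegral_levy (by fun_prop)]
  have hmap := Measure.map_addHaar_smul (volume : Measure (E d)) (r := t) ht.ne'
  have h1 : ∫⁻ z : E d, h (t • z) * ENNReal.ofReal (‖t • z‖ ^ (-((d : ℝ) + α))) =
      ENNReal.ofReal |(t ^ Module.finrank ℝ (E d))⁻¹| *
        ∫⁻ z : E d, h z * ENNReal.ofReal (‖z‖ ^ (-((d : ℝ) + α))) := by
    rw [← lintegral_map (f := fun z : E d => h z * ENNReal.ofReal (‖z‖ ^ (-((d : ℝ) + α))))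
      hG (measurable_const_smul t), hmap, lintegral_smul_measure, smul_eq_mul]
  have h2 : ∀ z : E d, h (t • z) * ENNReal.ofReal (‖z‖ ^ (-((d : ℝ) + α))) =
      ENNReal.ofReal (t ^ ((d : ℝ) + α)) *
        (h (t • z) * ENNReal.ofReal (‖t • z‖ ^ (-((d : ℝ) + α)))) := by
    intro z
    rw [mul_left_comm, ← ENNReal.ofReal_mul (by positivity)]
    congr 2
    rw [norm_smul, Real.norm_of_nonneg ht.le, Real.mul_rpow ht.le (norm_nonneg _), ← mul_assoc,
      ← Real.rpow_add ht]
    simp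
  simp_rw [h2]
  rw [lintegral_const_mul _ (by fun_prop), h1, ← mul_assoc, ← ENNReal.ofReal_mul (by positivity)]
  congr 2
  rw [abs_of_pos (by positivity), Real.rpow_add ht, finrank_euclideanSpace, Fintype.card_fin,
    Real.rpow_natCast]
  field_simp

/-- The Lévy integral of `min(t|z|, t²|z|²)` is proportional to `t^α`. -/
lemma lintegral_taylorWeight {d : ℕ} [NeZero d] {α : ℝ} (hα : α ∈ Set.Ioo (1 : ℝ) 2) {t : ℝ}
    (ht : 0 ≤ t) :
    ∫⁻ z : E d, ENNReal.ofReal (taylorWeight (t * ‖z‖)) ∂(levyMeasure d α) =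
      ENNReal.ofReal (t ^ α * weightInt d α) := by
  have hm : Measurable fun z : E d => ENNReal.ofReal (taylorWeight ‖z‖) :=
    (measurable_taylorWeight.comp measurable_norm).ennreal_ofReal
  have hone : ∫⁻ z : E d, ENNReal.ofReal (taylorWeight ‖z‖) ∂(levyMeasure d α) =
      ENNReal.ofReal (weightInt d α) := by
    rw [lintegral_levy hm, weightInt, ofReal_integral_eq_lintegral_ofReal
      (integrable_taylorWeight hα)]
    · simp_rw [ENNReal.ofReal_mul (taylorWeight_nonneg (norm_nonneg _))]
    · exact Filter.Eventually.of_forall fun z => mul_nonneg (taylorWeight_nonneg (norm_nonneg z))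
        (Real.rpow_nonneg (norm_nonneg z) _)
  rcases ht.eq_or_lt with rfl | ht
  · simp [taylorWeight, Real.zero_rpow (show α ≠ 0 by linarith [hα.1])]
  · have := lintegral_levy_smul (α := α) hm ht
    rw [hone, ← ENNReal.ofReal_mul (by positivity)] at this
    rw [← this]
    simp_rw [norm_smul, Real.norm_of_nonneg ht.le]

/-! ### Square integrable functions -/

section SquareIntegrable

variable {X : Type*} [MeasurableSpace X] {m : Measure X}

lemma sq_lpNorm_two {f : X → ℂ} (hf : MemLp f 2 m) : lpNorm f 2 m ^ 2 = ∫ x, ‖f x‖ ^ 2 ∂m := by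
  rw [lpNorm_eq_integral_norm_rpow_toReal (by norm_num) (by norm_num) hf.1]
  have h0 : 0 ≤ ∫ x, ‖f x‖ ^ 2 ∂m := integral_nonneg fun x => sq_nonneg _
  simp only [ENNReal.toReal_ofNat, Real.rpow_two]
  rw [← Real.rpow_natCast, ← Real.rpow_mul h0]
  norm_num

lemma lintegral_sq_norm {f : X → ℂ} (hf : MemLp f 2 m) :
    ∫⁻ x, ENNReal.ofReal (‖f x‖ ^ 2) ∂m = ENNReal.ofReal (lpNorm f 2 m ^ 2) := by
  rw [sq_lpNorm_two hf, ofReal_integral_eq_lintegral_ofReal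
    ((memLp_two_iff_integrable_sq_norm hf.1).1 hf)]
  exact Filter.Eventually.of_forall fun x => sq_nonneg _

lemma memLp_two_of_lintegral_le {f : X → ℂ} (hf : AEStronglyMeasurable f m) {C : ℝ}
    (h : ∫⁻ x, ENNReal.ofReal (‖f x‖ ^ 2) ∂m ≤ ENNReal.ofReal C) : MemLp f 2 m := by
  rw [memLp_two_iff_integrable_sq_norm hf]
  refine ⟨(hf.norm.pow 2), ?_⟩
  rw [hasFiniteIntegral_iff_ofReal (Filter.Eventually.of_forall fun x => sq_nonneg _)]
  exact h.trans_lt ENNReal.ofReal_lt_top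

lemma lpNorm_two_le_of_lintegral_le {f : X → ℂ} (hf : AEStronglyMeasurable f m) {C : ℝ}
    (hC : 0 ≤ C) (h : ∫⁻ x, ENNReal.ofReal (‖f x‖ ^ 2) ∂m ≤ ENNReal.ofReal (C ^ 2)) :
    lpNorm f 2 m ≤ C := by
  rw [lintegral_sq_norm (memLp_two_of_lintegral_le hf h)] at h
  have h2 := (ENNReal.ofReal_le_ofReal_iff (sq_nonneg C)).1 h
  exact le_of_sq_le_sq h2 hC

/-- The Cauchy–Schwarz inequality with a bounded weight. -/
lemma norm_integral_weighted_mul_conj_le {w f g : X → ℂ} {K : ℝ} (hK : 0 ≤ K)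
    (hw : ∀ᵐ x ∂m, ‖w x‖ ≤ K) (hf : MemLp f 2 m) (hg : MemLp g 2 m) :
    ‖∫ x, w x * (f x * starRingEnd ℂ (g x)) ∂m‖ ≤ K * (lpNorm f 2 m * lpNorm g 2 m) := by
  have hint : Integrable (fun x => K * (‖f x‖ * ‖g x‖)) m :=
    (hf.norm.integrable_mul hg.norm).const_mul K
  have h1 : ‖∫ x, w x * (f x * starRingEnd ℂ (g x)) ∂m‖ ≤ ∫ x, K * (‖f x‖ * ‖g x‖) ∂m := by
    refine norm_integral_le_of_norm_le hint ?_
    filter_upwards [hw] with x hx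
    rw [norm_mul, norm_mul, RCLike.norm_conj]
    exact mul_le_mul_of_nonneg_right hx (by positivity)
  rw [integral_const_mul] at h1
  refine h1.trans (mul_le_mul_of_nonneg_left ?_ hK)
  have h2 := integral_mul_le_Lp_mul_Lq_of_nonneg (μ := m) (p := 2) (q := 2)
    Real.HolderConjugate.two_two (f := fun x => ‖f x‖) (g := fun x => ‖g x‖)
    (Filter.Eventually.of_forall fun x => norm_nonneg _)
    (Filter.Eventually.of_forall fun x => norm_nonneg _)
    (by simpa using hf.norm) (by simpa using hg.norm)
  refine h2.trans (le_of_eq ?_)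
  have h3 : ∀ f : X → ℂ, MemLp f 2 m →
      (∫ x, ‖f x‖ ^ (2 : ℝ) ∂m) ^ (1 / (2 : ℝ)) = lpNorm f 2 m := by
    intro f hf
    simp only [Real.rpow_two]
    rw [← sq_lpNorm_two hf, ← Real.sqrt_eq_rpow, Real.sqrt_sq lpNorm_nonneg]
  rw [h3 f hf, h3 g hg]

lemma lpNorm_congr_norm {f g : X → ℂ} (hf : AEStronglyMeasurable f m)
    (hg : AEStronglyMeasurable g m) (h : ∀ᵐ x ∂m, ‖f x‖ = ‖g x‖) :
    lpNorm f 2 m = lpNorm g 2 m := by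
  rw [← toReal_eLpNorm hf, ← toReal_eLpNorm hg, eLpNorm_congr_norm_ae h]

/-- Averaging `|w(x) - θ w(y)|²` over two independent points, for a unimodular `θ`. -/
lemma integral_sq_sub_unimodular_mul [IsProbabilityMeasure m] {w : X → ℂ} (hw : MemLp w 2 m)
    {θ : ℂ} (hθ : ‖θ‖ = 1) :
    Integrable (fun p : X × X => ‖w p.1 - θ * w p.2‖ ^ 2) (m.prod m) ∧
    ∫ p : X × X, ‖w p.1 - θ * w p.2‖ ^ 2 ∂(m.prod m) =
      2 * ∫ x, ‖w x‖ ^ 2 ∂m - 2 * θ.re * ‖∫ x, w x ∂m‖ ^ 2 := by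
  have hsq : Integrable (fun x => ‖w x‖ ^ 2) m := (memLp_two_iff_integrable_sq_norm hw.1).1 hw
  have hi : Integrable w m := hw.integrable (by norm_num)
  have h1 : Integrable (fun p : X × X => ‖w p.1‖ ^ 2) (m.prod m) := hsq.comp_fst m
  have h2 : Integrable (fun p : X × X => ‖w p.2‖ ^ 2) (m.prod m) := hsq.comp_snd m
  have hic : Integrable (fun x => starRingEnd ℂ (w x)) m :=
    (hw.star.integrable (by norm_num))
  have h3 : Integrable (fun p : X × X => w p.1 * starRingEnd ℂ (w p.2)) (m.prod m) :=
    hi.mul_prod hic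
  have h4 := (h3.const_mul (starRingEnd ℂ θ)).re.const_mul 2
  have hpt : ∀ p : X × X, ‖w p.1 - θ * w p.2‖ ^ 2 = ‖w p.1‖ ^ 2 + ‖w p.2‖ ^ 2 -
      2 * RCLike.re (starRingEnd ℂ θ * (w p.1 * starRingEnd ℂ (w p.2))) := by
    intro p
    rw [← Complex.normSq_eq_norm_sq, Complex.normSq_sub, Complex.normSq_eq_norm_sq,
      Complex.normSq_eq_norm_sq, norm_mul, hθ, one_mul]
    simp only [map_mul, RCLike.re_eq_complex_re]
    ring_nf
  simp_rw [hpt]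
  have h12 : Integrable (fun p : X × X => ‖w p.1‖ ^ 2 + ‖w p.2‖ ^ 2) (m.prod m) := h1.add h2
  have h5 : ∫ p : X × X, RCLike.re (starRingEnd ℂ θ * (w p.1 * starRingEnd ℂ (w p.2)))
      ∂(m.prod m) = θ.re * ‖∫ x, w x ∂m‖ ^ 2 := by
    rw [integral_re (h3.const_mul _), integral_const_mul,
      integral_prod_mul w (fun x => starRingEnd ℂ (w x)), integral_conj, Complex.mul_conj,
      Complex.normSq_eq_norm_sq]
    simp [-Complex.ofReal_pow]
  refine ⟨h12.sub h4, ?_⟩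
  rw [integral_sub h12 h4, integral_add h1 h2, integral_const_mul, h5,
    integral_fun_fst (fun x => ‖w x‖ ^ 2), integral_fun_snd (fun x => ‖w x‖ ^ 2)]
  simp
  ring

end SquareIntegrable

/-! ### Norms in `L₂(Ω)` -/

lemma lintegral_sq_L2Cell {d : ℕ} (u : L2Cell d) :
    ∫⁻ x in unitCell d, ENNReal.ofReal (‖u x‖ ^ 2) = ENNReal.ofReal (‖u‖ ^ 2) := by
  rw [lintegral_sq_norm (Lp.memLp u), Lp.norm_def, toReal_eLpNorm (Lp.memLp u).1]

lemma lintegral_norm_L2Cell_le {d : ℕ} (u : L2Cell d) :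
    ∫⁻ x in unitCell d, ENNReal.ofReal ‖u x‖ ≤ ENNReal.ofReal ‖u‖ := by
  have h := eLpNorm_le_eLpNorm_of_exponent_le
    (μ := (volume : Measure (E d)).restrict (unitCell d)) (f := u) (p := 1) (q := 2)
    (by norm_num) (Lp.memLp u).1
  rw [eLpNorm_one_eq_lintegral_enorm] at h
  simp only [ofReal_norm, ← Lp.enorm_def] at h ⊢
  exact h

lemma coeFn_oneCell (d : ℕ) :
    ∀ᵐ x ∂((volume : Measure (E d)).restrict (unitCell d)), oneCell d x = 1 := by
  filter_upwards [indicatorConstLp_coeFn (p := 2) (hs := measurableSet_unitCell (d := d))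
    (hμs := volume_restrict_unitCell_ne_top d) (c := (1 : ℂ)),
    ae_restrict_mem measurableSet_unitCell] with x hx hxc
  rw [oneCell, hx, Set.indicator_of_mem hxc]

lemma perExt_oneCell (d : ℕ) : ∀ᵐ x : E d, perExt (oneCell d) x = 1 := by
  filter_upwards [quasiMeasurePreserving_toCell.ae (coeFn_oneCell d)] with x hx
  exact hx

lemma norm_oneCell (d : ℕ) : ‖oneCell d‖ = 1 := by
  have h := lintegral_sq_L2Cell (oneCell d)
  have h2 : ∫⁻ x in unitCell d, ENNReal.ofReal (‖oneCell d x‖ ^ 2) = 1 := by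
    rw [lintegral_congr_ae (g := fun _ => 1)]
    · simp
    · filter_upwards [coeFn_oneCell d] with x hx
      simp [hx]
  rw [h2] at h
  have h3 : ‖oneCell d‖ ^ 2 = 1 := by
    have := congrArg ENNReal.toReal h
    rwa [ENNReal.toReal_ofReal (sq_nonneg _), ENNReal.toReal_one, eq_comm] at this
  nlinarith [norm_nonneg (oneCell d)]

lemma inner_oneCell {d : ℕ} (u : L2Cell d) :
    inner ℂ (oneCell d) u = ∫ x in unitCell d, u x := by
  rw [L2.inner_def]
  refine integral_congr_ae ?_
  filter_upwards [coeFn_oneCell d] with x hx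
  simp [hx]

lemma integral_sq_L2Cell {d : ℕ} (u : L2Cell d) : ∫ x in unitCell d, ‖u x‖ ^ 2 = ‖u‖ ^ 2 := by
  rw [← sq_lpNorm_two (Lp.memLp u), Lp.norm_def, toReal_eLpNorm (Lp.memLp u).1]

/-! ### Elementary inequalities for `e^{it}` -/

lemma norm_exp_I_mul_sub_one_sq_le (t : ℝ) :
    ‖Complex.exp (Complex.I * t) - 1‖ ^ 2 ≤ 4 * taylorWeight |t| := by
  have h1 : ‖Complex.exp (Complex.I * t) - 1‖ ≤ |t| := Real.norm_exp_I_mul_ofReal_sub_one_le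
  have h2 : ‖Complex.exp (Complex.I * t) - 1‖ ≤ 2 := by
    refine (norm_sub_le _ _).trans ?_
    rw [mul_comm, Complex.norm_exp_ofReal_mul_I, norm_one]; norm_num
  have h0 := norm_nonneg (Complex.exp (Complex.I * t) - 1)
  have h3 : 0 ≤ |t| := abs_nonneg t
  rw [taylorWeight, mul_min_of_nonneg _ _ (by norm_num : (0 : ℝ) ≤ 4)]
  refine le_min ?_ ?_ <;> nlinarith

lemma norm_exp_I_mul_sub_one_sub_le (t : ℝ) :
    ‖Complex.exp (Complex.I * t) - 1 - Complex.I * t‖ ≤ 2 * taylorWeight |t| := by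
  have hn : ‖Complex.I * (t : ℂ)‖ = |t| := by simp
  have h1 : ‖Complex.exp (Complex.I * t) - 1‖ ≤ |t| := Real.norm_exp_I_mul_ofReal_sub_one_le
  have h2 : ‖Complex.exp (Complex.I * t) - 1 - Complex.I * t‖ ≤ 2 * |t| := by
    refine (norm_sub_le _ _).trans ?_
    rw [hn]; linarith
  have h3 : 0 ≤ |t| := abs_nonneg t
  rw [taylorWeight, mul_min_of_nonneg _ _ (by norm_num : (0 : ℝ) ≤ 2)]
  refine le_min h2 ?_
  rcases le_total |t| 1 with h | h
  · have := Complex.norm_exp_sub_one_sub_id_le (x := Complex.I * t) (by rw [hn]; exact h)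
    rw [hn] at this
    nlinarith
  · nlinarith

/-! ### Differences of periodic functions -/

/-- The difference `u(x) - u(y)` of a periodically extended function. -/
noncomputable def cellDiff {d : ℕ} (u : L2Cell d) (p : E d × E d) : ℂ :=
  perExt u p.1 - perExt u p.2

/-- The seminorm `(∫_Ω ∫_{ℝ^d} |u(x) - u(y)|² |x - y|^{-(d+α)} dy dx)^{1/2}`. -/
noncomputable def seminormH {d : ℕ} (α : ℝ) (u : L2Cell d) : ℝ :=
  lpNorm (cellDiff u) 2 (jumpMeasure d α)

lemma seminormH_nonneg {d : ℕ} (α : ℝ) (u : L2Cell d) : 0 ≤ seminormH α u := lpNorm_nonneg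

/-- The part `(e^{i⟨ξ,x⟩} - e^{i⟨ξ,y⟩}) u(x)` of the twisted difference. -/
noncomputable def twistRem {d : ℕ} (ξ : E d) (u : L2Cell d) (p : E d × E d) : ℂ :=
  (Complex.exp (Complex.I * (inner ℝ ξ p.1 : ℝ)) -
    Complex.exp (Complex.I * (inner ℝ ξ p.2 : ℝ))) * perExt u p.1

/-- The part `e^{i⟨ξ,y⟩} (u(x) - u(y))` of the twisted difference. -/
noncomputable def twistMain {d : ℕ} (ξ : E d) (u : L2Cell d) (p : E d × E d) : ℂ :=
  Complex.exp (Complex.I * (inner ℝ ξ p.2 : ℝ)) * cellDiff u p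

section

variable {d : ℕ}

lemma twistDiff_eq_add (ξ : E d) (u : L2Cell d) :
    twistDiff ξ u = twistMain ξ u + twistRem ξ u := by
  funext p
  simp only [twistDiff, twistMain, twistRem, cellDiff, Pi.add_apply]
  ring

lemma norm_exp_I_inner (ξ x : E d) :
    ‖Complex.exp (Complex.I * (inner ℝ ξ x : ℝ))‖ = 1 := by
  rw [mul_comm]; exact Complex.norm_exp_ofReal_mul_I _

lemma measurable_exp_I_inner (ξ : E d) :
    Measurable fun x : E d => Complex.exp (Complex.I * (inner ℝ ξ x : ℝ)) :=
  Continuous.measurable (by fun_prop)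

lemma measurable_perExt (u : L2Cell d) : Measurable (perExt u) :=
  (stronglyMeasurable_perExt u).measurable

lemma measurable_cellDiff (u : L2Cell d) : Measurable (cellDiff u) :=
  ((measurable_perExt u).comp measurable_fst).sub ((measurable_perExt u).comp measurable_snd)

lemma measurable_twistMain (ξ : E d) (u : L2Cell d) : Measurable (twistMain ξ u) :=
  ((measurable_exp_I_inner ξ).comp measurable_snd).mul (measurable_cellDiff u)

lemma measurable_twistRem (ξ : E d) (u : L2Cell d) : Measurable (twistRem ξ u) :=
  (((measurable_exp_I_inner ξ).comp measurable_fst).sub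
    ((measurable_exp_I_inner ξ).comp measurable_snd)).mul
      ((measurable_perExt u).comp measurable_fst)

lemma norm_twistMain (ξ : E d) (u : L2Cell d) (p : E d × E d) :
    ‖twistMain ξ u p‖ = ‖cellDiff u p‖ := by
  rw [twistMain, norm_mul, norm_exp_I_inner, one_mul]

lemma exp_sub_exp (ξ x y : E d) :
    Complex.exp (Complex.I * (inner ℝ ξ x : ℝ)) - Complex.exp (Complex.I * (inner ℝ ξ y : ℝ)) =
      Complex.exp (Complex.I * (inner ℝ ξ y : ℝ)) *
        (Complex.exp (Complex.I * (inner ℝ ξ (x - y) : ℝ)) - 1) := by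
  rw [mul_sub, ← Complex.exp_add, inner_sub_right]
  push_cast
  ring_nf

lemma taylorWeight_inner_le (ξ x y : E d) :
    taylorWeight |inner ℝ ξ (x - y)| ≤ taylorWeight (‖ξ‖ * ‖y - x‖) := by
  refine taylorWeight_mono (abs_nonneg _) ?_
  rw [norm_sub_rev y x]
  exact abs_real_inner_le_norm _ _

lemma norm_exp_sub_exp_sq_le (ξ x y : E d) :
    ‖Complex.exp (Complex.I * (inner ℝ ξ x : ℝ)) -
      Complex.exp (Complex.I * (inner ℝ ξ y : ℝ))‖ ^ 2 ≤ 4 * taylorWeight (‖ξ‖ * ‖y - x‖) := by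
  rw [exp_sub_exp, norm_mul, norm_exp_I_inner, one_mul]
  refine (norm_exp_I_mul_sub_one_sq_le _).trans ?_
  linarith [taylorWeight_inner_le ξ x y]

lemma lintegral_perExt_fst_sq {α : ℝ} (u : L2Cell d) {h : E d → ℝ≥0∞} (hh : Measurable h) :
    ∫⁻ p, ENNReal.ofReal (‖perExt u p.1‖ ^ 2) * h (p.2 - p.1) ∂(jumpMeasure d α) =
      ENNReal.ofReal (‖u‖ ^ 2) * ∫⁻ z, h z ∂(levyMeasure d α) := by
  have hF : Measurable fun x : E d => ENNReal.ofReal (‖perExt u x‖ ^ 2) :=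
    ((measurable_perExt u).norm.pow_const 2).ennreal_ofReal
  rw [lintegral_jump_fst hF hh, ← lintegral_sq_L2Cell]
  congr 1
  refine setLIntegral_congr_fun measurableSet_unitCell fun x hx => ?_
  simp only [perExt, toCell_eq_self hx]

lemma lintegral_perExt_fst {α : ℝ} (u : L2Cell d) {h : E d → ℝ≥0∞} (hh : Measurable h) :
    ∫⁻ p, ENNReal.ofReal ‖perExt u p.1‖ * h (p.2 - p.1) ∂(jumpMeasure d α) ≤
      ENNReal.ofReal ‖u‖ * ∫⁻ z, h z ∂(levyMeasure d α) := by
  have hF : Measurable fun x : E d => ENNReal.ofReal ‖perExt u x‖ :=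
    (measurable_perExt u).norm.ennreal_ofReal
  rw [lintegral_jump_fst hF hh]
  gcongr
  refine le_trans (le_of_eq ?_) (lintegral_norm_L2Cell_le u)
  refine setLIntegral_congr_fun measurableSet_unitCell fun x hx => ?_
  simp only [perExt, toCell_eq_self hx]

lemma lintegral_perExt_snd {α : ℝ} (u : L2Cell d) {h : E d → ℝ≥0∞} (hh : Measurable h) :
    ∫⁻ p, ENNReal.ofReal ‖perExt u p.2‖ * h (p.2 - p.1) ∂(jumpMeasure d α) ≤
      ENNReal.ofReal ‖u‖ * ∫⁻ z, h z ∂(levyMeasure d α) := by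
  have hF : Measurable fun x : E d => ENNReal.ofReal ‖u x‖ :=
    (Lp.stronglyMeasurable u).measurable.norm.ennreal_ofReal
  have := lintegral_jump_snd (α := α) hF hh
  simp only [perExt]
  rw [this]
  gcongr
  exact lintegral_norm_L2Cell_le u

lemma memLp_cellDiff {α : ℝ} {u : L2Cell d} (hu : u ∈ formDomain d α) :
    MemLp (cellDiff u) 2 (jumpMeasure d α) := hu

lemma lpNorm_twistMain {α : ℝ} (ξ : E d) (u : L2Cell d) :
    lpNorm (twistMain ξ u) 2 (jumpMeasure d α) = seminormH α u :=
  lpNorm_congr_norm (measurable_twistMain ξ u).aestronglyMeasurable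
    (measurable_cellDiff u).aestronglyMeasurable
    (Filter.Eventually.of_forall fun p => norm_twistMain ξ u p)

end

/-- The constant in the bound of the zero order part of the twisted difference. It is of order
`|ξ|^{α/2}`. -/
noncomputable def twistConst {d : ℕ} (α : ℝ) (ξ : E d) : ℝ :=
  2 * Real.sqrt (‖ξ‖ ^ α * weightInt d α)

lemma twistConst_nonneg {d : ℕ} (α : ℝ) (ξ : E d) : 0 ≤ twistConst α ξ := by
  unfold twistConst; positivity

lemma sq_twistConst {d : ℕ} (α : ℝ) (ξ : E d) :
    twistConst α ξ ^ 2 = 4 * (‖ξ‖ ^ α * weightInt d α) := by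
  rw [twistConst, mul_pow, Real.sq_sqrt (mul_nonneg (Real.rpow_nonneg (norm_nonneg _) _)
    (weightInt_nonneg d α))]
  norm_num

section

variable {d : ℕ} {α : ℝ}

/-- The `L₂` bound for the zero order part of the twisted difference. -/
lemma memLp_twistRem [NeZero d] (hα : α ∈ Set.Ioo (1 : ℝ) 2) (ξ : E d) (u : L2Cell d) :
    MemLp (twistRem ξ u) 2 (jumpMeasure d α) ∧
      lpNorm (twistRem ξ u) 2 (jumpMeasure d α) ≤
        twistConst α ξ * ‖u‖ := by
  have hm : Measurable fun z : E d => ENNReal.ofReal (taylorWeight (‖ξ‖ * ‖z‖)) :=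
    (measurable_taylorWeight.comp (by fun_prop)).ennreal_ofReal
  have hms := (measurable_twistRem ξ u).aestronglyMeasurable (μ := jumpMeasure d α)
  have key : ∫⁻ p, ENNReal.ofReal (‖twistRem ξ u p‖ ^ 2) ∂(jumpMeasure d α) ≤
      ENNReal.ofReal ((twistConst α ξ * ‖u‖) ^ 2) := by
    calc ∫⁻ p, ENNReal.ofReal (‖twistRem ξ u p‖ ^ 2) ∂(jumpMeasure d α)
        ≤ ∫⁻ p, ENNReal.ofReal 4 * (ENNReal.ofReal (‖perExt u p.1‖ ^ 2) *
            ENNReal.ofReal (taylorWeight (‖ξ‖ * ‖p.2 - p.1‖))) ∂(jumpMeasure d α) := by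
          refine lintegral_mono fun p => ?_
          rw [← ENNReal.ofReal_mul (sq_nonneg _), ← ENNReal.ofReal_mul (by norm_num)]
          refine ENNReal.ofReal_le_ofReal ?_
          rw [twistRem, norm_mul, mul_pow]
          have := mul_le_mul_of_nonneg_right (norm_exp_sub_exp_sq_le ξ p.1 p.2)
            (sq_nonneg ‖perExt u p.1‖)
          linarith
      _ = ENNReal.ofReal 4 * (ENNReal.ofReal (‖u‖ ^ 2) *
            ENNReal.ofReal (‖ξ‖ ^ α * weightInt d α)) := by
          rw [lintegral_const_mul' _ _ ENNReal.ofReal_ne_top, lintegral_perExt_fst_sq u hm,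
            lintegral_taylorWeight hα (norm_nonneg ξ)]
      _ = _ := by
          rw [← ENNReal.ofReal_mul (sq_nonneg _), ← ENNReal.ofReal_mul (by norm_num), mul_pow,
            sq_twistConst]
          ring_nf
  exact ⟨memLp_two_of_lintegral_le hms key, lpNorm_two_le_of_lintegral_le hms
    (mul_nonneg (twistConst_nonneg α ξ) (norm_nonneg u)) key⟩

lemma memLp_twistMain (ξ : E d) {u : L2Cell d} (hu : u ∈ formDomain d α) :
    MemLp (twistMain ξ u) 2 (jumpMeasure d α) :=
  (memLp_cellDiff hu).of_le (measurable_twistMain ξ u).aestronglyMeasurable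
    (Filter.Eventually.of_forall fun p => (norm_twistMain ξ u p).le)

/-- A function lies in the form domain as soon as one of its twisted differences is square
integrable. -/
lemma mem_formDomain_of_memLp_twistDiff [NeZero d] (hα : α ∈ Set.Ioo (1 : ℝ) 2) {ξ : E d} {u : L2Cell d}
    (h : MemLp (twistDiff ξ u) 2 (jumpMeasure d α)) : u ∈ formDomain d α := by
  have h1 : MemLp (twistMain ξ u) 2 (jumpMeasure d α) := by
    have h2 := h.sub (memLp_twistRem hα ξ u).1
    rwa [twistDiff_eq_add, add_sub_cancel_right] at h2
  exact h1.of_le (measurable_cellDiff u).aestronglyMeasurable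
    (Filter.Eventually.of_forall fun p => (norm_twistMain ξ u p).ge)

lemma seminormH_le_lpNorm_twistDiff [NeZero d] (hα : α ∈ Set.Ioo (1 : ℝ) 2) (ξ : E d) {u : L2Cell d}
    (hu : u ∈ formDomain d α) :
    seminormH α u ≤ lpNorm (twistDiff ξ u) 2 (jumpMeasure d α) +
      twistConst α ξ * ‖u‖ := by
  have h := lpNorm_sub_le (memLp_twistDiff (by linarith [hα.1]) hα.2 ξ hu)
    (g := twistRem ξ u) (p := 2) (by norm_num)
  rw [twistDiff_eq_add, add_sub_cancel_right, lpNorm_twistMain, ← twistDiff_eq_add] at h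
  linarith [(memLp_twistRem hα ξ u).2]

end

/-! ### The quasi-periodic form -/

section

variable {d : ℕ} {α μlo μhi : ℝ} {μ : E d → E d → ℝ}

lemma IsCoefficient.lo_le_hi (hμ : IsCoefficient μlo μhi μ) : μlo ≤ μhi := by
  obtain ⟨p, hp⟩ := hμ.bounds.exists
  exact hp.1.trans hp.2

lemma IsCoefficient.ae_jump_bounds (hμ : IsCoefficient μlo μhi μ) (α : ℝ) :
    ∀ᵐ p ∂(jumpMeasure d α), μlo ≤ μ p.1 p.2 ∧ μ p.1 p.2 ≤ μhi :=
  (jumpMeasure_ac d α).ae_le hμ.bounds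

lemma IsCoefficient.ae_jump_norm_le (hμ : IsCoefficient μlo μhi μ) (hlo : 0 < μlo) (α : ℝ) :
    ∀ᵐ p ∂(jumpMeasure d α), ‖(μ p.1 p.2 : ℂ)‖ ≤ μhi := by
  filter_upwards [hμ.ae_jump_bounds α] with p hp
  rw [Complex.norm_real, Real.norm_of_nonneg (hlo.le.trans hp.1)]
  exact hp.2

lemma form_conj (μ : E d → E d → ℝ) (α : ℝ) (ξ : E d) (u v : L2Cell d) :
    form μ α ξ u v = starRingEnd ℂ (form μ α ξ v u) := by
  unfold form
  rw [map_mul, ← integral_conj]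
  rw [show starRingEnd ℂ (1 / 2 : ℂ) = 1 / 2 by simp [Complex.conj_ofNat]]
  congr 1
  refine integral_congr_ae (Filter.Eventually.of_forall fun p => ?_)
  simp only [map_mul, Complex.conj_ofReal, Complex.conj_conj]
  ring

lemma form_add_left [NeZero d] (hα : α ∈ Set.Ioo (1 : ℝ) 2) (hμ : IsCoefficient μlo μhi μ) (ξ : E d)
    {u v η : L2Cell d} (hu : u ∈ formDomain d α) (hv : v ∈ formDomain d α)
    (hη : η ∈ formDomain d α) :
    form μ α ξ (u + v) η = form μ α ξ u η + form μ α ξ v η := by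
  have h0 : 0 < α := by linarith [hα.1]
  unfold form
  rw [← mul_add, ← integral_add (integrable_form h0 hα.2 hμ ξ hu hη)
    (integrable_form h0 hα.2 hμ ξ hv hη)]
  congr 1
  refine integral_congr_ae ?_
  filter_upwards [twistDiff_add (α := α) ξ u v] with p hp
  rw [hp, Pi.add_apply]
  ring

lemma form_smul_left (μ : E d → E d → ℝ) (α : ℝ) (ξ : E d) (c : ℂ) (u η : L2Cell d) :
    form μ α ξ (c • u) η = c * form μ α ξ u η := by
  unfold form
  have h : ∫ p, (μ p.1 p.2 : ℂ) *
        (twistDiff ξ (c • u) p * starRingEnd ℂ (twistDiff ξ η p)) ∂(jumpMeasure d α) =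
      c * ∫ p, (μ p.1 p.2 : ℂ) *
        (twistDiff ξ u p * starRingEnd ℂ (twistDiff ξ η p)) ∂(jumpMeasure d α) := by
    rw [← integral_const_mul]
    refine integral_congr_ae ?_
    filter_upwards [twistDiff_smul (α := α) ξ c u] with p hp
    rw [hp, Pi.smul_apply, smul_eq_mul]
    ring
  rw [h]
  ring

lemma form_add_right [NeZero d] (hα : α ∈ Set.Ioo (1 : ℝ) 2) (hμ : IsCoefficient μlo μhi μ) (ξ : E d)
    {u v η : L2Cell d} (hu : u ∈ formDomain d α) (hv : v ∈ formDomain d α)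
    (hη : η ∈ formDomain d α) :
    form μ α ξ η (u + v) = form μ α ξ η u + form μ α ξ η v := by
  rw [form_conj, form_add_left hα hμ ξ hu hv hη, map_add, ← form_conj, ← form_conj]

lemma form_smul_right (μ : E d → E d → ℝ) (α : ℝ) (ξ : E d) (c : ℂ) (u η : L2Cell d) :
    form μ α ξ η (c • u) = starRingEnd ℂ c * form μ α ξ η u := by
  rw [form_conj, form_smul_left, map_mul, ← form_conj]

lemma form_sum_left [NeZero d] (hα : α ∈ Set.Ioo (1 : ℝ) 2) (hμ : IsCoefficient μlo μhi μ) (ξ : E d)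
    {ι : Type*} (s : Finset ι) (c : ι → ℂ) {v : ι → L2Cell d} {η : L2Cell d}
    (hv : ∀ i, v i ∈ formDomain d α) (hη : η ∈ formDomain d α) :
    form μ α ξ (∑ i ∈ s, c i • v i) η = ∑ i ∈ s, c i * form μ α ξ (v i) η := by
  classical
  induction s using Finset.induction_on with
  | empty =>
    have := form_smul_left μ α ξ 0 0 η
    simpa using this
  | insert a s ha ih =>
    rw [Finset.sum_insert ha, Finset.sum_insert ha, form_add_left hα hμ ξ
      (Submodule.smul_mem _ _ (hv a)) (Submodule.sum_mem _ fun i _ => Submodule.smul_mem _ _ (hv i))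
      hη, form_smul_left, ih]

lemma norm_half_integral_le (hμ : IsCoefficient μlo μhi μ) (hlo : 0 < μlo)
    {f g : E d × E d → ℂ} (hf : MemLp f 2 (jumpMeasure d α)) (hg : MemLp g 2 (jumpMeasure d α)) :
    ‖(1 / 2 : ℂ) * ∫ p, (μ p.1 p.2 : ℂ) * (f p * starRingEnd ℂ (g p)) ∂(jumpMeasure d α)‖ ≤
      μhi / 2 * (lpNorm f 2 (jumpMeasure d α) * lpNorm g 2 (jumpMeasure d α)) := by
  have hhi : 0 ≤ μhi := hlo.le.trans hμ.lo_le_hi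
  have h := norm_integral_weighted_mul_conj_le hhi (hμ.ae_jump_norm_le hlo α) hf hg
  rw [norm_mul]
  have : ‖(1 / 2 : ℂ)‖ = 1 / 2 := by norm_num
  rw [this]
  linarith

lemma re_form_self_ge [NeZero d] (hα : α ∈ Set.Ioo (1 : ℝ) 2) (hμ : IsCoefficient μlo μhi μ) (ξ : E d)
    {u : L2Cell d} (hu : u ∈ formDomain d α) :
    μlo / 2 * lpNorm (twistDiff ξ u) 2 (jumpMeasure d α) ^ 2 ≤ (form μ α ξ u u).re := by
  have h0 : 0 < α := by linarith [hα.1]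
  have hm := memLp_twistDiff h0 hα.2 ξ hu
  have hsq := (memLp_two_iff_integrable_sq_norm hm.1).1 hm
  have h1 : (form μ α ξ u u).re =
      1 / 2 * ∫ p, μ p.1 p.2 * ‖twistDiff ξ u p‖ ^ 2 ∂(jumpMeasure d α) := by
    unfold form
    have : ∫ p, (μ p.1 p.2 : ℂ) * (twistDiff ξ u p * starRingEnd ℂ (twistDiff ξ u p))
        ∂(jumpMeasure d α) =
        ((∫ p, μ p.1 p.2 * ‖twistDiff ξ u p‖ ^ 2 ∂(jumpMeasure d α) : ℝ) : ℂ) := by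
      rw [← integral_complex_ofReal]
      refine integral_congr_ae (Filter.Eventually.of_forall fun p => ?_)
      simp only [Complex.mul_conj, Complex.normSq_eq_norm_sq]
      push_cast
      ring
    rw [this, show (1 / 2 : ℂ) = ((1 / 2 : ℝ) : ℂ) by norm_num, Complex.re_ofReal_mul,
      Complex.ofReal_re]
  have hint : Integrable (fun p => μ p.1 p.2 * ‖twistDiff ξ u p‖ ^ 2) (jumpMeasure d α) := by
    have := (integrable_form h0 hα.2 hμ ξ hu hu).re
    refine this.congr (Filter.Eventually.of_forall fun p => ?_)
    simp only [Complex.mul_conj, Complex.normSq_eq_norm_sq, RCLike.re_eq_complex_re,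
      Complex.re_ofReal_mul, Complex.ofReal_re]
  rw [h1, sq_lpNorm_two hm, div_mul_eq_mul_div, ← integral_const_mul, div_eq_inv_mul,
    one_div]
  refine mul_le_mul_of_nonneg_left (integral_mono_ae (hsq.const_mul _) hint ?_) (by norm_num)
  filter_upwards [hμ.ae_jump_bounds α] with p hp
  exact mul_le_mul_of_nonneg_right hp.1 (sq_nonneg _)

lemma twistDiff_zero_left (u : L2Cell d) : twistDiff 0 u = cellDiff u := by
  funext p
  simp [twistDiff, cellDiff]

/-- The form depends on `ξ` continuously, with modulus of order `|ξ|^{α/2}`. -/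
lemma norm_form_sub_form_zero_le [NeZero d] (hα : α ∈ Set.Ioo (1 : ℝ) 2) (hμ : IsCoefficient μlo μhi μ)
    (hlo : 0 < μlo) (ξ : E d) {u v : L2Cell d} (hu : u ∈ formDomain d α)
    (hv : v ∈ formDomain d α) :
    ‖form μ α ξ u v - form μ α 0 u v‖ ≤ μhi / 2 * (seminormH α u * (twistConst α ξ * ‖v‖) +
      twistConst α ξ * ‖u‖ * seminormH α v + twistConst α ξ * ‖u‖ * (twistConst α ξ * ‖v‖)) := by
  have h0 : 0 < α := by linarith [hα.1]
  have hhi : 0 ≤ μhi := hlo.le.trans hμ.lo_le_hi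
  have mu := memLp_twistMain (α := α) ξ hu
  have mv := memLp_twistMain (α := α) ξ hv
  have ru := memLp_twistRem hα ξ u
  have rv := memLp_twistRem hα ξ v
  have int : ∀ {f g : E d × E d → ℂ}, MemLp f 2 (jumpMeasure d α) →
      MemLp g 2 (jumpMeasure d α) → Integrable (fun p => (μ p.1 p.2 : ℂ) *
        (f p * starRingEnd ℂ (g p))) (jumpMeasure d α) := fun hf hg =>
    Integrable.bdd_mul (hf.integrable_mul hg.star) (hμ.ae_jump α).1 (hμ.ae_jump α).2
  set A := fun f g : E d × E d → ℂ =>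
    (1 / 2 : ℂ) * ∫ p, (μ p.1 p.2 : ℂ) * (f p * starRingEnd ℂ (g p)) ∂(jumpMeasure d α) with hA
  have i12 : Integrable (fun p => (μ p.1 p.2 : ℂ) *
      (twistMain ξ u p * starRingEnd ℂ (twistRem ξ v p)) + (μ p.1 p.2 : ℂ) *
      (twistRem ξ u p * starRingEnd ℂ (twistMain ξ v p))) (jumpMeasure d α) :=
    (int mu rv.1).add (int ru.1 mv)
  have e1 : form μ α ξ u v - form μ α 0 u v = A (twistMain ξ u) (twistRem ξ v) +
      A (twistRem ξ u) (twistMain ξ v) + A (twistRem ξ u) (twistRem ξ v) := by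
    simp only [hA, form, ← mul_add, ← mul_sub]
    rw [← integral_sub (integrable_form h0 hα.2 hμ ξ hu hv)
      (integrable_form h0 hα.2 hμ 0 hu hv), ← integral_add (int mu rv.1) (int ru.1 mv),
      ← integral_add i12 (int ru.1 rv.1)]
    congr 1
    refine integral_congr_ae (Filter.Eventually.of_forall fun p => ?_)
    simp only [twistDiff_eq_add ξ, twistDiff_zero_left, Pi.add_apply, map_add]
    have h2 : twistMain ξ u p * starRingEnd ℂ (twistMain ξ v p) =
        cellDiff u p * starRingEnd ℂ (cellDiff v p) := by
      simp only [twistMain, map_mul]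
      rw [mul_mul_mul_comm, Complex.mul_conj, Complex.normSq_eq_norm_sq, norm_exp_I_inner]
      simp
    rw [← h2]
    ring
  have b1 := norm_half_integral_le hμ hlo mu rv.1
  have b2 := norm_half_integral_le hμ hlo ru.1 mv
  have b3 := norm_half_integral_le hμ hlo ru.1 rv.1
  rw [lpNorm_twistMain] at b1 b2
  have hb := twistConst_nonneg α ξ
  rw [e1]
  refine (norm_add₃_le).trans ?_
  rw [mul_add, mul_add]
  have hu' : 0 ≤ seminormH α u := seminormH_nonneg α u
  have hv' : 0 ≤ seminormH α v := seminormH_nonneg α v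
  refine add_le_add (add_le_add (b1.trans ?_) (b2.trans ?_)) (b3.trans ?_)
  · exact mul_le_mul_of_nonneg_left (mul_le_mul_of_nonneg_left rv.2 hu') (by linarith)
  · exact mul_le_mul_of_nonneg_left (mul_le_mul_of_nonneg_right ru.2 hv') (by linarith)
  · exact mul_le_mul_of_nonneg_left (mul_le_mul ru.2 rv.2 lpNorm_nonneg (by positivity))
      (by linarith)

lemma oneCell_mem_formDomain (d : ℕ) (α : ℝ) : oneCell d ∈ formDomain d α := by
  change MemLp (fun p : E d × E d => perExt (oneCell d) p.1 - perExt (oneCell d) p.2) 2 _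
  refine (MemLp.zero (ε := ℂ)).ae_eq ?_
  filter_upwards [ae_jump_of_ae (α := α) (perExt_oneCell d)] with p hp
  simp [hp.1, hp.2]

/-- The functional `½ ∫_Ω ∫_{ℝ^d} μ(x,y) |x-y|^{-(d+α)} ⟨ξ, x - y⟩ conj(η(x) - η(y)) dy dx`, which
is the leading term of `-i a(ξ)[𝟏, η]` for small `ξ`. -/
noncomputable def dipole (μ : E d → E d → ℝ) (α : ℝ) (ξ : E d) (η : L2Cell d) : ℂ :=
  (1 / 2 : ℂ) * ∫ p, (μ p.1 p.2 : ℂ) * (((inner ℝ ξ (p.1 - p.2) : ℝ) : ℂ) *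
    starRingEnd ℂ (cellDiff η p)) ∂(jumpMeasure d α)

lemma integrable_of_lintegral_le {X : Type*} [MeasurableSpace X] {m : Measure X} {f : X → ℂ}
    (hf : AEStronglyMeasurable f m) {C : ℝ} {G : X → ℝ≥0∞}
    (hle : ∀ᵐ x ∂m, ENNReal.ofReal ‖f x‖ ≤ G x) (hC : 0 ≤ C)
    (h : ∫⁻ x, G x ∂m ≤ ENNReal.ofReal C) :
    Integrable f m ∧ ‖∫ x, f x ∂m‖ ≤ C := by
  have h1 : ∫⁻ x, ENNReal.ofReal ‖f x‖ ∂m ≤ ENNReal.ofReal C := (lintegral_mono_ae hle).trans h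
  refine ⟨⟨hf, ?_⟩, ?_⟩
  · rw [hasFiniteIntegral_iff_norm]
    exact h1.trans_lt ENNReal.ofReal_lt_top
  · have h2 := norm_integral_le_lintegral_norm (μ := m) f
    exact h2.trans (ENNReal.toReal_le_of_le_ofReal hC h1)

end

/-! ### The form on constants -/

section

variable {d : ℕ} {α μlo μhi : ℝ} {μ : E d → E d → ℝ}

lemma measurable_taylorWeight_smul_norm (t : ℝ) :
    Measurable fun z : E d => ENNReal.ofReal (taylorWeight (t * ‖z‖)) :=
  (measurable_taylorWeight.comp (by fun_prop)).ennreal_ofReal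

lemma norm_cellDiff_le (η : L2Cell d) (p : E d × E d) :
    ‖cellDiff η p‖ ≤ ‖perExt η p.1‖ + ‖perExt η p.2‖ := norm_sub_le _ _

/-- The basic weighted `L₁` bound, with a weight `min(t|x-y|, t²|x-y|²)`. -/
lemma lintegral_taylorWeight_mul_le [NeZero d] (hα : α ∈ Set.Ioo (1 : ℝ) 2) {t : ℝ} (ht : 0 ≤ t)
    (η : L2Cell d) {a b : ℝ} (ha : 0 ≤ a) (hb : 0 ≤ b) :
    ∫⁻ p, ENNReal.ofReal ((a * ‖perExt η p.1‖ + b * ‖perExt η p.2‖) *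
      taylorWeight (t * ‖p.2 - p.1‖)) ∂(jumpMeasure d α) ≤
      ENNReal.ofReal ((a + b) * ‖η‖ * (t ^ α * weightInt d α)) := by
  have hm := measurable_taylorWeight_smul_norm (d := d) t
  have h1 := lintegral_perExt_fst (α := α) η hm
  have h2 := lintegral_perExt_snd (α := α) η hm
  rw [lintegral_taylorWeight hα ht, ← ENNReal.ofReal_mul (norm_nonneg _)] at h1 h2
  have hK : 0 ≤ t ^ α * weightInt d α := mul_nonneg (Real.rpow_nonneg ht _) (weightInt_nonneg d α)
  have hw : ∀ p : E d × E d, 0 ≤ taylorWeight (t * ‖p.2 - p.1‖) := fun p =>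
    taylorWeight_nonneg (by positivity)
  have hpt : ∀ p : E d × E d, ENNReal.ofReal ((a * ‖perExt η p.1‖ + b * ‖perExt η p.2‖) *
      taylorWeight (t * ‖p.2 - p.1‖)) =
      ENNReal.ofReal a * (ENNReal.ofReal ‖perExt η p.1‖ *
        ENNReal.ofReal (taylorWeight (t * ‖p.2 - p.1‖))) +
      ENNReal.ofReal b * (ENNReal.ofReal ‖perExt η p.2‖ *
        ENNReal.ofReal (taylorWeight (t * ‖p.2 - p.1‖))) := by
    intro p
    have := hw p
    rw [← ENNReal.ofReal_mul (norm_nonneg _), ← ENNReal.ofReal_mul (norm_nonneg _),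
      ← ENNReal.ofReal_mul ha, ← ENNReal.ofReal_mul hb, ← ENNReal.ofReal_add (by positivity)
      (by positivity)]
    ring_nf
  have hm1 : Measurable fun p : E d × E d => ENNReal.ofReal a * (ENNReal.ofReal ‖perExt η p.1‖ *
        ENNReal.ofReal (taylorWeight (t * ‖p.2 - p.1‖))) :=
    measurable_const.mul (((measurable_perExt η).comp measurable_fst).norm.ennreal_ofReal.mul
      (hm.comp (measurable_snd.sub measurable_fst)))
  simp_rw [hpt]
  rw [lintegral_add_left hm1, lintegral_const_mul' _ _ ENNReal.ofReal_ne_top,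
    lintegral_const_mul' _ _ ENNReal.ofReal_ne_top]
  calc _ ≤ ENNReal.ofReal a * ENNReal.ofReal (‖η‖ * (t ^ α * weightInt d α)) +
        ENNReal.ofReal b * ENNReal.ofReal (‖η‖ * (t ^ α * weightInt d α)) := by gcongr
    _ = _ := by
      rw [← ENNReal.ofReal_mul ha, ← ENNReal.ofReal_mul hb, ← ENNReal.ofReal_add (by positivity)
        (by positivity)]
      ring_nf

lemma aestronglyMeasurable_coeff_mul (hμ : IsCoefficient μlo μhi μ) {f : E d × E d → ℂ}
    (hf : Measurable f) :
    AEStronglyMeasurable (fun p => (μ p.1 p.2 : ℂ) * f p) (jumpMeasure d α) :=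
  (hμ.ae_jump α).1.mul hf.aestronglyMeasurable

lemma measurable_conj_cellDiff (η : L2Cell d) :
    Measurable fun p => starRingEnd ℂ (cellDiff η p) :=
  Complex.continuous_conj.measurable.comp (measurable_cellDiff η)

lemma measurable_dipole_integrand (ξ : E d) (η : L2Cell d) :
    Measurable fun p : E d × E d =>
      ((inner ℝ ξ (p.1 - p.2) : ℝ) : ℂ) * starRingEnd ℂ (cellDiff η p) :=
  (Complex.measurable_ofReal.comp (Continuous.measurable (by fun_prop))).mul
    (measurable_conj_cellDiff η)

lemma lintegral_sqrt_taylorWeight_mul_le [NeZero d] (hα : α ∈ Set.Ioo (1 : ℝ) 2) {η : L2Cell d}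
    (hη : η ∈ formDomain d α) :
    ∫⁻ p, ENNReal.ofReal (Real.sqrt (taylorWeight ‖p.2 - p.1‖) * ‖cellDiff η p‖)
      ∂(jumpMeasure d α) ≤ ENNReal.ofReal (Real.sqrt (weightInt d α) * seminormH α η) := by
  set s : E d × E d → ℂ := fun p => (Real.sqrt (taylorWeight ‖p.2 - p.1‖) : ℂ) with hs
  have hsm : Measurable s := Complex.measurable_ofReal.comp
    ((measurable_taylorWeight.comp (by fun_prop)).sqrt)
  have h1 : ∫⁻ p, ENNReal.ofReal (‖s p‖ ^ 2) ∂(jumpMeasure d α) ≤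
      ENNReal.ofReal (Real.sqrt (weightInt d α) ^ 2) := by
    have hm := measurable_taylorWeight_smul_norm (d := d) 1
    have h2 := lintegral_jump_fst (α := α) (F := fun _ : E d => 1) measurable_const hm
    rw [lintegral_taylorWeight hα zero_le_one] at h2
    simp only [one_mul, lintegral_const, measure_univ, Real.one_rpow] at h2
    rw [Real.sq_sqrt (weightInt_nonneg d α), ← h2]
    refine lintegral_mono fun p => ENNReal.ofReal_le_ofReal ?_
    rw [hs, Complex.norm_real, Real.norm_of_nonneg (Real.sqrt_nonneg _),
      Real.sq_sqrt (taylorWeight_nonneg (norm_nonneg _))]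
  have hs2 := memLp_two_of_lintegral_le hsm.aestronglyMeasurable h1
  have hs3 := lpNorm_two_le_of_lintegral_le hsm.aestronglyMeasurable (Real.sqrt_nonneg _) h1
  have hD := memLp_cellDiff hη
  have h4 := norm_integral_weighted_mul_conj_le (m := jumpMeasure d α) (w := fun _ => 1)
    zero_le_one (Filter.Eventually.of_forall fun p => by simp)
    (f := fun p => (‖s p‖ : ℂ)) (g := fun p => (‖cellDiff η p‖ : ℂ)) ?_ ?_
  rotate_left
  · simpa using hs2.norm.ofReal (K := ℂ)
  · simpa using hD.norm.ofReal (K := ℂ)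
  simp only [one_mul, Complex.conj_ofReal, ← Complex.ofReal_mul] at h4
  rw [integral_complex_ofReal, Complex.norm_real,
    Real.norm_of_nonneg (integral_nonneg fun p => by positivity)] at h4
  have e1 : lpNorm (fun p => (‖s p‖ : ℂ)) 2 (jumpMeasure d α) = lpNorm s 2 (jumpMeasure d α) :=
    lpNorm_congr_norm (Complex.measurable_ofReal.comp hsm.norm).aestronglyMeasurable
      hsm.aestronglyMeasurable (Filter.Eventually.of_forall fun p => by simp)
  have e2 : lpNorm (fun p => (‖cellDiff η p‖ : ℂ)) 2 (jumpMeasure d α) = seminormH α η :=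
    lpNorm_congr_norm
      (Complex.measurable_ofReal.comp (measurable_cellDiff η).norm).aestronglyMeasurable
      (measurable_cellDiff η).aestronglyMeasurable (Filter.Eventually.of_forall fun p => by simp)
  rw [e1, e2] at h4
  have h5 : Integrable (fun p => ‖s p‖ * ‖cellDiff η p‖) (jumpMeasure d α) :=
    hs2.norm.integrable_mul hD.norm
  have h6 : ∀ p, Real.sqrt (taylorWeight ‖p.2 - p.1‖) * ‖cellDiff η p‖ =
      ‖s p‖ * ‖cellDiff η p‖ := fun p => by
    rw [hs, Complex.norm_real, Real.norm_of_nonneg (Real.sqrt_nonneg _)]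
  simp_rw [h6]
  rw [← ofReal_integral_eq_lintegral_ofReal h5
    (Filter.Eventually.of_forall fun p => by positivity)]
  refine ENNReal.ofReal_le_ofReal (h4.trans ?_)
  exact mul_le_mul_of_nonneg_right hs3 (seminormH_nonneg α η)

/-- Absolute convergence and boundedness of the dipole functional. For `|x - y| ≤ 1` the
Cauchy–Schwarz inequality applies, for `|x - y| ≥ 1` the weight `|x - y|` is integrable. -/
lemma integrable_dipole [NeZero d] (hα : α ∈ Set.Ioo (1 : ℝ) 2) (hμ : IsCoefficient μlo μhi μ)
    (hlo : 0 < μlo) (ξ : E d) {η : L2Cell d} (hη : η ∈ formDomain d α) :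
    Integrable (fun p => (μ p.1 p.2 : ℂ) * (((inner ℝ ξ (p.1 - p.2) : ℝ) : ℂ) *
      starRingEnd ℂ (cellDiff η p))) (jumpMeasure d α) ∧
    ‖dipole μ α ξ η‖ ≤ μhi / 2 * ‖ξ‖ *
      (Real.sqrt (weightInt d α) * seminormH α η + 2 * weightInt d α * ‖η‖) := by
  have hhi : 0 ≤ μhi := hlo.le.trans hμ.lo_le_hi
  have hK := weightInt_nonneg d α
  have hS := seminormH_nonneg α η
  set C := μhi * ‖ξ‖ *
      (Real.sqrt (weightInt d α) * seminormH α η + 2 * weightInt d α * ‖η‖) with hC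
  have hpt : ∀ᵐ p ∂(jumpMeasure d α), ENNReal.ofReal ‖(μ p.1 p.2 : ℂ) *
      (((inner ℝ ξ (p.1 - p.2) : ℝ) : ℂ) * starRingEnd ℂ (cellDiff η p))‖ ≤
      ENNReal.ofReal (μhi * ‖ξ‖) *
        (ENNReal.ofReal (Real.sqrt (taylorWeight ‖p.2 - p.1‖) * ‖cellDiff η p‖) +
        ENNReal.ofReal ((1 * ‖perExt η p.1‖ + 1 * ‖perExt η p.2‖) *
          taylorWeight (1 * ‖p.2 - p.1‖))) := by
    filter_upwards [hμ.ae_jump_norm_le hlo α] with p hp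
    have hw := taylorWeight_nonneg (norm_nonneg (p.2 - p.1))
    have hw' := taylorWeight_nonneg (t := 1 * ‖p.2 - p.1‖) (by positivity)
    rw [← ENNReal.ofReal_add (by positivity) (by positivity), ← ENNReal.ofReal_mul (by positivity)]
    refine ENNReal.ofReal_le_ofReal ?_
    rw [norm_mul, norm_mul, RCLike.norm_conj, Complex.norm_real (inner ℝ ξ (p.1 - p.2)),
      mul_assoc μhi, one_mul, one_mul,
      one_mul]
    have h1 : ‖inner ℝ ξ (p.1 - p.2)‖ ≤ ‖ξ‖ * ‖p.2 - p.1‖ := by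
      rw [norm_sub_rev p.2]; exact norm_inner_le_norm _ _
    have h2 : ‖p.2 - p.1‖ * ‖cellDiff η p‖ ≤
        Real.sqrt (taylorWeight ‖p.2 - p.1‖) * ‖cellDiff η p‖ +
        (‖perExt η p.1‖ + ‖perExt η p.2‖) * taylorWeight ‖p.2 - p.1‖ := by
      have h3 := norm_cellDiff_le η p
      have h0 := norm_nonneg (p.2 - p.1)
      rcases le_total ‖p.2 - p.1‖ 1 with h | h
      · have : taylorWeight ‖p.2 - p.1‖ = ‖p.2 - p.1‖ ^ 2 :=
          min_eq_right (by nlinarith)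
        rw [this, Real.sqrt_sq h0]
        have : 0 ≤ (‖perExt η p.1‖ + ‖perExt η p.2‖) * ‖p.2 - p.1‖ ^ 2 := by positivity
        linarith
      · have : taylorWeight ‖p.2 - p.1‖ = ‖p.2 - p.1‖ :=
          min_eq_left (by nlinarith)
        rw [this]
        have h4 := mul_le_mul_of_nonneg_left h3 h0
        have : 0 ≤ Real.sqrt ‖p.2 - p.1‖ * ‖cellDiff η p‖ := by positivity
        linarith
    refine mul_le_mul hp ?_ (by positivity) hhi
    calc _ ≤ ‖ξ‖ * ‖p.2 - p.1‖ * ‖cellDiff η p‖ :=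
          mul_le_mul_of_nonneg_right h1 (norm_nonneg _)
      _ = ‖ξ‖ * (‖p.2 - p.1‖ * ‖cellDiff η p‖) := by ring
      _ ≤ _ := mul_le_mul_of_nonneg_left h2 (norm_nonneg _)
  have hms : Measurable fun p : E d × E d =>
      ENNReal.ofReal (Real.sqrt (taylorWeight ‖p.2 - p.1‖) * ‖cellDiff η p‖) :=
    (((measurable_taylorWeight.comp (measurable_snd.sub measurable_fst).norm).sqrt).mul
      (measurable_cellDiff η).norm).ennreal_ofReal
  have hint := integrable_of_lintegral_le (C := C)
    (aestronglyMeasurable_coeff_mul hμ (measurable_dipole_integrand ξ η)) hpt (by positivity) (by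
      rw [lintegral_const_mul' _ _ ENNReal.ofReal_ne_top, lintegral_add_left hms]
      have h1 := lintegral_sqrt_taylorWeight_mul_le hα hη
      have h2 := lintegral_taylorWeight_mul_le hα zero_le_one η zero_le_one zero_le_one
      calc _ ≤ ENNReal.ofReal (μhi * ‖ξ‖) *
            (ENNReal.ofReal (Real.sqrt (weightInt d α) * seminormH α η) +
            ENNReal.ofReal ((1 + 1) * ‖η‖ * (1 ^ α * weightInt d α))) := by gcongr
        _ = ENNReal.ofReal C := by
          rw [← ENNReal.ofReal_add (by positivity) (by positivity),
            ← ENNReal.ofReal_mul (by positivity), Real.one_rpow]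
          congr 1
          rw [hC]; ring)
  refine ⟨hint.1, ?_⟩
  rw [dipole, norm_mul]
  have : ‖(1 / 2 : ℂ)‖ = 1 / 2 := by norm_num
  rw [this]
  calc _ ≤ 1 / 2 * C := by gcongr; exact hint.2
    _ = _ := by rw [hC]; ring

lemma twistDiff_oneCell (α : ℝ) (ξ : E d) :
    ∀ᵐ p ∂(jumpMeasure d α), twistDiff ξ (oneCell d) p =
      Complex.exp (Complex.I * (inner ℝ ξ p.1 : ℝ)) -
        Complex.exp (Complex.I * (inner ℝ ξ p.2 : ℝ)) := by
  filter_upwards [ae_jump_of_ae (α := α) (perExt_oneCell d)] with p hp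
  simp [twistDiff, hp.1, hp.2]

/-- First order expansion of `a(ξ)[𝟏, η]` at `ξ = 0`, with an error of order `|ξ|^α`. -/
lemma norm_form_one_sub_dipole_le [NeZero d] (hα : α ∈ Set.Ioo (1 : ℝ) 2)
    (hμ : IsCoefficient μlo μhi μ) (hlo : 0 < μlo) (ξ : E d) {η : L2Cell d}
    (hη : η ∈ formDomain d α) :
    ‖form μ α ξ (oneCell d) η - Complex.I * dipole μ α ξ η‖ ≤
      4 * μhi * weightInt d α * ‖ξ‖ ^ α * ‖η‖ := by
  have h0 : 0 < α := by linarith [hα.1]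
  have hhi : 0 ≤ μhi := hlo.le.trans hμ.lo_le_hi
  have hK := weightInt_nonneg d α
  have i1 := integrable_form h0 hα.2 hμ ξ (oneCell_mem_formDomain d α) hη
  have i2 := (integrable_dipole hα hμ hlo ξ hη).1.const_mul Complex.I
  have e1 : form μ α ξ (oneCell d) η - Complex.I * dipole μ α ξ η =
      (1 / 2 : ℂ) * ∫ p, ((μ p.1 p.2 : ℂ) *
        (twistDiff ξ (oneCell d) p * starRingEnd ℂ (twistDiff ξ η p)) -
        Complex.I * ((μ p.1 p.2 : ℂ) * (((inner ℝ ξ (p.1 - p.2) : ℝ) : ℂ) *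
          starRingEnd ℂ (cellDiff η p)))) ∂(jumpMeasure d α) := by
    rw [integral_sub i1 i2, integral_const_mul, form, dipole]
    ring
  set C := 8 * μhi * weightInt d α * ‖ξ‖ ^ α * ‖η‖ with hC
  have hpt : ∀ᵐ p ∂(jumpMeasure d α), ENNReal.ofReal ‖(μ p.1 p.2 : ℂ) *
        (twistDiff ξ (oneCell d) p * starRingEnd ℂ (twistDiff ξ η p)) -
        Complex.I * ((μ p.1 p.2 : ℂ) * (((inner ℝ ξ (p.1 - p.2) : ℝ) : ℂ) *
          starRingEnd ℂ (cellDiff η p)))‖ ≤ ENNReal.ofReal μhi *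
        ENNReal.ofReal ((6 * ‖perExt η p.1‖ + 2 * ‖perExt η p.2‖) *
          taylorWeight (‖ξ‖ * ‖p.2 - p.1‖)) := by
    filter_upwards [hμ.ae_jump_norm_le hlo α, twistDiff_oneCell α ξ] with p hp hp1
    have hw := taylorWeight_nonneg (t := ‖ξ‖ * ‖p.2 - p.1‖) (by positivity)
    rw [← ENNReal.ofReal_mul hhi]
    refine ENNReal.ofReal_le_ofReal ?_
    set a := Complex.exp (Complex.I * (inner ℝ ξ p.1 : ℝ)) with ha
    set b := Complex.exp (Complex.I * (inner ℝ ξ p.2 : ℝ)) with hb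
    set t : ℝ := inner ℝ ξ (p.1 - p.2) with ht
    set q := Complex.exp (Complex.I * (t : ℂ)) with hq
    have hab : a - b = b * (q - 1) := exp_sub_exp ξ p.1 p.2
    have hbb : b * starRingEnd ℂ b = 1 := by
      rw [Complex.mul_conj, Complex.normSq_eq_norm_sq, norm_exp_I_inner]; simp
    have hid : (μ p.1 p.2 : ℂ) * (twistDiff ξ (oneCell d) p * starRingEnd ℂ (twistDiff ξ η p)) -
        Complex.I * ((μ p.1 p.2 : ℂ) * ((t : ℂ) * starRingEnd ℂ (cellDiff η p))) =
        (μ p.1 p.2 : ℂ) * ((q - 1 - Complex.I * t) * starRingEnd ℂ (cellDiff η p) +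
          (a - b) * starRingEnd ℂ (a - b) * starRingEnd ℂ (perExt η p.1)) := by
      rw [hp1, twistDiff_eq_add]
      simp only [Pi.add_apply, twistMain, twistRem, map_add, map_mul, ← ha, ← hb]
      rw [mul_add, show (a - b) * (starRingEnd ℂ b * starRingEnd ℂ (cellDiff η p)) =
        (b * starRingEnd ℂ b) * ((q - 1) * starRingEnd ℂ (cellDiff η p)) by rw [hab]; ring, hbb]
      ring
    rw [hid, norm_mul]
    refine mul_le_mul hp ?_ (norm_nonneg _) hhi
    refine (norm_add_le _ _).trans ?_
    rw [norm_mul, norm_mul, norm_mul, RCLike.norm_conj, RCLike.norm_conj, RCLike.norm_conj]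
    have h1 : ‖q - 1 - Complex.I * t‖ ≤ 2 * taylorWeight (‖ξ‖ * ‖p.2 - p.1‖) :=
      (norm_exp_I_mul_sub_one_sub_le t).trans (by linarith [taylorWeight_inner_le ξ p.1 p.2])
    have h2 : ‖a - b‖ * ‖a - b‖ ≤ 4 * taylorWeight (‖ξ‖ * ‖p.2 - p.1‖) := by
      rw [← sq]; exact norm_exp_sub_exp_sq_le ξ p.1 p.2
    have h3 := norm_cellDiff_le η p
    have h4 := mul_le_mul h1 h3 (norm_nonneg _) (by positivity)
    have h5 := mul_le_mul_of_nonneg_right h2 (norm_nonneg (perExt η p.1))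
    linarith
  have hint := integrable_of_lintegral_le (C := C) (i1.sub i2).1 hpt (by positivity) (by
      rw [lintegral_const_mul' _ _ ENNReal.ofReal_ne_top]
      have h2 := lintegral_taylorWeight_mul_le hα (norm_nonneg ξ) η
        (by norm_num : (0 : ℝ) ≤ 6) (by norm_num : (0 : ℝ) ≤ 2)
      calc _ ≤ ENNReal.ofReal μhi *
            ENNReal.ofReal ((6 + 2) * ‖η‖ * (‖ξ‖ ^ α * weightInt d α)) := by gcongr
        _ = ENNReal.ofReal C := by
          rw [← ENNReal.ofReal_mul hhi]
          congr 1
          rw [hC]; ring)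
  rw [e1, norm_mul]
  have : ‖(1 / 2 : ℂ)‖ = 1 / 2 := by norm_num
  rw [this]
  calc _ ≤ 1 / 2 * C := by gcongr; exact hint.2
    _ = _ := by rw [hC]; ring

lemma dipole_sum [NeZero d] (hα : α ∈ Set.Ioo (1 : ℝ) 2) (hμ : IsCoefficient μlo μhi μ)
    (hlo : 0 < μlo) (ξ : E d) {η : L2Cell d} (hη : η ∈ formDomain d α) :
    dipole μ α ξ η = ∑ k, (ξ k : ℂ) * dipole μ α (EuclideanSpace.single k (1 : ℝ)) η := by
  have h : ∀ k, Integrable (fun p => (ξ k : ℂ) * ((μ p.1 p.2 : ℂ) *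
      (((inner ℝ (EuclideanSpace.single k (1 : ℝ)) (p.1 - p.2) : ℝ) : ℂ) *
        starRingEnd ℂ (cellDiff η p)))) (jumpMeasure d α) := fun k =>
    (integrable_dipole hα hμ hlo _ hη).1.const_mul _
  have h2 : ∀ k, (ξ k : ℂ) * dipole μ α (EuclideanSpace.single k (1 : ℝ)) η =
      (1 / 2 : ℂ) * ∫ p, (ξ k : ℂ) * ((μ p.1 p.2 : ℂ) *
      (((inner ℝ (EuclideanSpace.single k (1 : ℝ)) (p.1 - p.2) : ℝ) : ℂ) *
        starRingEnd ℂ (cellDiff η p))) ∂(jumpMeasure d α) := by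
    intro k
    rw [integral_const_mul, dipole]
    ring
  rw [Finset.sum_congr rfl fun k _ => h2 k, ← Finset.mul_sum,
    ← integral_finsetSum _ fun k _ => h k, dipole]
  congr 1
  refine integral_congr_ae (Filter.Eventually.of_forall fun p => ?_)
  have : inner ℝ ξ (p.1 - p.2) = ∑ k, ξ k * (p.1 - p.2) k := by
    rw [PiLp.inner_apply]
    simp [mul_comm]
  simp only [this, EuclideanSpace.inner_single_left]
  push_cast
  rw [Finset.sum_mul, Finset.mul_sum]
  refine Finset.sum_congr rfl fun k _ => ?_
  simp
  ring

end

/-! ### Lower bounds for the form -/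

/-- The value of the Lévy density at distance `2√d`, a lower bound for the jump kernel between the
cell and any of its neighbours in a coordinate direction. -/
noncomputable def kernelLow (d : ℕ) (α : ℝ) : ℝ := (2 * Real.sqrt d) ^ (-((d : ℝ) + α))

lemma kernelLow_pos (d : ℕ) [NeZero d] (α : ℝ) : 0 < kernelLow d α := by
  have : (0 : ℝ) < d := by exact_mod_cast Nat.pos_of_ne_zero (NeZero.ne d)
  unfold kernelLow
  positivity

section

variable {d : ℕ} {α : ℝ}

lemma norm_sub_le_of_mem_unitCell {x y : E d} (hx : x ∈ unitCell d) (hy : y ∈ unitCell d) :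
    ‖x - y‖ ≤ Real.sqrt d := by
  rw [EuclideanSpace.norm_eq]
  refine Real.sqrt_le_sqrt ?_
  calc ∑ i, ‖(x - y) i‖ ^ 2 ≤ ∑ _i : Fin d, (1 : ℝ) := by
        refine Finset.sum_le_sum fun i _ => ?_
        have h1 := hx i
        have h2 := hy i
        rw [Real.norm_eq_abs, sq_abs]
        have h3 : (x - y) i = x i - y i := rfl
        rw [h3]
        nlinarith [h1.1, h1.2, h2.1, h2.2]
    _ = d := by simp

lemma kernelLow_le [NeZero d] (hα : 0 < α) {x y : E d} (hx : x ∈ unitCell d)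
    (hy : y ∈ unitCell d) {n : Fin d → ℤ} (hn : ‖(latticePt n : E d)‖ ≤ Real.sqrt d)
    (hne : x ≠ y + latticePt n) :
    kernelLow d α ≤ ‖x - (y + latticePt n)‖ ^ (-((d : ℝ) + α)) := by
  have h1 : ‖x - (y + latticePt n)‖ ≤ 2 * Real.sqrt d := by
    have : x - (y + latticePt n) = (x - y) - latticePt n := by abel
    rw [this]
    linarith [norm_sub_le (x - y) (latticePt n), norm_sub_le_of_mem_unitCell hx hy]
  have h2 : 0 < ‖x - (y + latticePt n)‖ := norm_pos_iff.2 (sub_ne_zero.2 hne)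
  have hd : (0 : ℝ) ≤ d := Nat.cast_nonneg d
  exact Real.rpow_le_rpow_of_nonpos h2 h1 (by linarith)

/-- Only the pairs with `y` in the single cell `Ω + n` are kept; for them the kernel is at least
`kernelLow`. The kernel has the junk value `0` on the diagonal, which meets `Ω × (Ω + n)` when
`n = 0`; hence the assumption on `G` there. -/
lemma lintegral_jump_ge [NeZero d] (hα : 0 < α) {G : E d × E d → ℝ≥0∞} (hG : Measurable G)
    (hdiag : ∀ x, G (x, x) = 0) {n : Fin d → ℤ}
    (hn : ‖(latticePt n : E d)‖ ≤ Real.sqrt d) :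
    ENNReal.ofReal (kernelLow d α) * ∫⁻ q, G (q.1, q.2 + latticePt n)
        ∂(((volume : Measure (E d)).restrict (unitCell d)).prod
          ((volume : Measure (E d)).restrict (unitCell d))) ≤
      ∫⁻ p, G p ∂(jumpMeasure d α) := by
  have hw : Measurable fun p : E d × E d =>
      ENNReal.ofReal (‖p.1 - p.2‖ ^ (-((d : ℝ) + α))) := by fun_prop
  have hGn : Measurable fun q : E d × E d => G (q.1, q.2 + latticePt n) :=
    hG.comp (measurable_fst.prodMk (measurable_snd.add_const _))
  rw [jumpMeasure, lintegral_withDensity_eq_lintegral_mul _ hw hG,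
    lintegral_prod _ (hw.mul hG).aemeasurable, ← lintegral_const_mul _ hGn,
    lintegral_prod _ (hGn.const_mul _).aemeasurable]
  refine setLIntegral_mono' measurableSet_unitCell fun x hx => ?_
  refine le_trans ?_ (setLIntegral_le_lintegral (cellAt n) _)
  rw [setLIntegral_cellAt]
  refine setLIntegral_mono' measurableSet_unitCell fun y hy => ?_
  simp only [Pi.mul_apply]
  by_cases hne : x = y + latticePt n
  · rw [← hne, hdiag]; simp
  · gcongr
    exact kernelLow_le hα hx hy hn hne

lemma perExt_add_latticePt (u : L2Cell d) (y : E d) (n : Fin d → ℤ) :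
    perExt u (y + latticePt n) = perExt u y := by
  rw [perExt, toCell_add_latticePt, perExt]

/-- The twisted differences control the distance between the quasi-periodic function
`w = e^{i⟨ξ,·⟩} u` on the cell and on the cell shifted by `n`. -/
lemma kernelLow_mul_le_sq_lpNorm_twistDiff [NeZero d] (hα : α ∈ Set.Ioo (1 : ℝ) 2) (ξ : E d)
    {u : L2Cell d} (hu : u ∈ formDomain d α) {n : Fin d → ℤ}
    (hn : ‖(latticePt n : E d)‖ ≤ Real.sqrt d) :
    kernelLow d α * (2 * ‖u‖ ^ 2 - 2 * Real.cos (inner ℝ ξ (latticePt n)) *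
      ‖∫ x in unitCell d, Complex.exp (Complex.I * (inner ℝ ξ x : ℝ)) * u x‖ ^ 2) ≤
      lpNorm (twistDiff ξ u) 2 (jumpMeasure d α) ^ 2 := by
  have h0 : 0 < α := by linarith [hα.1]
  set σ := (volume : Measure (E d)).restrict (unitCell d) with hσ
  set w : E d → ℂ := fun x => Complex.exp (Complex.I * (inner ℝ ξ x : ℝ)) * u x with hw
  set θ := Complex.exp (Complex.I * (inner ℝ ξ (latticePt n) : ℝ)) with hθ
  have hnorm : ∀ x, ‖w x‖ = ‖u x‖ := fun x => by
    rw [hw, norm_mul, norm_exp_I_inner, one_mul]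
  have hwm : MemLp w 2 σ := (Lp.memLp u).of_le
    ((measurable_exp_I_inner ξ).mul (Lp.stronglyMeasurable u).measurable).aestronglyMeasurable
    (Filter.Eventually.of_forall fun x => (hnorm x).le)
  obtain ⟨hint, hval⟩ := integral_sq_sub_unimodular_mul hwm (norm_exp_I_inner ξ (latticePt n))
  have hre : θ.re = Real.cos (inner ℝ ξ (latticePt n)) := by
    rw [hθ, mul_comm, Complex.exp_ofReal_mul_I_re]
  have hu2 : ∫ x, ‖w x‖ ^ 2 ∂σ = ‖u‖ ^ 2 := by
    simp_rw [hnorm]; exact integral_sq_L2Cell u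
  have hGm : Measurable fun p => ENNReal.ofReal (‖twistDiff ξ u p‖ ^ 2) :=
    ((stronglyMeasurable_twistDiff ξ u).measurable.norm.pow_const 2).ennreal_ofReal
  have hge := lintegral_jump_ge (α := α) h0 hGm (fun x => by simp [twistDiff]) hn
  rw [lintegral_sq_norm (memLp_twistDiff h0 hα.2 ξ hu)] at hge
  have hcell : ∀ᵐ q ∂(σ.prod σ), ENNReal.ofReal (‖twistDiff ξ u (q.1, q.2 + latticePt n)‖ ^ 2) =
      ENNReal.ofReal (‖w q.1 - θ * w q.2‖ ^ 2) := by
    have hmem : ∀ᵐ x ∂σ, x ∈ unitCell d := ae_restrict_mem measurableSet_unitCell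
    filter_upwards [Measure.quasiMeasurePreserving_fst.ae hmem,
      Measure.quasiMeasurePreserving_snd.ae hmem] with q h1 h2
    have e1 : perExt u q.1 = u q.1 := by rw [perExt, toCell_eq_self h1]
    have e2 : perExt u (q.2 + latticePt n) = u q.2 := by
      rw [perExt_add_latticePt, perExt, toCell_eq_self h2]
    have e3 : Complex.exp (Complex.I * (inner ℝ ξ (q.2 + latticePt n) : ℝ)) =
        θ * Complex.exp (Complex.I * (inner ℝ ξ q.2 : ℝ)) := by
      rw [hθ, ← Complex.exp_add, inner_add_right]
      push_cast
      ring_nf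
    simp only [twistDiff, e1, e2, e3, hw]
    ring_nf
  rw [lintegral_congr_ae hcell, ← ofReal_integral_eq_lintegral_ofReal hint
    (Filter.Eventually.of_forall fun q => sq_nonneg _), hval, hu2, hre,
    ← ENNReal.ofReal_mul (kernelLow_pos d α).le] at hge
  exact (ENNReal.ofReal_le_ofReal_iff (sq_nonneg _)).1 hge

/-- The Poincaré inequality. -/
lemma norm_le_seminormH [NeZero d] (hα : α ∈ Set.Ioo (1 : ℝ) 2) {u : L2Cell d}
    (hu : u ∈ formDomain d α) (hmean : ∫ x in unitCell d, u x = 0) :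
    2 * kernelLow d α * ‖u‖ ^ 2 ≤ seminormH α u ^ 2 := by
  have hz : ‖(latticePt (0 : Fin d → ℤ) : E d)‖ ≤ Real.sqrt d := by
    have : (latticePt (0 : Fin d → ℤ) : E d) = 0 := by ext i; simp [latticePt]
    rw [this, norm_zero]; positivity
  have h := kernelLow_mul_le_sq_lpNorm_twistDiff hα 0 hu hz
  simp only [inner_zero_left, Complex.ofReal_zero, mul_zero, Complex.exp_zero, one_mul, hmean,
    norm_zero, twistDiff_zero_left] at h
  rw [seminormH]
  linarith

/-- Away from the origin of the zone `|ξ| ≤ π`, the form is bounded below by a multiple of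
`|ξ|² ‖u‖²`. -/
lemma norm_sq_mul_le_sq_lpNorm_twistDiff [NeZero d] (hα : α ∈ Set.Ioo (1 : ℝ) 2) {ξ : E d}
    (hξ : ‖ξ‖ ≤ Real.pi) {u : L2Cell d} (hu : u ∈ formDomain d α) :
    2 * kernelLow d α / (d * Real.pi ^ 2) * ‖ξ‖ ^ 2 * ‖u‖ ^ 2 ≤
      lpNorm (twistDiff ξ u) 2 (jumpMeasure d α) ^ 2 := by
  have hd : (0 : ℝ) < d := by exact_mod_cast Nat.pos_of_ne_zero (NeZero.ne d)
  have hd1 : 1 ≤ Real.sqrt d := by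
    rw [Real.one_le_sqrt]; exact_mod_cast Nat.one_le_iff_ne_zero.2 (NeZero.ne d)
  have hκ := kernelLow_pos d α
  set T := lpNorm (twistDiff ξ u) 2 (jumpMeasure d α) ^ 2 with hT
  set M := ‖∫ x in unitCell d, Complex.exp (Complex.I * (inner ℝ ξ x : ℝ)) * u x‖ ^ 2 with hM
  have hM1 : M ≤ ‖u‖ ^ 2 := by
    have h1 : ‖∫ x in unitCell d, Complex.exp (Complex.I * (inner ℝ ξ x : ℝ)) * u x‖ ≤ ‖u‖ := by
      have h2 := norm_integral_le_lintegral_norm (μ := (volume : Measure (E d)).restrict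
        (unitCell d)) (fun x => Complex.exp (Complex.I * (inner ℝ ξ x : ℝ)) * u x)
      simp only [norm_mul, norm_exp_I_inner, one_mul] at h2
      exact h2.trans (ENNReal.toReal_le_of_le_ofReal (norm_nonneg _) (lintegral_norm_L2Cell_le u))
    exact pow_le_pow_left₀ (norm_nonneg _) h1 2
  -- The cell itself gives `2 (‖u‖² - M)`, the neighbour in direction `j` gives
  -- `2 (‖u‖² - M cos ξ_j)`. Since `M ≤ ‖u‖²`, half the sum of the two bounds the term with
  -- `1 - cos ξ_j` that does not contain `M`.
  have hzero : kernelLow d α * (2 * ‖u‖ ^ 2 - 2 * M) ≤ T := by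
    have hz : (latticePt (0 : Fin d → ℤ) : E d) = 0 := by ext i; simp [latticePt]
    have h := kernelLow_mul_le_sq_lpNorm_twistDiff hα ξ hu (n := 0)
      (by rw [hz, norm_zero]; positivity)
    rw [hz, inner_zero_right, Real.cos_zero, mul_one] at h
    exact h
  have hcoord : ∀ j : Fin d, kernelLow d α * ((1 - Real.cos (ξ j)) * ‖u‖ ^ 2) ≤ T := by
    intro j
    have he : (latticePt (Pi.single j 1 : Fin d → ℤ) : E d) = EuclideanSpace.single j (1 : ℝ) := by
      ext i
      by_cases h : i = j
      · subst h; simp [latticePt]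
      · simp [latticePt, h]
    have h := kernelLow_mul_le_sq_lpNorm_twistDiff hα ξ hu (n := Pi.single j 1)
      (by rw [he]; simpa using hd1)
    rw [he, EuclideanSpace.inner_single_right] at h
    simp only [one_mul, conj_trivial] at h
    have h3 : 0 ≤ kernelLow d α * ((1 + Real.cos (ξ j)) * (‖u‖ ^ 2 - M)) :=
      mul_nonneg hκ.le (mul_nonneg (by linarith [Real.neg_one_le_cos (ξ j)]) (by linarith))
    nlinarith
  -- Jordan's inequality `1 - cos t ≥ 2t²/π²` on `[-π, π]`.
  have hquad : ∀ j : Fin d, kernelLow d α * (2 / Real.pi ^ 2 * ξ j ^ 2 * ‖u‖ ^ 2) ≤ T := by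
    intro j
    refine le_trans ?_ (hcoord j)
    have h1 : |ξ j| ≤ Real.pi := (PiLp.norm_apply_le ξ j).trans hξ
    have h2 := Real.cos_le_one_sub_mul_cos_sq h1
    gcongr
    linarith
  have hsum : ∑ j : Fin d, kernelLow d α * (2 / Real.pi ^ 2 * ξ j ^ 2 * ‖u‖ ^ 2) ≤ d * T := by
    refine (Finset.sum_le_sum fun j _ => hquad j).trans (le_of_eq ?_)
    simp
  have hsq : ∑ j : Fin d, ξ j ^ 2 = ‖ξ‖ ^ 2 := by
    rw [EuclideanSpace.norm_sq_eq]; simp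
  rw [← Finset.mul_sum, ← Finset.sum_mul, ← Finset.mul_sum, hsq] at hsum
  rw [← mul_le_mul_iff_right₀ hd]
  refine le_trans (le_of_eq ?_) hsum
  field_simp

end

/-! ### The energy space and the resolvent -/

section GraphSpace

variable {H₁ H₂ : Type*} [NormedAddCommGroup H₁] [InnerProductSpace ℂ H₁] [CompleteSpace H₁]
  [NormedAddCommGroup H₂] [InnerProductSpace ℂ H₂] [CompleteSpace H₂]

/-- For a closed subspace `G` of `H₁ × H₂`, with projection `ι` to `H₁`, the operator `ι ι*` maps `f`
to the first component of the representative in `G` of the functional `(f, ·)`. -/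
lemma exists_resolvent_of_isClosed {G : Submodule ℂ (WithLp 2 (H₁ × H₂))}
    (hG : IsClosed (G : Set (WithLp 2 (H₁ × H₂)))) :
    ∃ R : H₁ →L[ℂ] H₁, ∀ f, ∃ x ∈ G, R f = x.fst ∧
      ∀ y ∈ G, inner ℂ y.fst x.fst + inner ℂ y.snd x.snd = inner ℂ y.fst f := by
  have : CompleteSpace G := hG.completeSpace_coe
  let ι : G →L[ℂ] H₁ := (WithLp.fstL 2 ℂ H₁ H₂).comp G.subtypeL
  refine ⟨ι.comp (ContinuousLinearMap.adjoint ι), fun f => ?_⟩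
  refine ⟨ContinuousLinearMap.adjoint ι f, Submodule.coe_mem _, rfl, fun y hy => ?_⟩
  have h1 : inner ℂ (⟨y, hy⟩ : G) (ContinuousLinearMap.adjoint ι f) = inner ℂ y.fst f :=
    ContinuousLinearMap.adjoint_inner_right ι ⟨y, hy⟩ f
  rw [← h1, Submodule.coe_inner, WithLp.prod_inner_apply]
  rfl

/-- A Lax–Milgram lemma: if the second component controls the first one on the closed subspace `G`,
then every bounded functional on `G` is represented by the semi-inner product of second
components. -/
lemma exists_inner_snd_eq {G : Submodule ℂ (WithLp 2 (H₁ × H₂))}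
    (hG : IsClosed (G : Set (WithLp 2 (H₁ × H₂)))) {C : ℝ} (hC : 0 ≤ C)
    (hP : ∀ x ∈ G, ‖x.fst‖ ^ 2 ≤ C * ‖x.snd‖ ^ 2) (L : G →L[ℂ] ℂ) :
    ∃ x ∈ G, ∀ y (hy : y ∈ G), inner ℂ y.snd x.snd = starRingEnd ℂ (L ⟨y, hy⟩) := by
  have : CompleteSpace G := hG.completeSpace_coe
  let π : G →L[ℂ] H₂ := (WithLp.sndL 2 ℂ H₁ H₂).comp G.subtypeL
  let B : G →L[ℂ] G := (ContinuousLinearMap.adjoint π).comp π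
  have hB : ∀ y x : G, inner ℂ y (B x) = inner ℂ (π y) (π x) := fun y x =>
    ContinuousLinearMap.adjoint_inner_right π y (π x)
  have hunit : IsUnit B := by
    refine ContinuousLinearMap.isUnit_of_forall_le_norm_inner_map B
      (c := Real.toNNReal (1 + C)⁻¹) (Real.toNNReal_pos.2 (by positivity)) fun x => ?_
    have h1 : ‖inner ℂ (B x) x‖ = ‖π x‖ ^ 2 := by
      calc ‖inner ℂ (B x) x‖ = ‖inner ℂ x (B x)‖ :=
          norm_inner_symm (𝕜 := ℂ) (E := G) (B x) x
        _ = ‖inner ℂ (π x) (π x)‖ := by rw [hB]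
        _ = ‖π x‖ ^ 2 := by rw [inner_self_eq_norm_sq_to_K]; simp
    have h2 : ‖x‖ ^ 2 = ‖(x : WithLp 2 (H₁ × H₂)).fst‖ ^ 2 + ‖π x‖ ^ 2 :=
      WithLp.prod_norm_sq_eq_of_L2 (x : WithLp 2 (H₁ × H₂))
    have h3 : ‖(x : WithLp 2 (H₁ × H₂)).fst‖ ^ 2 ≤ C * ‖π x‖ ^ 2 := hP x x.2
    rw [h1, h2, Real.coe_toNNReal _ (by positivity), ← div_eq_mul_inv, div_le_iff₀ (by positivity)]
    linarith
  obtain ⟨B', hB'⟩ := hunit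
  set z := (InnerProductSpace.toDual ℂ G).symm L with hz
  set x : G := (↑B'⁻¹ : G →L[ℂ] G) z with hx
  have hBx : B x = z := by
    have h1 : (B * (↑B'⁻¹ : G →L[ℂ] G)) z = z := by
      rw [← hB', Units.mul_inv]; rfl
    exact h1
  refine ⟨x, x.2, fun y hy => ?_⟩
  calc inner ℂ y.snd (x : WithLp 2 (H₁ × H₂)).snd = inner ℂ (π ⟨y, hy⟩) (π x) := rfl
    _ = inner ℂ (⟨y, hy⟩ : G) z := by rw [← hBx, hB]
    _ = starRingEnd ℂ (inner ℂ z (⟨y, hy⟩ : G)) :=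
      (inner_conj_symm (𝕜 := ℂ) (E := G) ⟨y, hy⟩ z).symm
    _ = starRingEnd ℂ (L ⟨y, hy⟩) :=
      congrArg (starRingEnd ℂ) InnerProductSpace.toDual_symm_apply

end GraphSpace

/-- The square root of the weight `μ(x,y) / (2s)`. -/
noncomputable def rootWeight {d : ℕ} (μ : E d → E d → ℝ) (s : ℝ) (p : E d × E d) : ℝ :=
  Real.sqrt (μ p.1 p.2 / (2 * s))

/-- The graph space of the form: the pairs `(u, F)` in `L₂(Ω) × L₂(J)`, with `J` the jump measure,
for which `F` is the twisted difference of `u` multiplied by `(μ / (2s))^{1/2}`. Its squared norm is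
`‖u‖² + s⁻¹ a(ξ)[u,u]`. -/
noncomputable def energySpace {d : ℕ} (μ : E d → E d → ℝ) (α : ℝ) (ξ : E d) (s : ℝ) :
    Submodule ℂ (WithLp 2 (L2Cell d × Lp ℂ 2 (jumpMeasure d α))) where
  carrier := {q | ∀ᵐ p ∂(jumpMeasure d α), q.snd p = rootWeight μ s p * twistDiff ξ q.fst p}
  add_mem' := by
    intro q r hq hr
    simp only [Set.mem_ofPred_eq, WithLp.add_fst, WithLp.add_snd] at *
    filter_upwards [hq, hr, Lp.coeFn_add q.snd r.snd, twistDiff_add (α := α) ξ q.fst r.fst]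
      with p h1 h2 h3 h4
    rw [h3, h4, Pi.add_apply, Pi.add_apply, h1, h2, mul_add]
  zero_mem' := by
    simp only [Set.mem_ofPred_eq, WithLp.zero_fst, WithLp.zero_snd]
    filter_upwards [Lp.coeFn_zero ℂ 2 (jumpMeasure d α), twistDiff_zero (α := α) ξ] with p h1 h2
    rw [h1, h2]
    simp
  smul_mem' := by
    intro c q hq
    simp only [Set.mem_ofPred_eq, WithLp.smul_fst, WithLp.smul_snd] at *
    filter_upwards [hq, Lp.coeFn_smul c q.snd, twistDiff_smul (α := α) ξ c q.fst] with p h1 h2 h3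
    rw [h2, h3, Pi.smul_apply, Pi.smul_apply, h1, smul_eq_mul, smul_eq_mul, mul_left_comm]

section

variable {d : ℕ} {α μlo μhi : ℝ} {μ : E d → E d → ℝ}

lemma mem_energySpace {ξ : E d} {s : ℝ}
    {q : WithLp 2 (L2Cell d × Lp ℂ 2 (jumpMeasure d α))} :
    q ∈ energySpace μ α ξ s ↔
      ∀ᵐ p ∂(jumpMeasure d α), q.snd p = rootWeight μ s p * twistDiff ξ q.fst p := Iff.rfl

/-- The form is closed. -/
lemma isClosed_energySpace (μ : E d → E d → ℝ) (α : ℝ) (ξ : E d) (s : ℝ) :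
    IsClosed (energySpace μ α ξ s :
      Set (WithLp 2 (L2Cell d × Lp ℂ 2 (jumpMeasure d α)))) := by
  refine IsSeqClosed.isClosed fun q r hq hqr => ?_
  have h1 : Filter.Tendsto (fun n => (q n).fst) Filter.atTop (nhds r.fst) :=
    (WithLp.fstL 2 ℂ _ _).continuous.continuousAt.tendsto.comp hqr
  have h2 : Filter.Tendsto (fun n => (q n).snd) Filter.atTop (nhds r.snd) :=
    (WithLp.sndL 2 ℂ _ _).continuous.continuousAt.tendsto.comp hqr
  obtain ⟨φ, hφ, hφ'⟩ := (tendstoInMeasure_of_tendsto_Lp h1).exists_seq_tendsto_ae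
  obtain ⟨ψ, hψ, hψ'⟩ := (tendstoInMeasure_of_tendsto_Lp
    (h2.comp hφ.tendsto_atTop)).exists_seq_tendsto_ae
  have hper : ∀ᵐ x : E d, Filter.Tendsto (fun n => perExt (q (φ n)).fst x) Filter.atTop
      (nhds (perExt r.fst x)) := quasiMeasurePreserving_toCell.ae hφ'
  have hall : ∀ᵐ p ∂(jumpMeasure d α), ∀ n,
      (q n).snd p = rootWeight μ s p * twistDiff ξ (q n).fst p :=
    ae_all_iff.2 fun n => hq n
  rw [SetLike.mem_coe, mem_energySpace]
  filter_upwards [ae_jump_of_ae (α := α) hper, hψ', hall] with p hp1 hp2 hp3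
  have hlim : Filter.Tendsto (fun n => rootWeight μ s p * twistDiff ξ (q (φ (ψ n))).fst p)
      Filter.atTop (nhds (rootWeight μ s p * twistDiff ξ r.fst p)) :=
    (((hp1.1.comp hψ.tendsto_atTop).const_mul _).sub
      ((hp1.2.comp hψ.tendsto_atTop).const_mul _)).const_mul _
  refine tendsto_nhds_unique hp2 (hlim.congr fun n => ?_)
  exact (hp3 (φ (ψ n))).symm

lemma rootWeight_sq (hμ : IsCoefficient μlo μhi μ) (hlo : 0 < μlo) {s : ℝ} (hs : 0 < s) :
    ∀ᵐ p ∂(jumpMeasure d α), rootWeight μ s p ^ 2 = μ p.1 p.2 / (2 * s) ∧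
      Real.sqrt (μlo / (2 * s)) ≤ rootWeight μ s p ∧
      rootWeight μ s p ≤ Real.sqrt (μhi / (2 * s)) := by
  filter_upwards [hμ.ae_jump_bounds α] with p hp
  refine ⟨Real.sq_sqrt (div_nonneg (hlo.le.trans hp.1) (by positivity)), ?_, ?_⟩
  · exact Real.sqrt_le_sqrt (div_le_div_of_nonneg_right hp.1 (by positivity))
  · exact Real.sqrt_le_sqrt (div_le_div_of_nonneg_right hp.2 (by positivity))

lemma fst_mem_formDomain [NeZero d] (hα : α ∈ Set.Ioo (1 : ℝ) 2) (hμ : IsCoefficient μlo μhi μ)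
    (hlo : 0 < μlo) {ξ : E d} {s : ℝ} (hs : 0 < s)
    {q : WithLp 2 (L2Cell d × Lp ℂ 2 (jumpMeasure d α))} (hq : q ∈ energySpace μ α ξ s) :
    q.fst ∈ formDomain d α := by
  have hpos : 0 < Real.sqrt (μlo / (2 * s)) := Real.sqrt_pos.2 (by positivity)
  refine mem_formDomain_of_memLp_twistDiff hα (ξ := ξ) ?_
  refine (Lp.memLp q.snd).of_le_mul (c := (Real.sqrt (μlo / (2 * s)))⁻¹)
    (stronglyMeasurable_twistDiff ξ _).aestronglyMeasurable ?_
  filter_upwards [mem_energySpace.1 hq, rootWeight_sq hμ hlo hs] with p h1 h2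
  rw [h1, norm_mul, Complex.norm_real, Real.norm_of_nonneg (hpos.le.trans h2.2.1), ← mul_assoc]
  refine le_mul_of_one_le_left (norm_nonneg _) ?_
  rw [inv_mul_eq_div, one_le_div hpos]
  exact h2.2.1

lemma exists_mem_energySpace [NeZero d] (hα : α ∈ Set.Ioo (1 : ℝ) 2)
    (hμ : IsCoefficient μlo μhi μ) (hlo : 0 < μlo) (ξ : E d) {s : ℝ} (hs : 0 < s) {u : L2Cell d}
    (hu : u ∈ formDomain d α) : ∃ q ∈ energySpace μ α ξ s, q.fst = u := by
  have htw := memLp_twistDiff (by linarith [hα.1]) hα.2 ξ hu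
  have hm : AEStronglyMeasurable (fun p => (rootWeight μ s p : ℂ)) (jumpMeasure d α) := by
    have h1 : AEMeasurable (fun p : E d × E d => μ p.1 p.2) (jumpMeasure d α) :=
      hμ.aemeasurable.mono_ac (jumpMeasure_ac d α)
    exact (Complex.measurable_ofReal.comp_aemeasurable
      (h1.div_const _).sqrt).aestronglyMeasurable
  have hmem : MemLp (fun p => (rootWeight μ s p : ℂ) * twistDiff ξ u p) 2 (jumpMeasure d α) := by
    refine htw.of_le_mul (c := Real.sqrt (μhi / (2 * s))) (hm.mul htw.1) ?_
    filter_upwards [rootWeight_sq (α := α) hμ hlo hs] with p h2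
    rw [norm_mul, Complex.norm_real, Real.norm_of_nonneg (show 0 ≤ rootWeight μ s p from Real.sqrt_nonneg _)]
    exact mul_le_mul_of_nonneg_right h2.2.2 (norm_nonneg _)
  exact ⟨WithLp.toLp 2 (u, hmem.toLp), hmem.coeFn_toLp, rfl⟩

lemma inner_snd_energySpace (hμ : IsCoefficient μlo μhi μ) (hlo : 0 < μlo) {ξ : E d} {s : ℝ}
    (hs : 0 < s) {q r : WithLp 2 (L2Cell d × Lp ℂ 2 (jumpMeasure d α))}
    (hq : q ∈ energySpace μ α ξ s) (hr : r ∈ energySpace μ α ξ s) :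
    inner ℂ r.snd q.snd = (s : ℂ)⁻¹ * form μ α ξ q.fst r.fst := by
  rw [L2.inner_def, form, ← mul_assoc, ← integral_const_mul]
  refine integral_congr_ae ?_
  filter_upwards [mem_energySpace.1 hq, mem_energySpace.1 hr, rootWeight_sq hμ hlo hs]
    with p h1 h2 h3
  have h4 : (rootWeight μ s p : ℂ) * (rootWeight μ s p : ℂ) = (μ p.1 p.2 : ℂ) / (2 * s) := by
    rw [← sq]
    exact_mod_cast congrArg ((↑) : ℝ → ℂ) h3.1
  rw [RCLike.inner_apply, h1, h2, map_mul, Complex.conj_ofReal]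
  calc _ = (rootWeight μ s p * rootWeight μ s p : ℂ) *
        (twistDiff ξ q.fst p * starRingEnd ℂ (twistDiff ξ r.fst p)) := by ring
    _ = _ := by
      rw [h4]
      field_simp

/-- The weak resolvent equation `a(ξ)[u,η] + s (u,η) = (f,η)` is solved by a bounded operator. It is
`s⁻¹ ι ι*`, where `ι` is the projection of the energy space to `L₂(Ω)`. -/
lemma exists_weak_resolvent [NeZero d] (hα : α ∈ Set.Ioo (1 : ℝ) 2)
    (hμ : IsCoefficient μlo μhi μ) (hlo : 0 < μlo) (ξ : E d) {s : ℝ} (hs : 0 < s) :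
    ∃ R : L2Cell d →L[ℂ] L2Cell d, ∀ f, R f ∈ formDomain d α ∧ ∀ η ∈ formDomain d α,
      form μ α ξ (R f) η + s * inner ℂ η (R f) = inner ℂ η f := by
  obtain ⟨R, hR⟩ := exists_resolvent_of_isClosed (isClosed_energySpace μ α ξ s)
  have hsc : (s : ℂ) ≠ 0 := by exact_mod_cast hs.ne'
  refine ⟨(s : ℂ)⁻¹ • R, fun f => ?_⟩
  obtain ⟨x, hx, hRx, hxf⟩ := hR f
  have hxV := fst_mem_formDomain hα hμ hlo hs hx
  rw [smul_apply, hRx]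
  refine ⟨Submodule.smul_mem _ _ hxV, fun η hη => ?_⟩
  obtain ⟨q, hq, rfl⟩ := exists_mem_energySpace hα hμ hlo ξ hs hη
  rw [form_smul_left, inner_smul_right, ← hxf q hq, inner_snd_energySpace hμ hlo hs hx hq]
  field_simp
  ring

lemma eq_zero_of_weak_resolvent [NeZero d] (hα : α ∈ Set.Ioo (1 : ℝ) 2)
    (hμ : IsCoefficient μlo μhi μ) (hlo : 0 < μlo) (ξ : E d) {s : ℝ} (hs : 0 < s) {u : L2Cell d}
    (hu : u ∈ formDomain d α)
    (h : ∀ η ∈ formDomain d α, form μ α ξ u η + s * inner ℂ η u = 0) : u = 0 := by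
  have h1 := congrArg Complex.re (h u hu)
  have h2 := re_form_self_ge hα hμ ξ hu
  have h3 : 0 ≤ μlo / 2 * lpNorm (twistDiff ξ u) 2 (jumpMeasure d α) ^ 2 := by positivity
  have hself : (inner ℂ u u).re = ‖u‖ ^ 2 := inner_self_eq_norm_sq (𝕜 := ℂ) u
  rw [Complex.add_re, Complex.re_ofReal_mul, hself, Complex.zero_re] at h1
  have h4 : s * ‖u‖ ^ 2 ≤ 0 := by linarith
  have h5 : ‖u‖ ^ 2 ≤ 0 := by
    by_contra hne
    push Not at hne
    nlinarith
  exact norm_eq_zero.1 (by nlinarith [norm_nonneg u])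

/-- The weak solution operator is the resolvent of the operator generated by the form. -/
lemma isInverseOfShift_levyOperator [NeZero d] (hα : α ∈ Set.Ioo (1 : ℝ) 2)
    (hμ : IsCoefficient μlo μhi μ) (hlo : 0 < μlo) (ξ : E d) {s : ℝ} (hs : 0 < s)
    {R : L2Cell d →L[ℂ] L2Cell d} (hR : ∀ f, R f ∈ formDomain d α ∧ ∀ η ∈ formDomain d α,
      form μ α ξ (R f) η + s * inner ℂ η (R f) = inner ℂ η f) :
    IsInverseOfShift (levyOperator hα hμ ξ) s R := by
  have hsv : ∀ x ∈ operatorGraph hα hμ ξ, x.1 = 0 → x.2 = 0 :=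
    operatorGraph_single_valued hα hμ ξ
  constructor
  · intro f
    have hg : (R f, f - (s : ℂ) • R f) ∈ operatorGraph hα hμ ξ := by
      refine ⟨(hR f).1, fun η hη => ?_⟩
      rw [inner_sub_right, inner_smul_right, ← (hR f).2 η hη]
      ring
    rw [← Submodule.toLinearPMap_graph_eq _ hsv, LinearPMap.mem_graph_iff] at hg
    obtain ⟨u, hu1, hu2⟩ := hg
    refine ⟨u, hu1, ?_⟩
    change levyOperator hα hμ ξ u = f - (s : ℂ) • R f at hu2
    rw [hu2, hu1]
    simp
  · intro u
    have hg : ((u : L2Cell d), levyOperator hα hμ ξ u) ∈ operatorGraph hα hμ ξ :=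
      Submodule.mem_graph_toLinearPMap hsv u
    set f := levyOperator hα hμ ξ u + (s : ℂ) • (u : L2Cell d) with hf
    rw [← sub_eq_zero]
    refine eq_zero_of_weak_resolvent hα hμ hlo ξ hs (Submodule.sub_mem _ (hR f).1 hg.1)
      fun η hη => ?_
    have h1 := (hR f).2 η hη
    have h2 := hg.2 η hη
    have h3 : inner ℂ η f = inner ℂ η (levyOperator hα hμ ξ u) + s * inner ℂ η (u : L2Cell d) := by
      rw [hf, inner_add_right, inner_smul_right]
    simp only at h2
    rw [sub_eq_add_neg, ← neg_one_smul ℂ (u : L2Cell d), form_add_left hα hμ ξ (hR f).1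
      (Submodule.smul_mem _ _ hg.1) hη, form_smul_left, inner_add_right, inner_smul_right, h2]
    linear_combination h1 + h3

end

/-! ### The auxiliary problems on the cell -/

/-- The constant in the Poincaré inequality `‖u‖ ≤ C |u|` for mean zero functions. -/
noncomputable def poincareConst (d : ℕ) (α : ℝ) : ℝ := (Real.sqrt (2 * kernelLow d α))⁻¹

/-- The norm of the dipole functional on mean zero functions is at most this constant times
`|ξ|`. -/
noncomputable def dipoleConst (d : ℕ) (α μhi : ℝ) : ℝ :=
  μhi / 2 * (Real.sqrt (weightInt d α) + 2 * weightInt d α * poincareConst d α)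

section

variable {d : ℕ} {α μlo μhi : ℝ} {μ : E d → E d → ℝ}

lemma poincareConst_nonneg (d : ℕ) (α : ℝ) : 0 ≤ poincareConst d α :=
  inv_nonneg.2 (Real.sqrt_nonneg _)

lemma dipoleConst_nonneg (d : ℕ) (α : ℝ) (h : 0 ≤ μhi) : 0 ≤ dipoleConst d α μhi := by
  have := weightInt_nonneg d α
  have := poincareConst_nonneg d α
  unfold dipoleConst
  positivity

lemma norm_le_poincareConst_mul [NeZero d] (hα : α ∈ Set.Ioo (1 : ℝ) 2) {u : L2Cell d}
    (hu : u ∈ formDomain d α) (hmean : ∫ x in unitCell d, u x = 0) :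
    ‖u‖ ≤ poincareConst d α * seminormH α u := by
  have h := norm_le_seminormH hα hu hmean
  have hκ : 0 < 2 * kernelLow d α := by linarith [kernelLow_pos d α]
  have hs := Real.sqrt_pos.2 hκ
  rw [poincareConst, inv_mul_eq_div, le_div_iff₀ hs]
  refine le_of_sq_le_sq ?_ (seminormH_nonneg α u)
  rw [mul_pow, Real.sq_sqrt hκ.le]
  linarith

lemma norm_dipole_le [NeZero d] (hα : α ∈ Set.Ioo (1 : ℝ) 2) (hμ : IsCoefficient μlo μhi μ)
    (hlo : 0 < μlo) (ξ : E d) {u : L2Cell d} (hu : u ∈ formDomain d α)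
    (hmean : ∫ x in unitCell d, u x = 0) :
    ‖dipole μ α ξ u‖ ≤ dipoleConst d α μhi * ‖ξ‖ * seminormH α u := by
  have hhi : 0 ≤ μhi := hlo.le.trans hμ.lo_le_hi
  have hK := weightInt_nonneg d α
  refine (integrable_dipole hα hμ hlo ξ hu).2.trans ?_
  have h := norm_le_poincareConst_mul hα hu hmean
  calc _ ≤ μhi / 2 * ‖ξ‖ * (Real.sqrt (weightInt d α) * seminormH α u +
        2 * weightInt d α * (poincareConst d α * seminormH α u)) := by gcongr
    _ = _ := by rw [dipoleConst]; ring

lemma cellDiff_add (α : ℝ) (u v : L2Cell d) :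
    ∀ᵐ p ∂(jumpMeasure d α), cellDiff (u + v) p = cellDiff u p + cellDiff v p := by
  filter_upwards [ae_jump_of_ae (α := α) (perExt_add u v)] with p hp
  simp only [cellDiff, hp.1, hp.2]
  ring

lemma cellDiff_smul (α : ℝ) (c : ℂ) (u : L2Cell d) :
    ∀ᵐ p ∂(jumpMeasure d α), cellDiff (c • u) p = c * cellDiff u p := by
  filter_upwards [ae_jump_of_ae (α := α) (perExt_smul c u)] with p hp
  simp only [cellDiff, hp.1, hp.2]
  ring

lemma cellDiff_oneCell (d : ℕ) (α : ℝ) :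
    ∀ᵐ p ∂(jumpMeasure d α), cellDiff (oneCell d) p = 0 := by
  filter_upwards [ae_jump_of_ae (α := α) (perExt_oneCell d)] with p hp
  simp [cellDiff, hp.1, hp.2]

lemma dipole_add [NeZero d] (hα : α ∈ Set.Ioo (1 : ℝ) 2) (hμ : IsCoefficient μlo μhi μ)
    (hlo : 0 < μlo) (ξ : E d) {u v : L2Cell d} (hu : u ∈ formDomain d α)
    (hv : v ∈ formDomain d α) :
    dipole μ α ξ (u + v) = dipole μ α ξ u + dipole μ α ξ v := by
  unfold dipole
  rw [← mul_add, ← integral_add (integrable_dipole hα hμ hlo ξ hu).1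
    (integrable_dipole hα hμ hlo ξ hv).1]
  congr 1
  refine integral_congr_ae ?_
  filter_upwards [cellDiff_add α u v] with p hp
  rw [hp, map_add]
  ring

lemma dipole_smul (μ : E d → E d → ℝ) (α : ℝ) (ξ : E d) (c : ℂ) (u : L2Cell d) :
    dipole μ α ξ (c • u) = starRingEnd ℂ c * dipole μ α ξ u := by
  unfold dipole
  have h : ∫ p, (μ p.1 p.2 : ℂ) * (((inner ℝ ξ (p.1 - p.2) : ℝ) : ℂ) *
        starRingEnd ℂ (cellDiff (c • u) p)) ∂(jumpMeasure d α) =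
      starRingEnd ℂ c * ∫ p, (μ p.1 p.2 : ℂ) * (((inner ℝ ξ (p.1 - p.2) : ℝ) : ℂ) *
        starRingEnd ℂ (cellDiff u p)) ∂(jumpMeasure d α) := by
    rw [← integral_const_mul]
    refine integral_congr_ae ?_
    filter_upwards [cellDiff_smul α c u] with p hp
    rw [hp, map_mul]
    ring
  rw [h]
  ring

lemma dipole_oneCell (μ : E d → E d → ℝ) (α : ℝ) (ξ : E d) : dipole μ α ξ (oneCell d) = 0 := by
  unfold dipole
  rw [integral_eq_zero_of_ae, mul_zero]
  filter_upwards [cellDiff_oneCell d α] with p hp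
  simp [hp]

lemma form_zero_oneCell (μ : E d → E d → ℝ) (α : ℝ) (u : L2Cell d) :
    form μ α 0 u (oneCell d) = 0 := by
  unfold form
  rw [integral_eq_zero_of_ae, mul_zero]
  filter_upwards [cellDiff_oneCell d α] with p hp
  simp [twistDiff_zero_left, hp]

/-- The auxiliary problem in terms of the form `a(0)` and the dipole functional. -/
lemma isCellSolution_iff [NeZero d] (hα : α ∈ Set.Ioo (1 : ℝ) 2) (hμ : IsCoefficient μlo μhi μ)
    (hlo : 0 < μlo) (k : Fin d) (v : L2Cell d) :
    IsCellSolution μ α k v ↔ v ∈ formDomain d α ∧ (∫ x in unitCell d, v x) = 0 ∧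
      ∀ η ∈ formDomain d α,
        form μ α 0 v η = -dipole μ α (EuclideanSpace.single k (1 : ℝ)) η := by
  refine and_congr_right fun hv => and_congr_right fun _ => forall₂_congr fun η hη => ?_
  have i1 := integrable_form (by linarith [hα.1]) hα.2 hμ 0 hv hη
  have i2 := (integrable_dipole hα hμ hlo (EuclideanSpace.single k (1 : ℝ)) hη).1
  have h1 : ∫ p, (μ p.1 p.2 : ℂ) * ((perExt v p.1 - perExt v p.2 + ((p.1 k - p.2 k : ℝ) : ℂ)) *
      starRingEnd ℂ (perExt η p.1 - perExt η p.2)) ∂(jumpMeasure d α) =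
      2 * (form μ α 0 v η + dipole μ α (EuclideanSpace.single k (1 : ℝ)) η) := by
    rw [form, dipole, ← mul_add, ← integral_add i1 i2, ← mul_assoc,
      show (2 : ℂ) * (1 / 2) = 1 by norm_num, one_mul]
    refine integral_congr_ae (Filter.Eventually.of_forall fun p => ?_)
    simp only [twistDiff_zero_left, cellDiff, EuclideanSpace.inner_single_left, map_one, one_mul,
      PiLp.sub_apply]
    ring
  rw [h1, mul_eq_zero, or_iff_right two_ne_zero, add_eq_zero_iff_eq_neg]

lemma eq_zero_of_form_zero_eq_zero [NeZero d] (hα : α ∈ Set.Ioo (1 : ℝ) 2)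
    (hμ : IsCoefficient μlo μhi μ) (hlo : 0 < μlo) {u : L2Cell d} (hu : u ∈ formDomain d α)
    (hmean : ∫ x in unitCell d, u x = 0) (h : form μ α 0 u u = 0) : u = 0 := by
  have h1 := re_form_self_ge hα hμ 0 hu
  rw [h, Complex.zero_re, twistDiff_zero_left] at h1
  have h2 := norm_le_seminormH hα hu hmean
  have h3 : lpNorm (cellDiff u) 2 (jumpMeasure d α) ^ 2 ≤ 0 := by
    by_contra hne
    push Not at hne
    nlinarith
  rw [seminormH] at h2
  have h4 : ‖u‖ ^ 2 ≤ 0 := by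
    by_contra hne
    push Not at hne
    nlinarith [kernelLow_pos d α]
  exact norm_eq_zero.1 (by nlinarith [norm_nonneg u])

/-- The part of the energy space (for `ξ = 0`) of mean zero functions. -/
noncomputable def meanZeroSpace (μ : E d → E d → ℝ) (α : ℝ) :
    Submodule ℂ (WithLp 2 (L2Cell d × Lp ℂ 2 (jumpMeasure d α))) :=
  energySpace μ α 0 1 ⊓
    LinearMap.ker ((innerSL ℂ (oneCell d)).comp (WithLp.fstL 2 ℂ (L2Cell d)
      (Lp ℂ 2 (jumpMeasure d α)))).toLinearMap

lemma mem_meanZeroSpace {q : WithLp 2 (L2Cell d × Lp ℂ 2 (jumpMeasure d α))} :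
    q ∈ meanZeroSpace μ α ↔ q ∈ energySpace μ α 0 1 ∧ ∫ x in unitCell d, q.fst x = 0 := by
  rw [meanZeroSpace, Submodule.mem_inf, LinearMap.mem_ker, ← inner_oneCell]
  rfl

lemma isClosed_meanZeroSpace (μ : E d → E d → ℝ) (α : ℝ) :
    IsClosed (meanZeroSpace μ α : Set (WithLp 2 (L2Cell d × Lp ℂ 2 (jumpMeasure d α)))) :=
  (isClosed_energySpace μ α 0 1).inter (ContinuousLinearMap.isClosed_ker
    ((innerSL ℂ (oneCell d)).comp (WithLp.fstL 2 ℂ (L2Cell d) (Lp ℂ 2 (jumpMeasure d α)))))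

lemma sq_seminormH_le_sq_norm_snd [NeZero d] (hα : α ∈ Set.Ioo (1 : ℝ) 2)
    (hμ : IsCoefficient μlo μhi μ) (hlo : 0 < μlo)
    {q : WithLp 2 (L2Cell d × Lp ℂ 2 (jumpMeasure d α))} (hq : q ∈ energySpace μ α 0 1) :
    μlo / 2 * seminormH α q.fst ^ 2 ≤ ‖q.snd‖ ^ 2 := by
  have h1 := inner_snd_energySpace hμ hlo one_pos hq hq
  have h2 := re_form_self_ge hα hμ 0 (fst_mem_formDomain hα hμ hlo one_pos hq)
  have h3 : (inner ℂ q.snd q.snd).re = ‖q.snd‖ ^ 2 := inner_self_eq_norm_sq (𝕜 := ℂ) q.snd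
  rw [h1, Complex.ofReal_one, inv_one, one_mul] at h3
  rw [twistDiff_zero_left] at h2
  rw [← h3]
  exact h2

lemma exists_isCellSolution [NeZero d] (hα : α ∈ Set.Ioo (1 : ℝ) 2)
    (hμ : IsCoefficient μlo μhi μ) (hlo : 0 < μlo) (k : Fin d) :
    ∃ v : L2Cell d, IsCellSolution μ α k v := by
  set e : E d := EuclideanSpace.single k (1 : ℝ) with he
  have hhi : 0 ≤ μhi := hlo.le.trans hμ.lo_le_hi
  have hV : ∀ {q : WithLp 2 (L2Cell d × Lp ℂ 2 (jumpMeasure d α))}, q ∈ meanZeroSpace μ α →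
      q.fst ∈ formDomain d α := fun hq =>
    fst_mem_formDomain hα hμ hlo one_pos (mem_meanZeroSpace.1 hq).1
  have hκ := kernelLow_pos d α
  have hsemi : ∀ {q : WithLp 2 (L2Cell d × Lp ℂ 2 (jumpMeasure d α))}, q ∈ meanZeroSpace μ α →
      seminormH α q.fst ≤ Real.sqrt (2 / μlo) * ‖q.snd‖ := fun {q} hq => by
    have h := sq_seminormH_le_sq_norm_snd hα hμ hlo (mem_meanZeroSpace.1 hq).1
    refine le_of_sq_le_sq ?_ (by positivity)
    rw [mul_pow, Real.sq_sqrt (by positivity)]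
    rw [div_mul_eq_mul_div, le_div_iff₀ hlo]
    linarith
  let ℓ : meanZeroSpace μ α →ₗ[ℂ] ℂ :=
    { toFun := fun y => -starRingEnd ℂ (dipole μ α e
        (y : WithLp 2 (L2Cell d × Lp ℂ 2 (jumpMeasure d α))).fst)
      map_add' := fun x y => by
        rw [Submodule.coe_add, WithLp.add_fst, dipole_add hα hμ hlo e (hV x.2) (hV y.2), map_add]
        ring
      map_smul' := fun c x => by
        rw [Submodule.coe_smul, WithLp.smul_fst, dipole_smul, map_mul, Complex.conj_conj]
        simp }
  let L : meanZeroSpace μ α →L[ℂ] ℂ := ℓ.mkContinuous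
    (dipoleConst d α μhi * ‖e‖ * Real.sqrt (2 / μlo)) fun y => by
      have h1 : ‖ℓ y‖ = ‖dipole μ α e
          (y : WithLp 2 (L2Cell d × Lp ℂ 2 (jumpMeasure d α))).fst‖ := by
        change ‖-starRingEnd ℂ _‖ = _
        rw [norm_neg, RCLike.norm_conj]
      have h2 := norm_dipole_le hα hμ hlo e (hV y.2) (mem_meanZeroSpace.1 y.2).2
      have h3 := hsemi y.2
      have h4 : ‖(y : WithLp 2 (L2Cell d × Lp ℂ 2 (jumpMeasure d α))).snd‖ ≤ ‖y‖ :=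
        WithLp.norm_snd_le _ _
      have h5 := dipoleConst_nonneg d α hhi
      rw [h1, mul_assoc]
      refine h2.trans (mul_le_mul_of_nonneg_left (h3.trans ?_) (by positivity))
      exact mul_le_mul_of_nonneg_left h4 (Real.sqrt_nonneg _)
  obtain ⟨x, hx, hxL⟩ := exists_inner_snd_eq (isClosed_meanZeroSpace μ α)
    (C := poincareConst d α ^ 2 * (2 / μlo)) (by positivity) (fun x hx => by
      have h1 := norm_le_poincareConst_mul hα (hV hx) (mem_meanZeroSpace.1 hx).2
      have h2 : ‖x.fst‖ ≤ poincareConst d α * (Real.sqrt (2 / μlo) * ‖x.snd‖) :=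
        h1.trans (mul_le_mul_of_nonneg_left (hsemi hx) (poincareConst_nonneg d α))
      have h3 := pow_le_pow_left₀ (norm_nonneg _) h2 2
      rw [mul_pow, mul_pow, Real.sq_sqrt (by positivity)] at h3
      linarith) L
  have hL : ∀ y (hy : y ∈ meanZeroSpace μ α), L ⟨y, hy⟩ = -starRingEnd ℂ (dipole μ α e y.fst) :=
    fun y hy => rfl
  refine ⟨x.fst, (isCellSolution_iff hα hμ hlo k _).2
    ⟨hV hx, (mem_meanZeroSpace.1 hx).2, fun η hη => ?_⟩⟩
  -- The equation holds for mean zero test functions; both sides vanish on constants.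
  set c : ℂ := inner ℂ (oneCell d) η with hc
  have h1V := oneCell_mem_formDomain d α
  set ζ := η + (-c) • oneCell d with hζ
  have hζV : ζ ∈ formDomain d α := Submodule.add_mem _ hη (Submodule.smul_mem _ _ h1V)
  have hζm : ∫ x in unitCell d, ζ x = 0 := by
    rw [← inner_oneCell, hζ, inner_add_right, inner_smul_right, inner_self_eq_norm_sq_to_K,
      norm_oneCell, ← hc]
    simp
  obtain ⟨q, hq, hqζ⟩ := exists_mem_energySpace hα hμ hlo 0 one_pos hζV
  have hq' : q ∈ meanZeroSpace μ α := mem_meanZeroSpace.2 ⟨hq, by rw [hqζ]; exact hζm⟩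
  have h1 := hxL q hq'
  rw [hL, inner_snd_energySpace hμ hlo one_pos (mem_meanZeroSpace.1 hx).1 hq, hqζ, map_neg,
    Complex.conj_conj, Complex.ofReal_one, inv_one, one_mul, hζ,
    form_add_right hα hμ 0 hη (Submodule.smul_mem _ _ h1V) (hV hx), form_smul_right,
    form_zero_oneCell, dipole_add hα hμ hlo e hη (Submodule.smul_mem _ _ h1V), dipole_smul,
    dipole_oneCell, mul_zero, add_zero, add_zero] at h1
  exact h1

lemma existsUnique_isCellSolution [NeZero d] (hα : α ∈ Set.Ioo (1 : ℝ) 2)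
    (hμ : IsCoefficient μlo μhi μ) (hlo : 0 < μlo) (k : Fin d) :
    ∃! v : L2Cell d, IsCellSolution μ α k v := by
  obtain ⟨v, hv⟩ := exists_isCellSolution hα hμ hlo k
  refine ⟨v, hv, fun w hw => ?_⟩
  obtain ⟨hv1, hv2, hv3⟩ := (isCellSolution_iff hα hμ hlo k v).1 hv
  obtain ⟨hw1, hw2, hw3⟩ := (isCellSolution_iff hα hμ hlo k w).1 hw
  have hz : w + (-1 : ℂ) • v ∈ formDomain d α :=
    Submodule.add_mem _ hw1 (Submodule.smul_mem _ _ hv1)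
  have h0 : w + (-1 : ℂ) • v = 0 := by
    refine eq_zero_of_form_zero_eq_zero hα hμ hlo hz ?_ ?_
    · rw [← inner_oneCell, inner_add_right, inner_smul_right, inner_oneCell, inner_oneCell, hv2,
        hw2]
      simp
    · rw [form_add_left hα hμ 0 hw1 (Submodule.smul_mem _ _ hv1) hz, form_smul_left, hw3 _ hz,
        hv3 _ hz]
      ring
  rw [neg_one_smul, ← sub_eq_add_neg, sub_eq_zero] at h0
  exact h0

end

/-! ### The averaged coefficient `μ_*` -/

section

variable {d : ℕ} {α μlo μhi : ℝ} {μ : E d → E d → ℝ}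

/-- Adding a displacement that runs through a cell `Ω + n` and reducing modulo the lattice gives the
uniform distribution on the cell, independently of the starting point. -/
lemma measurePreserving_toCell_add (n : Fin d → ℤ) :
    MeasurePreserving (fun q : E d × E d => (q.1, toCell (q.1 + q.2)))
      (((volume : Measure (E d)).restrict (unitCell d)).prod (volume.restrict (cellAt n)))
      (((volume : Measure (E d)).restrict (unitCell d)).prod
        (volume.restrict (unitCell d))) := by
  have hm : Measurable fun q : E d × E d => (q.1, toCell (q.1 + q.2)) :=
    measurable_fst.prodMk (measurable_toCell.comp (measurable_fst.add measurable_snd))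
  refine ⟨hm, ?_⟩
  refine Measure.ext_of_lintegral _ fun G hG => ?_
  have hGm : Measurable fun q : E d × E d => G (q.1, toCell (q.1 + q.2)) := hG.comp hm
  rw [lintegral_map hG hm, lintegral_prod _ hGm.aemeasurable,
    lintegral_prod _ hG.aemeasurable]
  refine lintegral_congr fun x => ?_
  have hGx : Measurable fun y => G (x, y) := hG.comp measurable_prodMk_left
  rw [← lintegral_cell_translate hGx (latticePt n + x), setLIntegral_cellAt]
  refine lintegral_congr fun z => ?_
  simp only
  congr 3
  abel

/-- Almost everywhere, the second variable of the coefficient can be reduced modulo the lattice. -/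
lemma IsCoefficient.ae_toCell (hμ : IsCoefficient μlo μhi μ) :
    ∀ᵐ p : E d × E d, μ p.1 (toCell p.2) = μ p.1 p.2 := by
  have h : ∀ᵐ p : E d × E d, ∀ n : Fin d → ℤ, μ p.1 (p.2 + latticePt n) = μ p.1 p.2 := by
    refine ae_all_iff.2 fun n => ?_
    filter_upwards [hμ.periodic 0 n] with p hp
    have h0 : (latticePt (0 : Fin d → ℤ) : E d) = 0 := by ext i; simp [latticePt]
    rwa [h0, add_zero] at hp
  filter_upwards [h] with p hp
  have h1 : toCell p.2 = p.2 + latticePt (fun i => -⌊p.2 i⌋) := by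
    ext i
    simp [latticePt, toCell, Int.fract, sub_eq_add_neg]
  rw [h1, hp]

lemma quasiMeasurePreserving_shear :
    Measure.QuasiMeasurePreserving (fun q : E d × E d => (q.1, q.1 + q.2))
      (((volume : Measure (E d)).restrict (unitCell d)).prod volume)
      (volume : Measure (E d × E d)) := by
  have h := (measurePreserving_prod_add ((volume : Measure (E d)).restrict (unitCell d))
    (volume : Measure (E d))).quasiMeasurePreserving
  exact h.mono_right (Measure.AbsolutelyContinuous.prod Measure.absolutelyContinuous_restrict
    Measure.AbsolutelyContinuous.rfl)

lemma IsCoefficient.aestronglyMeasurable_shear (hμ : IsCoefficient μlo μhi μ) :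
    AEStronglyMeasurable (fun q : E d × E d => μ q.1 (q.1 + q.2))
      (((volume : Measure (E d)).restrict (unitCell d)).prod volume) :=
  (hμ.aemeasurable.comp_quasiMeasurePreserving quasiMeasurePreserving_shear).aestronglyMeasurable

lemma IsCoefficient.ae_shear_bounds (hμ : IsCoefficient μlo μhi μ) :
    ∀ᵐ q ∂(((volume : Measure (E d)).restrict (unitCell d)).prod (volume : Measure (E d))),
      μlo ≤ μ q.1 (q.1 + q.2) ∧ μ q.1 (q.1 + q.2) ≤ μhi :=
  quasiMeasurePreserving_shear.ae hμ.bounds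

/-- The average `∫_Ω μ(x, x + z) dx`. -/
noncomputable def shiftMean (μ : E d → E d → ℝ) (z : E d) : ℝ := ∫ x in unitCell d, μ x (x + z)

lemma muStar_eq (μ : E d → E d → ℝ) (z : E d) : muStar μ z = shiftMean μ z - muZero μ := by
  simp only [muStar, shiftMean, add_comm z]

lemma aestronglyMeasurable_shiftMean (hμ : IsCoefficient μlo μhi μ) :
    AEStronglyMeasurable (shiftMean μ) (volume : Measure (E d)) :=
  hμ.aestronglyMeasurable_shear.prod_swap.integral_prod_right'

lemma shiftMean_bounds (hμ : IsCoefficient μlo μhi μ) :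
    ∀ᵐ z : E d, μlo ≤ shiftMean μ z ∧ shiftMean μ z ≤ μhi := by
  have h1 := Measure.ae_ae_of_ae_prod (Measure.measurePreserving_swap.quasiMeasurePreserving.ae
    hμ.ae_shear_bounds)
  have h2 := hμ.aestronglyMeasurable_shear.prod_swap.prodMk_left
  filter_upwards [h1, h2] with z hz hm
  have hi : Integrable (fun x => μ x (x + z)) ((volume : Measure (E d)).restrict (unitCell d)) := by
    refine Integrable.of_bound hm (max |μlo| |μhi|) ?_
    filter_upwards [hz] with x hx
    exact abs_le_max_abs_abs hx.1 hx.2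
  have hc : ∀ c : ℝ, ∫ _x in unitCell d, c = c := fun c => by simp
  constructor
  · rw [← hc μlo]
    refine integral_mono_ae (integrable_const _) hi ?_
    filter_upwards [hz] with x hx using hx.1
  · rw [← hc μhi]
    refine integral_mono_ae hi (integrable_const _) ?_
    filter_upwards [hz] with x hx using hx.2

lemma muZero_bounds (hμ : IsCoefficient μlo μhi μ) : μlo ≤ muZero μ ∧ muZero μ ≤ μhi := by
  have hac : ((volume : Measure (E d)).restrict (unitCell d)).prod
      ((volume : Measure (E d)).restrict (unitCell d)) ≪ (volume : Measure (E d × E d)) :=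
    Measure.AbsolutelyContinuous.prod Measure.absolutelyContinuous_restrict
      Measure.absolutelyContinuous_restrict
  have hb := hac.ae_le hμ.bounds
  have hi : Integrable (fun p : E d × E d => μ p.1 p.2)
      (((volume : Measure (E d)).restrict (unitCell d)).prod
      ((volume : Measure (E d)).restrict (unitCell d))) := by
    refine Integrable.of_bound (hμ.aemeasurable.mono_ac hac).aestronglyMeasurable
      (max |μlo| |μhi|) ?_
    filter_upwards [hb] with x hx
    exact abs_le_max_abs_abs hx.1 hx.2
  have hc : ∀ c : ℝ, ∫ _x, c ∂(((volume : Measure (E d)).restrict (unitCell d)).prod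
      ((volume : Measure (E d)).restrict (unitCell d))) = c := fun c => by simp
  constructor
  · rw [← hc μlo]
    refine integral_mono_ae (integrable_const _) hi ?_
    filter_upwards [hb] with x hx using hx.1
  · rw [← hc μhi]
    refine integral_mono_ae hi (integrable_const _) ?_
    filter_upwards [hb] with x hx using hx.2

lemma aestronglyMeasurable_muStar (hμ : IsCoefficient μlo μhi μ) :
    AEStronglyMeasurable (muStar μ) (volume : Measure (E d)) := by
  simp_rw [funext (muStar_eq μ)]
  exact (aestronglyMeasurable_shiftMean hμ).sub aestronglyMeasurable_const

lemma abs_muStar_le (hμ : IsCoefficient μlo μhi μ) (hlo : 0 < μlo) :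
    ∀ᵐ z : E d, |muStar μ z| ≤ μhi := by
  filter_upwards [shiftMean_bounds hμ] with z hz
  have := muZero_bounds hμ
  rw [muStar_eq, abs_le]
  constructor <;> linarith [hz.1, hz.2]

lemma volume_cellAt (n : Fin d → ℤ) : (volume : Measure (E d)) (cellAt n) = 1 := by
  have h := setLIntegral_cellAt (fun _ => 1) n
  simpa using h

instance isProbabilityMeasure_cellAt (n : Fin d → ℤ) :
    IsProbabilityMeasure ((volume : Measure (E d)).restrict (cellAt n)) :=
  ⟨by rw [Measure.restrict_apply_univ, volume_cellAt]⟩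

/-- The function `μ_*` has mean zero over each cell of the lattice. -/
lemma integral_muStar_cellAt (hμ : IsCoefficient μlo μhi μ) (n : Fin d → ℤ) :
    ∫ z in cellAt n, muStar μ z = 0 := by
  set σ := (volume : Measure (E d)).restrict (unitCell d) with hσ
  set ν := (volume : Measure (E d)).restrict (cellAt n) with hν
  have hac : σ.prod ν ≪ σ.prod (volume : Measure (E d)) :=
    Measure.AbsolutelyContinuous.rfl.prod Measure.absolutelyContinuous_restrict
  have hac2 : σ.prod σ ≪ (volume : Measure (E d × E d)) :=
    Measure.AbsolutelyContinuous.prod Measure.absolutelyContinuous_restrict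
      Measure.absolutelyContinuous_restrict
  have hint : Integrable (fun q : E d × E d => μ q.1 (q.1 + q.2)) (σ.prod ν) := by
    refine Integrable.of_bound (hμ.aestronglyMeasurable_shear.mono_ac hac) (max |μlo| |μhi|) ?_
    filter_upwards [hac.ae_le hμ.ae_shear_bounds] with x hx
    exact abs_le_max_abs_abs hx.1 hx.2
  have h1 : ∫ z in cellAt n, shiftMean μ z = muZero μ := by
    have e1 : ∫ z in cellAt n, shiftMean μ z = ∫ q, μ q.1 (q.1 + q.2) ∂(σ.prod ν) :=
      (integral_prod_symm _ hint).symm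
    have hmp := measurePreserving_toCell_add (d := d) n
    have e2 : ∫ q, μ q.1 (q.1 + q.2) ∂(σ.prod ν) =
        ∫ q, μ q.1 (toCell (q.1 + q.2)) ∂(σ.prod ν) := by
      refine integral_congr_ae ?_
      filter_upwards [hac.ae_le (quasiMeasurePreserving_shear.ae hμ.ae_toCell)] with q hq
      exact hq.symm
    have e3 : ∫ q, μ q.1 (toCell (q.1 + q.2)) ∂(σ.prod ν) = muZero μ := by
      have hsm : AEStronglyMeasurable (fun p : E d × E d => μ p.1 p.2) (Measure.map
          (fun q : E d × E d => (q.1, toCell (q.1 + q.2))) (σ.prod ν)) := by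
        rw [hmp.map_eq]
        exact (hμ.aemeasurable.mono_ac hac2).aestronglyMeasurable
      have := integral_map hmp.measurable.aemeasurable hsm
      rw [hmp.map_eq] at this
      exact this.symm
    rw [e1, e2, e3]
  have hsi : Integrable (shiftMean μ) ν := hint.integral_prod_right
  simp_rw [muStar_eq]
  rw [integral_sub hsi (integrable_const _), h1]
  simp

end

/-! ### Cellwise sums against `μ_*` -/

section

variable {d : ℕ} {α μlo μhi : ℝ} {μ : E d → E d → ℝ}

/-- Since `μ_*` has mean zero on the cells, only the oscillation of `F` on each cell contributes to
the cellwise integrals of `μ_* F`. -/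
lemma summable_integral_muStar_mul (hμ : IsCoefficient μlo μhi μ) (hlo : 0 < μlo)
    {F W : E d → ℝ} (hF : Measurable F) (hW : Integrable W)
    (hosc : ∀ n : Fin d → ℤ, ∃ c : ℝ, ∀ z ∈ cellAt n, |F z - c| ≤ W z) :
    (∀ n : Fin d → ℤ, IntegrableOn (fun z => muStar μ z * F z) (cellAt n)) ∧
    Summable (fun n : Fin d → ℤ => ∫ z in cellAt n, muStar μ z * F z) ∧
    |∑' n : Fin d → ℤ, ∫ z in cellAt n, muStar μ z * F z| ≤ μhi * ∫ z, W z := by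
  have hhi : 0 ≤ μhi := hlo.le.trans hμ.lo_le_hi
  have hms := aestronglyMeasurable_muStar hμ
  have hb : ∀ᵐ z : E d, ‖muStar μ z‖ ≤ μhi := abs_muStar_le hμ hlo
  have key : ∀ n : Fin d → ℤ, IntegrableOn (fun z => muStar μ z * F z) (cellAt n) ∧
      ‖∫ z in cellAt n, muStar μ z * F z‖ ≤ ∫ z in cellAt n, μhi * W z := by
    intro n
    obtain ⟨c, hc⟩ := hosc n
    have hcell : ∀ᵐ z ∂((volume : Measure (E d)).restrict (cellAt n)), z ∈ cellAt n :=
      ae_restrict_mem (measurableSet_cellAt n)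
    have i1 : IntegrableOn (fun z => F z - c) (cellAt n) := by
      refine hW.integrableOn.mono' (hF.sub_const c).aestronglyMeasurable ?_
      filter_upwards [hcell] with z hz using hc z hz
    have i2 : IntegrableOn (fun z => muStar μ z * (F z - c)) (cellAt n) :=
      Integrable.bdd_mul i1 hms.restrict (ae_restrict_of_ae hb)
    have i0 : IntegrableOn (muStar μ) (cellAt n) :=
      Integrable.of_bound hms.restrict μhi (ae_restrict_of_ae hb)
    have i3 : IntegrableOn (fun z => muStar μ z * c) (cellAt n) := i0.mul_const c
    have e1 : (fun z => muStar μ z * F z) = fun z => muStar μ z * (F z - c) + muStar μ z * c := by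
      funext z; ring
    refine ⟨by rw [e1]; exact i2.add i3, ?_⟩
    rw [e1, integral_add i2 i3, integral_mul_const, integral_muStar_cellAt hμ n, zero_mul,
      add_zero]
    refine norm_integral_le_of_norm_le (hW.integrableOn.const_mul μhi) ?_
    filter_upwards [hcell, ae_restrict_of_ae hb] with z hz hz2
    rw [norm_mul]
    exact mul_le_mul hz2 (hc z hz) (norm_nonneg _) hhi
  have hsum : HasSum (fun n : Fin d → ℤ => ∫ z in cellAt n, μhi * W z) (μhi * ∫ z, W z) := by
    have h := hasSum_integral_iUnion (μ := (volume : Measure (E d))) (f := fun z => μhi * W z)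
      measurableSet_cellAt pairwise_disjoint_cellAt (hW.const_mul μhi).integrableOn
    rwa [iUnion_cellAt, Measure.restrict_univ, integral_const_mul] at h
  exact ⟨fun n => (key n).1, Summable.of_norm_bounded hsum.summable fun n => (key n).2,
    tsum_of_norm_bounded hsum fun n => (key n).2⟩

lemma norm_sub_latticePt_le {n : Fin d → ℤ} {z : E d} (hz : z ∈ cellAt n) :
    ‖z - latticePt n‖ ≤ Real.sqrt d := by
  have h0 : (0 : E d) ∈ unitCell d := fun i => by simp
  have := norm_sub_le_of_mem_unitCell (x := z - latticePt n) hz h0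
  simpa using this

lemma one_le_sqrt_dim (d : ℕ) [NeZero d] : 1 ≤ Real.sqrt d := by
  rw [Real.one_le_sqrt]; exact_mod_cast Nat.one_le_iff_ne_zero.2 (NeZero.ne d)

/-- A cell is either close to the origin, or comparable in size with its corner. -/
lemma near_or_far [NeZero d] (n : Fin d → ℤ) :
    (∀ z ∈ cellAt n, ‖z‖ ≤ 3 * Real.sqrt d) ∨
    (∀ z ∈ cellAt n, 1 ≤ ‖z‖ ∧ ‖z‖ / 2 ≤ ‖(latticePt n : E d)‖ ∧
      ‖(latticePt n : E d)‖ ≤ 2 * ‖z‖) := by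
  have hd := one_le_sqrt_dim d
  rcases le_total ‖(latticePt n : E d)‖ (2 * Real.sqrt d) with h | h
  · left
    intro z hz
    have h1 := norm_sub_latticePt_le hz
    have h2 := norm_sub_norm_le z (latticePt n)
    linarith
  · right
    intro z hz
    have h1 := norm_sub_latticePt_le hz
    have h2 := norm_sub_norm_le z (latticePt n)
    have h3 := norm_sub_norm_le (latticePt n) z
    rw [norm_sub_rev] at h3
    refine ⟨?_, ?_, ?_⟩ <;> linarith

lemma abs_rpow_neg_sub_le {s ρ a b : ℝ} (hs : 0 < s) (hρ : 0 < ρ) (ha : ρ ≤ a) (hb : ρ ≤ b) :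
    |a ^ (-s) - b ^ (-s)| ≤ s * ρ ^ (-s - 1) * |a - b| := by
  have h := (convex_Ici ρ).norm_image_sub_le_of_norm_hasDerivWithin_le (𝕜 := ℝ)
    (f := fun x : ℝ => x ^ (-s)) (f' := fun x : ℝ => -s * x ^ (-s - 1))
    (C := s * ρ ^ (-s - 1)) (fun x hx => by
      have hx' : ρ ≤ x := hx
      exact (Real.hasDerivAt_rpow_const (Or.inl (hρ.trans_le hx').ne')).hasDerivWithinAt)
    (fun x hx => by
      have hx' : ρ ≤ x := hx
      have hx0 := hρ.trans_le hx'
      rw [norm_mul, norm_neg, Real.norm_of_nonneg hs.le,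
        Real.norm_of_nonneg (Real.rpow_nonneg hx0.le _)]
      exact mul_le_mul_of_nonneg_left
        (Real.rpow_le_rpow_of_nonpos hρ hx' (by linarith)) hs.le) hb ha
  simpa [Real.norm_eq_abs] using h

/-- The constant in the oscillation bound of `|z|^{-(d+α)}` over a far cell. -/
noncomputable def oscConst (d : ℕ) (α : ℝ) : ℝ :=
  ((d : ℝ) + α) * 2 ^ ((d : ℝ) + α + 1) * Real.sqrt d

lemma oscConst_nonneg (d : ℕ) {α : ℝ} (hα : 0 < α) : 0 ≤ oscConst d α := by
  unfold oscConst; positivity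

/-- Oscillation of `Q(z) |z|^{-(d+α)}` over a far cell, from the oscillation and the size of `Q`. -/
lemma osc_far [NeZero d] (hα : 0 < α) {n : Fin d → ℤ} {z : E d} (hz : z ∈ cellAt n)
    (h1 : 1 ≤ ‖z‖) (h2 : ‖z‖ / 2 ≤ ‖(latticePt n : E d)‖) {a b A B : ℝ}
    (hA : |a - b| ≤ A) (hB : |b| ≤ B * ‖z‖) :
    |a * ‖z‖ ^ (-((d : ℝ) + α)) - b * ‖(latticePt n : E d)‖ ^ (-((d : ℝ) + α))| ≤
      (A + oscConst d α * B) * ‖z‖ ^ (-((d : ℝ) + α)) := by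
  set s := (d : ℝ) + α with hs
  have hs0 : 0 < s := by positivity
  have hz0 : 0 < ‖z‖ := by linarith
  have h3 := abs_rpow_neg_sub_le (a := ‖z‖) (b := ‖(latticePt n : E d)‖) hs0
    (half_pos hz0) (by linarith) h2
  have h4 : |‖z‖ - ‖(latticePt n : E d)‖| ≤ Real.sqrt d :=
    (abs_norm_sub_norm_le _ _).trans (norm_sub_latticePt_le hz)
  have h5 : (‖z‖ / 2) ^ (-s - 1) * ‖z‖ = 2 ^ (s + 1) * ‖z‖ ^ (-s) := by
    rw [Real.div_rpow hz0.le (by norm_num), div_eq_mul_inv, ← Real.rpow_neg (by norm_num)]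
    have : ‖z‖ ^ (-s) = ‖z‖ ^ (-s - 1) * ‖z‖ := by
      rw [← Real.rpow_add_one hz0.ne']; ring_nf
    rw [this]
    ring_nf
  have hw : 0 ≤ ‖z‖ ^ (-s) := Real.rpow_nonneg hz0.le _
  have hB0 : 0 ≤ B := by
    by_contra hneg
    push Not at hneg
    have := abs_nonneg b
    nlinarith
  have hid : a * ‖z‖ ^ (-s) - b * ‖(latticePt n : E d)‖ ^ (-s) =
      (a - b) * ‖z‖ ^ (-s) + b * (‖z‖ ^ (-s) - ‖(latticePt n : E d)‖ ^ (-s)) := by ring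
  rw [hid]
  refine (abs_add_le _ _).trans ?_
  rw [abs_mul, abs_mul, abs_of_nonneg hw, add_mul]
  refine add_le_add (mul_le_mul_of_nonneg_right hA hw) ?_
  calc |b| * |‖z‖ ^ (-s) - ‖(latticePt n : E d)‖ ^ (-s)|
      ≤ (B * ‖z‖) * (s * (‖z‖ / 2) ^ (-s - 1) * Real.sqrt d) := by
        refine mul_le_mul hB (h3.trans ?_) (abs_nonneg _) (by positivity)
        exact mul_le_mul_of_nonneg_left h4 (by positivity)
    _ = B * s * Real.sqrt d * ((‖z‖ / 2) ^ (-s - 1) * ‖z‖) := by ring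
    _ = _ := by rw [h5, oscConst, ← hs]; ring

lemma taylorWeight_mul_le {t : ℝ} (ht : 0 ≤ t) {r : ℝ} (hr : t ≤ r) (h1 : 1 ≤ r) :
    t ^ 2 ≤ r * taylorWeight t := by
  rcases le_total t 1 with h | h
  · rw [taylorWeight, min_eq_right (by nlinarith)]
    nlinarith [sq_nonneg t]
  · rw [taylorWeight, min_eq_left (by nlinarith)]
    nlinarith

/-- Scaled version of the integrability of `min(|z|, |z|²)` against the Lévy measure. -/
lemma integrable_taylorWeight_mul [NeZero d] (hα : α ∈ Set.Ioo (1 : ℝ) 2) {t : ℝ} (ht : 0 ≤ t) :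
    Integrable (fun z : E d => taylorWeight (t * ‖z‖) * ‖z‖ ^ (-((d : ℝ) + α))) ∧
    ∫ z : E d, taylorWeight (t * ‖z‖) * ‖z‖ ^ (-((d : ℝ) + α)) = t ^ α * weightInt d α := by
  have hm := measurable_taylorWeight_smul_norm (d := d) t
  have h := lintegral_taylorWeight (d := d) hα ht
  have hK : 0 ≤ t ^ α * weightInt d α := mul_nonneg (Real.rpow_nonneg ht _) (weightInt_nonneg d α)
  have hpt : ∀ z : E d, 0 ≤ taylorWeight (t * ‖z‖) * ‖z‖ ^ (-((d : ℝ) + α)) := fun z =>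
    mul_nonneg (taylorWeight_nonneg (by positivity)) (Real.rpow_nonneg (norm_nonneg z) _)
  rw [lintegral_levy hm] at h
  have hpt' : ∀ z : E d, ENNReal.ofReal (taylorWeight (t * ‖z‖)) *
      ENNReal.ofReal (‖z‖ ^ (-((d : ℝ) + α))) =
      ENNReal.ofReal (taylorWeight (t * ‖z‖) * ‖z‖ ^ (-((d : ℝ) + α))) := fun z =>
    (ENNReal.ofReal_mul (taylorWeight_nonneg (by positivity))).symm
  simp_rw [hpt'] at h
  have hmm : Measurable fun z : E d => taylorWeight (t * ‖z‖) * ‖z‖ ^ (-((d : ℝ) + α)) :=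
    (measurable_taylorWeight.comp (by fun_prop)).mul (by fun_prop)
  have hint : Integrable (fun z : E d => taylorWeight (t * ‖z‖) * ‖z‖ ^ (-((d : ℝ) + α))) := by
    refine ⟨hmm.aestronglyMeasurable, ?_⟩
    rw [hasFiniteIntegral_iff_ofReal (Filter.Eventually.of_forall hpt), h]
    exact ENNReal.ofReal_lt_top
  refine ⟨hint, ?_⟩
  rw [← ofReal_integral_eq_lintegral_ofReal hint (Filter.Eventually.of_forall hpt)] at h
  exact (ENNReal.ofReal_eq_ofReal_iff (integral_nonneg hpt) hK).1 h

/-- The constant in the bound for the cellwise sums that define the second part of `g⁰`. -/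
noncomputable def quadConst (d : ℕ) (α : ℝ) : ℝ := 3 * Real.sqrt d + 4 * oscConst d α

/-- The cellwise sums in the definition of `g⁰` converge, and are bounded uniformly in the
coefficient. -/
lemma summable_muStar_quadratic [NeZero d] (hα : α ∈ Set.Ioo (1 : ℝ) 2)
    (hμ : IsCoefficient μlo μhi μ) (hlo : 0 < μlo) (j k : Fin d) :
    (∀ n : Fin d → ℤ, IntegrableOn
      (fun z : E d => muStar μ z * (z j * z k * ‖z‖ ^ (-((d : ℝ) + α)))) (cellAt n)) ∧
    Summable (fun n : Fin d → ℤ =>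
      ∫ z in cellAt n, muStar μ z * (z j * z k * ‖z‖ ^ (-((d : ℝ) + α)))) ∧
    |∑' n : Fin d → ℤ, ∫ z in cellAt n, muStar μ z * (z j * z k * ‖z‖ ^ (-((d : ℝ) + α)))| ≤
      μhi * (quadConst d α * weightInt d α) := by
  have h0 : 0 < α := by linarith [hα.1]
  have hd := one_le_sqrt_dim d
  have hO := oscConst_nonneg d h0
  have hW := integrable_taylorWeight hα (d := d)
  have h := summable_integral_muStar_mul hμ hlo (d := d)
    (F := fun z : E d => z j * z k * ‖z‖ ^ (-((d : ℝ) + α)))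
    (W := fun z : E d => quadConst d α * (taylorWeight ‖z‖ * ‖z‖ ^ (-((d : ℝ) + α))))
    (by fun_prop) (hW.const_mul _) (fun n => ?_)
  · rwa [integral_const_mul] at h
  rcases near_or_far n with hn | hn
  · refine ⟨0, fun z hz => ?_⟩
    have hw : 0 ≤ ‖z‖ ^ (-((d : ℝ) + α)) := Real.rpow_nonneg (norm_nonneg z) _
    have hH := taylorWeight_nonneg (norm_nonneg z)
    rw [sub_zero, abs_mul, abs_mul, abs_of_nonneg hw, ← mul_assoc]
    refine mul_le_mul_of_nonneg_right ?_ hw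
    have h1 : |z j| ≤ ‖z‖ := PiLp.norm_apply_le z j
    have h2 : |z k| ≤ ‖z‖ := PiLp.norm_apply_le z k
    have h3 := mul_le_mul h1 h2 (abs_nonneg _) (norm_nonneg _)
    have h4 := taylorWeight_mul_le (norm_nonneg z) (hn z hz) (by linarith)
    rw [quadConst]
    nlinarith [mul_nonneg hO hH]
  · refine ⟨latticePt n j * latticePt n k * ‖(latticePt n : E d)‖ ^ (-((d : ℝ) + α)),
      fun z hz => ?_⟩
    obtain ⟨g1, g2, g3⟩ := hn z hz
    have hH : taylorWeight ‖z‖ = ‖z‖ := min_eq_left (by nlinarith)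
    have hj : |z j| ≤ ‖z‖ := PiLp.norm_apply_le z j
    have hk : |z k| ≤ ‖z‖ := PiLp.norm_apply_le z k
    have nj : |latticePt n j| ≤ ‖(latticePt n : E d)‖ := PiLp.norm_apply_le (latticePt n) j
    have nk : |latticePt n k| ≤ ‖(latticePt n : E d)‖ := PiLp.norm_apply_le (latticePt n) k
    have dj : |z j - latticePt n j| ≤ Real.sqrt d :=
      (PiLp.norm_apply_le (z - latticePt n) j).trans (norm_sub_latticePt_le hz)
    have dk : |z k - latticePt n k| ≤ Real.sqrt d :=
      (PiLp.norm_apply_le (z - latticePt n) k).trans (norm_sub_latticePt_le hz)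
    have hz0 := norm_nonneg z
    have hA : |z j * z k - latticePt n j * latticePt n k| ≤ 3 * Real.sqrt d * ‖z‖ := by
      have hid : z j * z k - latticePt n j * latticePt n k =
          (z j - latticePt n j) * z k + latticePt n j * (z k - latticePt n k) := by ring
      rw [hid]
      refine (abs_add_le _ _).trans ?_
      rw [abs_mul, abs_mul]
      have e1 := mul_le_mul dj hk (abs_nonneg _) (by linarith)
      have e2 := mul_le_mul (nj.trans g3) dk (abs_nonneg _) (by linarith)
      linarith
    have hB : |latticePt n j * latticePt n k| ≤ (4 * ‖z‖) * ‖z‖ := by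
      rw [abs_mul]
      have e2 := mul_le_mul (nj.trans g3) (nk.trans g3) (abs_nonneg _) (by linarith)
      linarith
    refine (osc_far h0 hz g1 g2 hA hB).trans (le_of_eq ?_)
    rw [hH, quadConst]
    ring

/-- The remainder `1 - cos t - t²/2` of the cosine. -/
noncomputable def cosRem (t : ℝ) : ℝ := 1 - Real.cos t - t ^ 2 / 2

lemma abs_sin_sub_self_le (t : ℝ) : |Real.sin t - t| ≤ 2 * taylorWeight |t| := by
  have h := norm_exp_I_mul_sub_one_sub_le t
  refine le_trans ?_ h
  have e : (Complex.exp (Complex.I * t) - 1 - Complex.I * t).im = Real.sin t - t := by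
    rw [mul_comm Complex.I, Complex.sub_im, Complex.sub_im, Complex.exp_ofReal_mul_I_im]
    simp
  rw [← e]
  exact Complex.abs_im_le_norm _

lemma abs_cosRem_sub_le {a b r : ℝ} (ha : |a| ≤ r) (hb : |b| ≤ r) :
    |cosRem a - cosRem b| ≤ 2 * taylorWeight r * |a - b| := by
  have hderiv : ∀ x, HasDerivAt cosRem (Real.sin x - x) x := by
    intro x
    have h1 := ((Real.hasDerivAt_cos x).const_sub 1).sub (((hasDerivAt_id x).pow 2).div_const 2)
    refine h1.congr_deriv ?_
    simp
  have h := (convex_Icc (-r) r).norm_image_sub_le_of_norm_hasDerivWithin_le (𝕜 := ℝ)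
    (f := cosRem) (C := 2 * taylorWeight r) (fun x _ => (hderiv x).hasDerivWithinAt)
    (fun x hx => (abs_sin_sub_self_le x).trans (mul_le_mul_of_nonneg_left
      (taylorWeight_mono (abs_nonneg x) (abs_le.2 hx)) (by norm_num)))
    (abs_le.1 hb) (abs_le.1 ha)
  simpa [Real.norm_eq_abs] using h

lemma abs_cosRem_le {a r : ℝ} (ha : |a| ≤ r) : |cosRem a| ≤ 2 * taylorWeight r * r := by
  have h0 : 0 ≤ r := (abs_nonneg a).trans ha
  have h := abs_cosRem_sub_le ha (b := 0) (by simpa using h0)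
  have h1 : cosRem 0 = 0 := by simp [cosRem]
  rw [h1, sub_zero, sub_zero] at h
  exact h.trans (mul_le_mul_of_nonneg_left ha (by linarith [taylorWeight_nonneg h0]))

/-- The constant in the bound for the cellwise sums of the cosine remainder. -/
noncomputable def cosConst (d : ℕ) (α : ℝ) : ℝ := 6 * Real.sqrt d + 4 * oscConst d α

/-- Replacing `1 - cos⟨ξ,z⟩` by its quadratic part in the integral against `μ_*` costs only
`O(|ξ|^{1+α})`, because of the cancellation on the cells. -/
lemma summable_muStar_cosRem [NeZero d] (hα : α ∈ Set.Ioo (1 : ℝ) 2)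
    (hμ : IsCoefficient μlo μhi μ) (hlo : 0 < μlo) (ξ : E d) :
    (∀ n : Fin d → ℤ, IntegrableOn
      (fun z : E d => muStar μ z * (cosRem (inner ℝ ξ z) * ‖z‖ ^ (-((d : ℝ) + α))))
        (cellAt n)) ∧
    Summable (fun n : Fin d → ℤ =>
      ∫ z in cellAt n, muStar μ z * (cosRem (inner ℝ ξ z) * ‖z‖ ^ (-((d : ℝ) + α)))) ∧
    |∑' n : Fin d → ℤ, ∫ z in cellAt n,
        muStar μ z * (cosRem (inner ℝ ξ z) * ‖z‖ ^ (-((d : ℝ) + α)))| ≤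
      μhi * (cosConst d α * ‖ξ‖ * ((2 * ‖ξ‖) ^ α * weightInt d α)) := by
  have h0 : 0 < α := by linarith [hα.1]
  have hd := one_le_sqrt_dim d
  have hO := oscConst_nonneg d h0
  have hξ := norm_nonneg ξ
  have hW := integrable_taylorWeight_mul hα (d := d) (t := 2 * ‖ξ‖) (by positivity)
  have hcm : Measurable cosRem := by unfold cosRem; fun_prop
  have h := summable_integral_muStar_mul hμ hlo (d := d)
    (F := fun z : E d => cosRem (inner ℝ ξ z) * ‖z‖ ^ (-((d : ℝ) + α)))
    (W := fun z : E d => cosConst d α * ‖ξ‖ *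
      (taylorWeight (2 * ‖ξ‖ * ‖z‖) * ‖z‖ ^ (-((d : ℝ) + α))))
    ((hcm.comp (by fun_prop)).mul (by fun_prop)) (hW.1.const_mul _) (fun n => ?_)
  · rwa [integral_const_mul, hW.2] at h
  rcases near_or_far n with hn | hn
  · refine ⟨0, fun z hz => ?_⟩
    have hz0 := norm_nonneg z
    have hw : 0 ≤ ‖z‖ ^ (-((d : ℝ) + α)) := Real.rpow_nonneg hz0 _
    have hH := taylorWeight_nonneg (t := 2 * ‖ξ‖ * ‖z‖) (by positivity)
    rw [sub_zero, abs_mul, abs_of_nonneg hw, ← mul_assoc]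
    refine mul_le_mul_of_nonneg_right ?_ hw
    have h1 : |inner ℝ ξ z| ≤ ‖ξ‖ * ‖z‖ := abs_real_inner_le_norm ξ z
    have h2 := abs_cosRem_le h1
    have h3 : taylorWeight (‖ξ‖ * ‖z‖) ≤ taylorWeight (2 * ‖ξ‖ * ‖z‖) :=
      taylorWeight_mono (by positivity) (by nlinarith [mul_nonneg hξ hz0])
    have h4 : ‖ξ‖ * ‖z‖ ≤ ‖ξ‖ * (3 * Real.sqrt d) := mul_le_mul_of_nonneg_left (hn z hz) hξ
    calc |cosRem (inner ℝ ξ z)| ≤ 2 * taylorWeight (‖ξ‖ * ‖z‖) * (‖ξ‖ * ‖z‖) := h2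
      _ ≤ 2 * taylorWeight (2 * ‖ξ‖ * ‖z‖) * (‖ξ‖ * (3 * Real.sqrt d)) := by gcongr
      _ = 6 * Real.sqrt d * (‖ξ‖ * taylorWeight (2 * ‖ξ‖ * ‖z‖)) := by ring
      _ ≤ cosConst d α * (‖ξ‖ * taylorWeight (2 * ‖ξ‖ * ‖z‖)) := by
        refine mul_le_mul_of_nonneg_right ?_ (by positivity)
        rw [cosConst]; linarith
      _ = _ := by ring
  · refine ⟨cosRem (inner ℝ ξ (latticePt n)) * ‖(latticePt n : E d)‖ ^ (-((d : ℝ) + α)),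
      fun z hz => ?_⟩
    obtain ⟨g1, g2, g3⟩ := hn z hz
    have hz0 := norm_nonneg z
    have hH := taylorWeight_nonneg (t := 2 * ‖ξ‖ * ‖z‖) (by positivity)
    have ha : |inner ℝ ξ z| ≤ 2 * ‖ξ‖ * ‖z‖ :=
      (abs_real_inner_le_norm ξ z).trans (by nlinarith [mul_nonneg hξ hz0])
    have hb : |inner ℝ ξ (latticePt n)| ≤ 2 * ‖ξ‖ * ‖z‖ :=
      (abs_real_inner_le_norm ξ _).trans (by nlinarith [mul_le_mul_of_nonneg_left g3 hξ])
    have hab : |inner ℝ ξ z - inner ℝ ξ (latticePt n)| ≤ ‖ξ‖ * Real.sqrt d := by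
      rw [← inner_sub_right]
      exact (abs_real_inner_le_norm ξ _).trans
        (mul_le_mul_of_nonneg_left (norm_sub_latticePt_le hz) hξ)
    have hA : |cosRem (inner ℝ ξ z) - cosRem (inner ℝ ξ (latticePt n))| ≤
        2 * taylorWeight (2 * ‖ξ‖ * ‖z‖) * (‖ξ‖ * Real.sqrt d) :=
      (abs_cosRem_sub_le ha hb).trans (mul_le_mul_of_nonneg_left hab (by positivity))
    have hB : |cosRem (inner ℝ ξ (latticePt n))| ≤
        (4 * ‖ξ‖ * taylorWeight (2 * ‖ξ‖ * ‖z‖)) * ‖z‖ :=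
      (abs_cosRem_le hb).trans (le_of_eq (by ring))
    refine (osc_far h0 hz g1 g2 hA hB).trans ?_
    have e : cosConst d α * ‖ξ‖ *
        (taylorWeight (2 * ‖ξ‖ * ‖z‖) * ‖z‖ ^ (-((d : ℝ) + α))) =
        (cosConst d α * (‖ξ‖ * taylorWeight (2 * ‖ξ‖ * ‖z‖))) *
          ‖z‖ ^ (-((d : ℝ) + α)) := by ring
    rw [e]
    refine mul_le_mul_of_nonneg_right ?_ (Real.rpow_nonneg hz0 _)
    have : 0 ≤ Real.sqrt d * (‖ξ‖ * taylorWeight (2 * ‖ξ‖ * ‖z‖)) := by positivity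
    rw [cosConst]
    nlinarith

end

/-! ### The symbol `c₀|ξ|^α` and the expansion of `a(ξ)[𝟏,𝟏]` -/

section

variable {d : ℕ} {α μlo μhi : ℝ} {μ : E d → E d → ℝ}

lemma one_sub_cos_le_taylorWeight {t r : ℝ} (h : |t| ≤ r) :
    1 - Real.cos t ≤ 2 * taylorWeight r := by
  refine le_trans ?_ (mul_le_mul_of_nonneg_left (taylorWeight_mono (abs_nonneg t) h) zero_le_two)
  have h1 := Real.one_sub_sq_div_two_le_cos (x := t)
  have h2 := Real.neg_one_le_cos t
  have h3 := sq_abs t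
  have h4 := abs_nonneg t
  rw [taylorWeight]
  rcases le_total |t| 1 with h | h
  · rw [min_eq_right (by nlinarith)]; nlinarith
  · rw [min_eq_left (by nlinarith)]; nlinarith

lemma integrable_one_sub_cos [NeZero d] (hα : α ∈ Set.Ioo (1 : ℝ) 2) (ξ : E d) :
    Integrable (fun z : E d => (1 - Real.cos (inner ℝ ξ z)) * ‖z‖ ^ (-((d : ℝ) + α))) := by
  refine ((integrable_taylorWeight_mul hα (norm_nonneg ξ)).1.const_mul 2).mono'
    (by fun_prop) (Filter.Eventually.of_forall fun z => ?_)
  have hw : 0 ≤ ‖z‖ ^ (-((d : ℝ) + α)) := Real.rpow_nonneg (norm_nonneg z) _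
  have h1 := Real.cos_le_one (inner ℝ ξ z)
  rw [norm_mul, Real.norm_of_nonneg hw, Real.norm_of_nonneg (by linarith), ← mul_assoc]
  exact mul_le_mul_of_nonneg_right (one_sub_cos_le_taylorWeight (abs_real_inner_le_norm ξ z)) hw

lemma c0_eq (d : ℕ) [NeZero d] (α : ℝ) :
    c0 d α = ∫ z : E d, (1 - Real.cos (inner ℝ (EuclideanSpace.single (0 : Fin d) (1 : ℝ)) z)) *
      ‖z‖ ^ (-((d : ℝ) + α)) := by
  unfold c0
  refine integral_congr_ae (Filter.Eventually.of_forall fun z => ?_)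
  simp only [EuclideanSpace.inner_single_left, map_one, one_mul]
  rw [Real.rpow_neg (norm_nonneg z), div_eq_mul_inv]

lemma c0_pos [NeZero d] (hα : α ∈ Set.Ioo (1 : ℝ) 2) : 0 < c0 d α := by
  rw [c0_eq]
  set e : E d := EuclideanSpace.single (0 : Fin d) (1 : ℝ) with he
  have hpt : ∀ z : E d, 0 ≤ (1 - Real.cos (inner ℝ e z)) * ‖z‖ ^ (-((d : ℝ) + α)) := fun z =>
    mul_nonneg (by linarith [Real.cos_le_one (inner ℝ e z)]) (Real.rpow_nonneg (norm_nonneg z) _)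
  rw [integral_pos_iff_support_of_nonneg hpt (integrable_one_sub_cos hα e)]
  have hc : Continuous fun z : E d => inner ℝ e z := continuous_const.inner continuous_id
  have hopen : IsOpen ((fun z : E d => inner ℝ e z) ⁻¹' Set.Ioo (0 : ℝ) 1) := isOpen_Ioo.preimage hc
  have hne : ((fun z : E d => inner ℝ e z) ⁻¹' Set.Ioo (0 : ℝ) 1).Nonempty := by
    refine ⟨(1 / 2 : ℝ) • e, ?_⟩
    have : inner ℝ e ((1 / 2 : ℝ) • e) = 1 / 2 := by
      rw [inner_smul_right, real_inner_self_eq_norm_sq, he, PiLp.norm_single]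
      simp
    rw [Set.mem_preimage, this]
    norm_num
  refine (hopen.measure_pos volume hne).trans_le (measure_mono fun z hz => ?_)
  have hz0 : z ≠ 0 := by
    rintro rfl
    simp at hz
  have h1 : 0 < ‖z‖ ^ (-((d : ℝ) + α)) := Real.rpow_pos_of_pos (norm_pos_iff.2 hz0) _
  have h2 : Real.cos (inner ℝ e z) < 1 := by
    have := Real.cos_lt_cos_of_nonneg_of_le_pi le_rfl (by linarith [hz.2, Real.pi_gt_three]) hz.1
    rwa [Real.cos_zero] at this
  exact (mul_pos (by linarith) h1).ne'

/-- Rotation invariance and homogeneity give the symbol of the fractional Laplacian. -/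
lemma integral_one_sub_cos [NeZero d] (hα : α ∈ Set.Ioo (1 : ℝ) 2) (ξ : E d) :
    ∫ z : E d, (1 - Real.cos (inner ℝ ξ z)) * ‖z‖ ^ (-((d : ℝ) + α)) = c0 d α * ‖ξ‖ ^ α := by
  have h0 : 0 < α := by linarith [hα.1]
  rcases eq_or_ne ξ 0 with rfl | hξ
  · simp [Real.zero_rpow h0.ne']
  set e : E d := EuclideanSpace.single (0 : Fin d) (1 : ℝ) with he
  have ht : 0 < ‖ξ‖ := norm_pos_iff.2 hξ
  set t := ‖ξ‖ with htd
  have hnorm : ‖ξ‖ = ‖t • e‖ := by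
    rw [norm_smul, he, PiLp.norm_single]; simp [htd]
  set L : E d ≃ₗᵢ[ℝ] E d := (Submodule.span ℝ {ξ - t • e})ᗮ.reflection with hL
  have hLξ : L ξ = t • e := Submodule.reflection_sub hnorm
  have hrot : ∫ z : E d, (1 - Real.cos (inner ℝ ξ z)) * ‖z‖ ^ (-((d : ℝ) + α)) =
      ∫ z : E d, (1 - Real.cos (inner ℝ (t • e) z)) * ‖z‖ ^ (-((d : ℝ) + α)) := by
    rw [← L.measurePreserving.integral_comp L.toHomeomorph.measurableEmbedding
      (fun z : E d => (1 - Real.cos (inner ℝ (t • e) z)) * ‖z‖ ^ (-((d : ℝ) + α)))]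
    refine integral_congr_ae (Filter.Eventually.of_forall fun z => ?_)
    simp only [← hLξ, LinearIsometryEquiv.inner_map_map, LinearIsometryEquiv.norm_map]
  have hscale := Measure.integral_comp_smul (volume : Measure (E d))
    (fun z : E d => (1 - Real.cos (inner ℝ e z)) * ‖z‖ ^ (-((d : ℝ) + α))) t
  rw [hrot, c0_eq]
  have hpt : ∀ z : E d, (1 - Real.cos (inner ℝ (t • e) z)) * ‖z‖ ^ (-((d : ℝ) + α)) =
      t ^ ((d : ℝ) + α) *
        ((1 - Real.cos (inner ℝ e (t • z))) * ‖t • z‖ ^ (-((d : ℝ) + α))) := by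
    intro z
    rw [inner_smul_left, inner_smul_right, norm_smul, Real.norm_of_nonneg ht.le,
      Real.mul_rpow ht.le (norm_nonneg z), Real.rpow_neg ht.le]
    have := (Real.rpow_pos_of_pos ht ((d : ℝ) + α)).ne'
    simp only [conj_trivial]
    field_simp
  simp_rw [hpt]
  rw [integral_const_mul, hscale, finrank_euclideanSpace, Fintype.card_fin, smul_eq_mul,
    abs_of_pos (by positivity), Real.rpow_add ht, Real.rpow_natCast]
  have : t ^ d ≠ 0 := by positivity
  rw [← he]
  field_simp

/-- The value `a(ξ)[𝟏,𝟏]` as an integral over displacements. -/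
lemma form_oneCell_eq [NeZero d] (hα : α ∈ Set.Ioo (1 : ℝ) 2) (hμ : IsCoefficient μlo μhi μ)
    (ξ : E d) :
    form μ α ξ (oneCell d) (oneCell d) = ((∫ z : E d, shiftMean μ z *
      ((1 - Real.cos (inner ℝ ξ z)) * ‖z‖ ^ (-((d : ℝ) + α))) : ℝ) : ℂ) := by
  set σ := (volume : Measure (E d)).restrict (unitCell d) with hσ
  have hacL : levyMeasure d α ≪ (volume : Measure (E d)) := withDensity_absolutelyContinuous _ _
  have hac : σ.prod (levyMeasure d α) ≪ σ.prod (volume : Measure (E d)) :=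
    Measure.AbsolutelyContinuous.rfl.prod hacL
  have h1 : form μ α ξ (oneCell d) (oneCell d) =
      ((∫ p, μ p.1 p.2 * (1 - Real.cos (inner ℝ ξ (p.2 - p.1))) ∂(jumpMeasure d α) : ℝ) : ℂ) := by
    rw [form, ← integral_complex_ofReal, ← integral_const_mul]
    refine integral_congr_ae ?_
    filter_upwards [twistDiff_oneCell α ξ] with p hp
    rw [hp, exp_sub_exp, map_mul]
    set t : ℝ := inner ℝ ξ (p.1 - p.2) with ht
    have hb : Complex.exp (Complex.I * (inner ℝ ξ p.2 : ℝ)) *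
        starRingEnd ℂ (Complex.exp (Complex.I * (inner ℝ ξ p.2 : ℝ))) = 1 := by
      rw [Complex.mul_conj, Complex.normSq_eq_norm_sq, norm_exp_I_inner]; simp
    have hq : (Complex.exp (Complex.I * (t : ℂ)) - 1) *
        starRingEnd ℂ (Complex.exp (Complex.I * (t : ℂ)) - 1) =
        ((2 * (1 - Real.cos t) : ℝ) : ℂ) := by
      rw [mul_comm Complex.I, Complex.exp_mul_I, ← Complex.ofReal_cos t, ← Complex.ofReal_sin t]
      simp only [map_sub, map_add, map_mul, Complex.conj_ofReal, Complex.conj_I, map_one]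
      have := Real.sin_sq_add_cos_sq t
      have h2 : (Real.sin t : ℂ) ^ 2 + (Real.cos t : ℂ) ^ 2 = 1 := by exact_mod_cast this
      rw [Complex.ofReal_mul, Complex.ofReal_sub, Complex.ofReal_one, Complex.ofReal_ofNat]
      linear_combination h2 + (-(Real.sin t : ℂ) ^ 2) * Complex.I_sq
    have hneg : inner ℝ ξ (p.2 - p.1) = -t := by
      rw [ht, ← inner_neg_right, neg_sub]
    rw [hneg, Real.cos_neg]
    calc _ = 1 / 2 * ((μ p.1 p.2 : ℂ) * ((Complex.exp (Complex.I * (inner ℝ ξ p.2 : ℝ)) *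
        starRingEnd ℂ (Complex.exp (Complex.I * (inner ℝ ξ p.2 : ℝ)))) *
        ((Complex.exp (Complex.I * (t : ℂ)) - 1) *
        starRingEnd ℂ (Complex.exp (Complex.I * (t : ℂ)) - 1)))) := by ring
      _ = _ := by rw [hb, hq]; push_cast; ring
  have hcm : Measurable fun z : E d => 1 - Real.cos (inner ℝ ξ z) := by fun_prop
  have hcL : Integrable (fun z : E d => 1 - Real.cos (inner ℝ ξ z)) (levyMeasure d α) := by
    unfold levyMeasure
    rw [integrable_withDensity_iff_integrable_smul' (by fun_prop)
      (Filter.Eventually.of_forall fun p => ENNReal.ofReal_lt_top)]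
    refine (integrable_one_sub_cos hα ξ).congr (Filter.Eventually.of_forall fun z => ?_)
    simp only [ENNReal.toReal_ofReal (Real.rpow_nonneg (norm_nonneg z) _), smul_eq_mul]
    ring
  have hcP : Integrable (fun q : E d × E d => 1 - Real.cos (inner ℝ ξ q.2))
      (σ.prod (levyMeasure d α)) := hcL.comp_snd σ
  have hint : Integrable (fun q : E d × E d => μ q.1 (q.1 + q.2) *
      (1 - Real.cos (inner ℝ ξ q.2))) (σ.prod (levyMeasure d α)) := by
    refine Integrable.bdd_mul (c := max |μlo| |μhi|) hcP
      (hμ.aestronglyMeasurable_shear.mono_ac hac) ?_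
    filter_upwards [hac.ae_le hμ.ae_shear_bounds] with x hx
    exact abs_le_max_abs_abs hx.1 hx.2
  have hmp := measurePreserving_jump d α
  have hsm : AEStronglyMeasurable (fun p : E d × E d => μ p.1 p.2 *
      (1 - Real.cos (inner ℝ ξ (p.2 - p.1)))) (Measure.map
      (fun q : E d × E d => (q.1, q.1 + q.2)) (σ.prod (levyMeasure d α))) := by
    rw [hmp.map_eq]
    refine AEStronglyMeasurable.mul ?_ (by fun_prop)
    have : jumpMeasure d α ≪ (volume : Measure (E d × E d)) := jumpMeasure_ac d α
    exact (hμ.aemeasurable.mono_ac this).aestronglyMeasurable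
  have h2 := integral_map hmp.measurable.aemeasurable hsm
  rw [hmp.map_eq] at h2
  simp only [add_sub_cancel_left] at h2
  rw [h1, h2, integral_prod_symm _ hint]
  congr 1
  simp_rw [integral_mul_const]
  change ∫ z, shiftMean μ z * (1 - Real.cos (inner ℝ ξ z)) ∂(levyMeasure d α) = _
  unfold levyMeasure
  rw [integral_withDensity_eq_integral_toReal_smul (by fun_prop)
    (Filter.Eventually.of_forall fun p => ENNReal.ofReal_lt_top)]
  refine integral_congr_ae (Filter.Eventually.of_forall fun z => ?_)
  simp only [ENNReal.toReal_ofReal (Real.rpow_nonneg (norm_nonneg z) _), smul_eq_mul]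
  ring

/-- The cellwise sums that form the second part of the matrix `g⁰`. -/
noncomputable def cellSum (μ : E d → E d → ℝ) (α : ℝ) (j k : Fin d) : ℝ :=
  ∑' n : Fin d → ℤ, ∫ z in cellAt n, muStar μ z * z j * z k / (2 * ‖z‖ ^ ((d : ℝ) + α))

lemma cellSum_eq (μ : E d → E d → ℝ) (α : ℝ) (j k : Fin d) :
    cellSum μ α j k = 1 / 2 * ∑' n : Fin d → ℤ, ∫ z in cellAt n,
      muStar μ z * (z j * z k * ‖z‖ ^ (-((d : ℝ) + α))) := by
  rw [cellSum, ← tsum_mul_left]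
  refine tsum_congr fun n => ?_
  rw [← integral_const_mul]
  refine integral_congr_ae (Filter.Eventually.of_forall fun z => ?_)
  simp only
  rw [Real.rpow_neg (norm_nonneg z), mul_comm (2 : ℝ), ← div_div, div_eq_mul_inv _ (‖z‖ ^ _)]
  ring

lemma abs_cellSum_le [NeZero d] (hα : α ∈ Set.Ioo (1 : ℝ) 2) (hμ : IsCoefficient μlo μhi μ)
    (hlo : 0 < μlo) (j k : Fin d) :
    |cellSum μ α j k| ≤ 1 / 2 * (μhi * (quadConst d α * weightInt d α)) := by
  rw [cellSum_eq, abs_mul, abs_of_pos (by norm_num : (0 : ℝ) < 1 / 2)]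
  exact mul_le_mul_of_nonneg_left (summable_muStar_quadratic hα hμ hlo j k).2.2 (by norm_num)

/-- Second order expansion of `a(ξ)[𝟏,𝟏]`: the mean of the coefficient gives the term
`μ⁰c₀|ξ|^α`, its fluctuation `μ_*` a quadratic form, up to `O(|ξ|^{1+α})`. -/
lemma norm_form_oneCell_sub_le [NeZero d] (hα : α ∈ Set.Ioo (1 : ℝ) 2)
    (hμ : IsCoefficient μlo μhi μ) (hlo : 0 < μlo) (ξ : E d) :
    ‖form μ α ξ (oneCell d) (oneCell d) - ((muZero μ * c0 d α * ‖ξ‖ ^ α +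
      ∑ j, ∑ k, cellSum μ α j k * (ξ k * ξ j) : ℝ) : ℂ)‖ ≤
      μhi * (cosConst d α * ‖ξ‖ * ((2 * ‖ξ‖) ^ α * weightInt d α)) := by
  rw [form_oneCell_eq hα hμ, ← Complex.ofReal_sub, Complex.norm_real, Real.norm_eq_abs]
  have hi := integrable_one_sub_cos (d := d) hα ξ
  have him : Integrable (fun z : E d => muStar μ z *
      ((1 - Real.cos (inner ℝ ξ z)) * ‖z‖ ^ (-((d : ℝ) + α)))) :=
    Integrable.bdd_mul hi (aestronglyMeasurable_muStar hμ) (abs_muStar_le hμ hlo)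
  have h1 : ∫ z : E d, shiftMean μ z *
      ((1 - Real.cos (inner ℝ ξ z)) * ‖z‖ ^ (-((d : ℝ) + α))) =
      muZero μ * (c0 d α * ‖ξ‖ ^ α) + ∫ z : E d, muStar μ z *
        ((1 - Real.cos (inner ℝ ξ z)) * ‖z‖ ^ (-((d : ℝ) + α))) := by
    rw [← integral_one_sub_cos hα ξ, ← integral_const_mul, ← integral_add (hi.const_mul _) him]
    refine integral_congr_ae (Filter.Eventually.of_forall fun z => ?_)
    simp only [muStar_eq]
    ring
  have h2 := hasSum_integral_iUnion (μ := (volume : Measure (E d))) (f := fun z => muStar μ z *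
      ((1 - Real.cos (inner ℝ ξ z)) * ‖z‖ ^ (-((d : ℝ) + α))))
      measurableSet_cellAt pairwise_disjoint_cellAt him.integrableOn
  rw [iUnion_cellAt, Measure.restrict_univ] at h2
  have hr := summable_muStar_cosRem hα hμ hlo (d := d) ξ
  have hq := fun j k => summable_muStar_quadratic hα hμ hlo (d := d) j k
  have h3 : HasSum (fun n : Fin d → ℤ => ∑ j, ∑ k, (1 / 2 * (ξ k * ξ j)) * ∫ z in cellAt n,
      muStar μ z * (z j * z k * ‖z‖ ^ (-((d : ℝ) + α))))
      (∑ j, ∑ k, cellSum μ α j k * (ξ k * ξ j)) := by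
    refine hasSum_sum fun j _ => hasSum_sum fun k _ => ?_
    rw [cellSum_eq, show ∀ a b c : ℝ, 1 / 2 * a * (b * c) = 1 / 2 * (b * c) * a by intros; ring]
    exact (hq j k).2.1.hasSum.mul_left _
  have h4 : ∀ n : Fin d → ℤ, (∫ z in cellAt n, muStar μ z *
        ((1 - Real.cos (inner ℝ ξ z)) * ‖z‖ ^ (-((d : ℝ) + α)))) =
      (∑ j, ∑ k, (1 / 2 * (ξ k * ξ j)) * ∫ z in cellAt n,
      muStar μ z * (z j * z k * ‖z‖ ^ (-((d : ℝ) + α)))) + ∫ z in cellAt n,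
        muStar μ z * (cosRem (inner ℝ ξ z) * ‖z‖ ^ (-((d : ℝ) + α))) := by
    intro n
    have hqi : ∀ j k, IntegrableOn (fun z : E d => (1 / 2 * (ξ k * ξ j)) *
        (muStar μ z * (z j * z k * ‖z‖ ^ (-((d : ℝ) + α))))) (cellAt n) :=
      fun j k => ((hq j k).1 n).const_mul _
    simp_rw [← integral_const_mul]
    rw [← Finset.sum_congr rfl fun j _ => integral_finsetSum Finset.univ fun k _ => hqi j k,
      ← integral_finsetSum Finset.univ fun j _ => integrable_finsetSum _ fun k _ => hqi j k,
      ← integral_add (integrable_finsetSum _ fun j _ => integrable_finsetSum _ fun k _ => hqi j k)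
        (hr.1 n)]
    refine integral_congr_ae (Filter.Eventually.of_forall fun z => ?_)
    have hin : ∑ j, ∑ k, (1 / 2 * (ξ k * ξ j)) *
        (muStar μ z * (z j * z k * ‖z‖ ^ (-((d : ℝ) + α)))) =
        1 / 2 * inner ℝ ξ z ^ 2 * (muStar μ z * ‖z‖ ^ (-((d : ℝ) + α))) := by
      rw [sq, PiLp.inner_apply, Finset.sum_mul_sum, Finset.mul_sum, Finset.sum_mul]
      refine Finset.sum_congr rfl fun j _ => ?_
      rw [Finset.mul_sum, Finset.sum_mul]
      refine Finset.sum_congr rfl fun k _ => ?_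
      simp only [RCLike.inner_apply, conj_trivial]
      ring
    simp only
    rw [hin, cosRem]
    ring
  simp_rw [h4] at h2
  have h5 := h2.unique (h3.add hr.2.1.hasSum)
  rw [h1, h5]
  refine le_trans (le_of_eq ?_) hr.2.2
  congr 1
  ring

end

/-! ### The corrector -/

section

variable {d : ℕ} {α μlo μhi : ℝ} {μ : E d → E d → ℝ}

lemma dipole_sum_right [NeZero d] (hα : α ∈ Set.Ioo (1 : ℝ) 2) (hμ : IsCoefficient μlo μhi μ)
    (hlo : 0 < μlo) (ξ : E d) {ι : Type*} (s : Finset ι) (c : ι → ℂ) {v : ι → L2Cell d}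
    (hv : ∀ i, v i ∈ formDomain d α) :
    dipole μ α ξ (∑ i ∈ s, c i • v i) = ∑ i ∈ s, starRingEnd ℂ (c i) * dipole μ α ξ (v i) := by
  classical
  induction s using Finset.induction_on with
  | empty =>
    have := dipole_smul μ α ξ 0 0
    simpa using this
  | insert a s ha ih =>
    rw [Finset.sum_insert ha, Finset.sum_insert ha, dipole_add hα hμ hlo ξ
      (Submodule.smul_mem _ _ (hv a)) (Submodule.sum_mem _ fun i _ => Submodule.smul_mem _ _ (hv i)),
      dipole_smul, ih]

/-- The combination `∑ ξ_k v_k` of the solutions of the auxiliary problems. It is the first order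
corrector in the direction `ξ`, up to the factor `i`. -/
noncomputable def corrector (ξ : E d) (v : Fin d → L2Cell d) : L2Cell d := ∑ k, (ξ k : ℂ) • v k

lemma corrector_mem {v : Fin d → L2Cell d} (hv : ∀ k, IsCellSolution μ α k (v k)) (ξ : E d) :
    corrector ξ v ∈ formDomain d α :=
  Submodule.sum_mem _ fun k _ => Submodule.smul_mem _ _ (hv k).1

lemma inner_oneCell_corrector {v : Fin d → L2Cell d} (hv : ∀ k, IsCellSolution μ α k (v k))
    (ξ : E d) : inner ℂ (oneCell d) (corrector ξ v) = 0 := by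
  rw [corrector, inner_sum]
  refine Finset.sum_eq_zero fun k _ => ?_
  rw [inner_smul_right, inner_oneCell, (hv k).2.1, mul_zero]

lemma integral_corrector {v : Fin d → L2Cell d} (hv : ∀ k, IsCellSolution μ α k (v k))
    (ξ : E d) : ∫ x in unitCell d, corrector ξ v x = 0 := by
  rw [← inner_oneCell, inner_oneCell_corrector hv]

lemma form_zero_corrector [NeZero d] (hα : α ∈ Set.Ioo (1 : ℝ) 2)
    (hμ : IsCoefficient μlo μhi μ) (hlo : 0 < μlo) {v : Fin d → L2Cell d}
    (hv : ∀ k, IsCellSolution μ α k (v k)) (ξ : E d) {η : L2Cell d} (hη : η ∈ formDomain d α) :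
    form μ α 0 (corrector ξ v) η = -dipole μ α ξ η := by
  rw [corrector, form_sum_left hα hμ 0 _ _ (fun k => (hv k).1) hη, dipole_sum hα hμ hlo ξ hη,
    ← Finset.sum_neg_distrib]
  refine Finset.sum_congr rfl fun k _ => ?_
  rw [((isCellSolution_iff hα hμ hlo k (v k)).1 (hv k)).2.2 η hη, mul_neg]

/-- The constant in the energy bound for the corrector. -/
noncomputable def corrConst (d : ℕ) (α μlo μhi : ℝ) : ℝ := 2 / μlo * dipoleConst d α μhi

lemma corrConst_nonneg (d : ℕ) (α : ℝ) (hlo : 0 < μlo) (hhi : 0 ≤ μhi) :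
    0 ≤ corrConst d α μlo μhi :=
  mul_nonneg (by positivity) (dipoleConst_nonneg d α hhi)

lemma seminormH_corrector_le [NeZero d] (hα : α ∈ Set.Ioo (1 : ℝ) 2)
    (hμ : IsCoefficient μlo μhi μ) (hlo : 0 < μlo) {v : Fin d → L2Cell d}
    (hv : ∀ k, IsCellSolution μ α k (v k)) (ξ : E d) :
    seminormH α (corrector ξ v) ≤ corrConst d α μlo μhi * ‖ξ‖ := by
  have hhi : 0 ≤ μhi := hlo.le.trans hμ.lo_le_hi
  have hV := corrector_mem hv ξ
  have hS := seminormH_nonneg α (corrector ξ v)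
  have h1 := re_form_self_ge hα hμ 0 hV
  rw [twistDiff_zero_left, form_zero_corrector hα hμ hlo hv ξ hV] at h1
  change μlo / 2 * seminormH α (corrector ξ v) ^ 2 ≤ _ at h1
  have h2 : (-dipole μ α ξ (corrector ξ v)).re ≤ ‖dipole μ α ξ (corrector ξ v)‖ := by
    rw [← norm_neg]; exact Complex.re_le_norm _
  have h3 := norm_dipole_le hα hμ hlo ξ hV (integral_corrector hv ξ)
  have hD := mul_nonneg (dipoleConst_nonneg d α hhi) (norm_nonneg ξ)
  have hC := mul_nonneg (corrConst_nonneg d α hlo hhi) (norm_nonneg ξ)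
  rcases hS.eq_or_lt with h0 | h0
  · rw [← h0]; exact hC
  · have h4 : μlo / 2 * seminormH α (corrector ξ v) ≤ dipoleConst d α μhi * ‖ξ‖ := by
      refine le_of_mul_le_mul_right ?_ h0
      calc _ = μlo / 2 * seminormH α (corrector ξ v) ^ 2 := by ring
        _ ≤ _ := (h1.trans h2).trans h3
    calc seminormH α (corrector ξ v) = 2 / μlo * (μlo / 2 * seminormH α (corrector ξ v)) := by
          field_simp
      _ ≤ 2 / μlo * (dipoleConst d α μhi * ‖ξ‖) :=
          mul_le_mul_of_nonneg_left h4 (by positivity)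
      _ = _ := by rw [corrConst]; ring

lemma norm_corrector_le [NeZero d] (hα : α ∈ Set.Ioo (1 : ℝ) 2)
    (hμ : IsCoefficient μlo μhi μ) (hlo : 0 < μlo) {v : Fin d → L2Cell d}
    (hv : ∀ k, IsCellSolution μ α k (v k)) (ξ : E d) :
    ‖corrector ξ v‖ ≤ poincareConst d α * corrConst d α μlo μhi * ‖ξ‖ := by
  refine (norm_le_poincareConst_mul hα (corrector_mem hv ξ) (integral_corrector hv ξ)).trans ?_
  rw [mul_assoc]
  exact mul_le_mul_of_nonneg_left (seminormH_corrector_le hα hμ hlo hv ξ)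
    (poincareConst_nonneg d α)

lemma gZero_apply (μ : E d → E d → ℝ) (α : ℝ) (v : Fin d → L2Cell d) (j k : Fin d)
    (i1 : Integrable (fun p => (μ p.1 p.2 : ℂ) *
      (((inner ℝ (EuclideanSpace.single j (1 : ℝ)) (p.1 - p.2) : ℝ) : ℂ) *
      starRingEnd ℂ (cellDiff (v k) p))) (jumpMeasure d α))
    (i2 : Integrable (fun p => (μ p.1 p.2 : ℂ) *
      (((inner ℝ (EuclideanSpace.single k (1 : ℝ)) (p.1 - p.2) : ℝ) : ℂ) *
      starRingEnd ℂ (cellDiff (v j) p))) (jumpMeasure d α)) :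
    gZero μ α v j k = 1 / 2 *
      (starRingEnd ℂ (dipole μ α (EuclideanSpace.single j (1 : ℝ)) (v k)) +
        starRingEnd ℂ (dipole μ α (EuclideanSpace.single k (1 : ℝ)) (v j))) +
      (cellSum μ α j k : ℂ) := by
  have h : ∫ p, (μ p.1 p.2 : ℂ) *
      (((p.1 j - p.2 j : ℝ) : ℂ) * (perExt (v k) p.1 - perExt (v k) p.2) +
        ((p.1 k - p.2 k : ℝ) : ℂ) * (perExt (v j) p.1 - perExt (v j) p.2)) ∂(jumpMeasure d α) =
      starRingEnd ℂ (2 * dipole μ α (EuclideanSpace.single j (1 : ℝ)) (v k) +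
        2 * dipole μ α (EuclideanSpace.single k (1 : ℝ)) (v j)) := by
    rw [dipole, dipole, ← mul_assoc, ← mul_assoc, show (2 : ℂ) * (1 / 2) = 1 by norm_num, one_mul,
      one_mul, ← integral_add i1 i2, ← integral_conj]
    refine integral_congr_ae (Filter.Eventually.of_forall fun p => ?_)
    simp only [cellDiff, EuclideanSpace.inner_single_left, map_one, one_mul, PiLp.sub_apply,
      map_add, map_mul, Complex.conj_ofReal, Complex.conj_conj, map_sub]
    ring
  change (1 / 4 : ℂ) * _ + (cellSum μ α j k : ℂ) = _
  rw [h]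
  simp only [map_add, map_mul, Complex.conj_ofNat]
  ring

lemma dipole_corrector_conj [NeZero d] (hα : α ∈ Set.Ioo (1 : ℝ) 2)
    (hμ : IsCoefficient μlo μhi μ) (hlo : 0 < μlo) {v : Fin d → L2Cell d}
    (hv : ∀ k, IsCellSolution μ α k (v k)) (ξ : E d) :
    starRingEnd ℂ (dipole μ α ξ (corrector ξ v)) = dipole μ α ξ (corrector ξ v) := by
  have h := form_zero_corrector hα hμ hlo hv ξ (corrector_mem hv ξ)
  rw [← neg_eq_iff_eq_neg] at h
  rw [← h, map_neg, ← form_conj]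

/-- The quadratic form of `g⁰` splits into the (real, nonpositive) contribution of the corrector and
the contribution of the fluctuation of the coefficient. -/
lemma matForm_gZero [NeZero d] (hα : α ∈ Set.Ioo (1 : ℝ) 2)
    (hμ : IsCoefficient μlo μhi μ) (hlo : 0 < μlo) {v : Fin d → L2Cell d}
    (hv : ∀ k, IsCellSolution μ α k (v k)) (ξ : E d) :
    matForm (gZero μ α v) ξ = dipole μ α ξ (corrector ξ v) +
      ((∑ j, ∑ k, cellSum μ α j k * (ξ k * ξ j) : ℝ) : ℂ) := by
  have hi := fun j k => (integrable_dipole hα hμ hlo (EuclideanSpace.single j (1 : ℝ)) (hv k).1).1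
  set D : Fin d → Fin d → ℂ := fun j k =>
    starRingEnd ℂ (dipole μ α (EuclideanSpace.single j (1 : ℝ)) (v k)) with hD
  have h1 : dipole μ α ξ (corrector ξ v) = ∑ j, ∑ k, D j k * (ξ k * ξ j) := by
    rw [← dipole_corrector_conj hα hμ hlo hv ξ, dipole_sum hα hμ hlo ξ (corrector_mem hv ξ), map_sum]
    refine Finset.sum_congr rfl fun j _ => ?_
    rw [corrector, dipole_sum_right hα hμ hlo _ _ _ (fun k => (hv k).1), map_mul, map_sum,
      Finset.mul_sum]
    refine Finset.sum_congr rfl fun k _ => ?_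
    simp only [map_mul, Complex.conj_ofReal, hD]
    ring
  have h2 : ∑ j, ∑ k, D j k * ((ξ k : ℂ) * ξ j) = ∑ j, ∑ k, D k j * ((ξ k : ℂ) * ξ j) := by
    rw [Finset.sum_comm]
    refine Finset.sum_congr rfl fun j _ => Finset.sum_congr rfl fun k _ => ?_
    ring
  have h3 : dipole μ α ξ (corrector ξ v) =
      ∑ j, ∑ k, 1 / 2 * (D j k + D k j) * ((ξ k : ℂ) * ξ j) := by
    have e : dipole μ α ξ (corrector ξ v) = 1 / 2 * ∑ j, ∑ k, D j k * ((ξ k : ℂ) * ξ j) +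
        1 / 2 * ∑ j, ∑ k, D k j * ((ξ k : ℂ) * ξ j) := by rw [← h2, ← h1]; ring
    rw [e]
    simp only [Finset.mul_sum, ← Finset.sum_add_distrib]
    refine Finset.sum_congr rfl fun j _ => Finset.sum_congr rfl fun k _ => ?_
    ring
  rw [h3, matForm]
  push_cast
  simp only [← Finset.sum_add_distrib]
  refine Finset.sum_congr rfl fun j _ => Finset.sum_congr rfl fun k _ => ?_
  rw [gZero_apply μ α v j k (hi j k) (hi k j)]
  ring

/-- The constant in the bound for the matrix `g⁰`. -/
noncomputable def matConst (d : ℕ) (α μlo μhi : ℝ) : ℝ :=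
  dipoleConst d α μhi * corrConst d α μlo μhi +
    d * (d * (1 / 2 * (μhi * (quadConst d α * weightInt d α))))

lemma norm_matForm_le [NeZero d] (hα : α ∈ Set.Ioo (1 : ℝ) 2)
    (hμ : IsCoefficient μlo μhi μ) (hlo : 0 < μlo) {v : Fin d → L2Cell d}
    (hv : ∀ k, IsCellSolution μ α k (v k)) (ξ : E d) :
    ‖matForm (gZero μ α v) ξ‖ ≤ matConst d α μlo μhi * ‖ξ‖ ^ 2 := by
  have hhi : 0 ≤ μhi := hlo.le.trans hμ.lo_le_hi
  have hD := dipoleConst_nonneg d α hhi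
  have hξ := norm_nonneg ξ
  rw [matForm_gZero hα hμ hlo hv]
  refine (norm_add_le _ _).trans ?_
  have h1 : ‖dipole μ α ξ (corrector ξ v)‖ ≤
      dipoleConst d α μhi * corrConst d α μlo μhi * ‖ξ‖ ^ 2 := by
    refine (norm_dipole_le hα hμ hlo ξ (corrector_mem hv ξ) (integral_corrector hv ξ)).trans ?_
    calc _ ≤ dipoleConst d α μhi * ‖ξ‖ * (corrConst d α μlo μhi * ‖ξ‖) :=
          mul_le_mul_of_nonneg_left (seminormH_corrector_le hα hμ hlo hv ξ) (by positivity)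
      _ = _ := by ring
  have h2 : |∑ j, ∑ k, cellSum μ α j k * (ξ k * ξ j)| ≤
      d * (d * (1 / 2 * (μhi * (quadConst d α * weightInt d α)))) * ‖ξ‖ ^ 2 := by
    have hjk : ∀ j k, |cellSum μ α j k * (ξ k * ξ j)| ≤
        1 / 2 * (μhi * (quadConst d α * weightInt d α)) * ‖ξ‖ ^ 2 := by
      intro j k
      rw [abs_mul, abs_mul]
      have hk : |ξ k| ≤ ‖ξ‖ := PiLp.norm_apply_le ξ k
      have hj : |ξ j| ≤ ‖ξ‖ := PiLp.norm_apply_le ξ j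
      have hc := abs_cellSum_le hα hμ hlo j k
      calc _ ≤ 1 / 2 * (μhi * (quadConst d α * weightInt d α)) * (‖ξ‖ * ‖ξ‖) :=
            mul_le_mul hc (mul_le_mul hk hj (abs_nonneg _) hξ) (by positivity)
              ((abs_nonneg _).trans hc)
        _ = _ := by ring
    refine (Finset.abs_sum_le_sum_abs _ _).trans ((Finset.sum_le_sum fun j _ =>
      (Finset.abs_sum_le_sum_abs _ _).trans (Finset.sum_le_sum fun k _ => hjk j k)).trans
      (le_of_eq ?_))
    simp only [Finset.sum_const, Finset.card_univ, Fintype.card_fin, nsmul_eq_mul]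
    ring
  rw [Complex.norm_real, Real.norm_eq_abs, matConst, add_mul]
  exact add_le_add h1 h2

/-- The constant in the expansion of `a(ξ)[𝟏,φ]`. -/
noncomputable def expandConst (d : ℕ) (α μlo μhi : ℝ) : ℝ :=
  μhi * (cosConst d α * (2 ^ α * weightInt d α)) +
    4 * μhi * weightInt d α * (poincareConst d α * corrConst d α μlo μhi)

/-- With the corrected test function `φ = 𝟏 + i ∑ ξ_k v_k`, the form reproduces the effective symbol
together with the correction `⟨g⁰ξ,ξ⟩`. -/
lemma norm_form_oneCell_corrected_sub_le [NeZero d] (hα : α ∈ Set.Ioo (1 : ℝ) 2)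
    (hμ : IsCoefficient μlo μhi μ) (hlo : 0 < μlo) {v : Fin d → L2Cell d}
    (hv : ∀ k, IsCellSolution μ α k (v k)) (ξ : E d) :
    ‖form μ α ξ (oneCell d) (oneCell d + Complex.I • corrector ξ v) -
      ((muZero μ * c0 d α * ‖ξ‖ ^ α : ℝ) + matForm (gZero μ α v) ξ)‖ ≤
      expandConst d α μlo μhi * (‖ξ‖ ^ α * ‖ξ‖) := by
  have hhi : 0 ≤ μhi := hlo.le.trans hμ.lo_le_hi
  have hV := corrector_mem hv ξ
  have h1V := oneCell_mem_formDomain d α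
  have hK := weightInt_nonneg d α
  have hξα : 0 ≤ ‖ξ‖ ^ α := Real.rpow_nonneg (norm_nonneg ξ) _
  have h1 := norm_form_oneCell_sub_le hα hμ hlo ξ
  have h2 := norm_form_one_sub_dipole_le hα hμ hlo ξ hV
  have h3 := norm_corrector_le hα hμ hlo hv ξ
  rw [form_add_right hα hμ ξ h1V (Submodule.smul_mem _ _ hV) h1V, form_smul_right, Complex.conj_I,
    matForm_gZero hα hμ hlo hv]
  set a := form μ α ξ (oneCell d) (oneCell d)
  set b := form μ α ξ (oneCell d) (corrector ξ v)
  set D := dipole μ α ξ (corrector ξ v)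
  set G := ∑ j, ∑ k, cellSum μ α j k * (ξ k * ξ j)
  have e : a + -Complex.I * b - ((muZero μ * c0 d α * ‖ξ‖ ^ α : ℝ) + (D + (G : ℂ))) =
      (a - ((muZero μ * c0 d α * ‖ξ‖ ^ α + G : ℝ) : ℂ)) - Complex.I * (b - Complex.I * D) := by
    push_cast
    linear_combination (-D) * Complex.I_sq
  rw [e]
  refine (norm_sub_le _ _).trans ?_
  rw [norm_mul, Complex.norm_I, one_mul]
  refine (add_le_add h1 (h2.trans (mul_le_mul_of_nonneg_left h3 (by positivity)))).trans
    (le_of_eq ?_)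
  rw [Real.mul_rpow zero_le_two (norm_nonneg ξ), expandConst]
  ring

/-- For `|ξ| ≤ 1`, a factor `|ξ|` compensates the order `|ξ|^{α/2}` of the twist. -/
lemma twistConst_mul_norm_le (hα : α ∈ Set.Ioo (1 : ℝ) 2) {ξ : E d} (hξ : ‖ξ‖ ≤ 1) :
    twistConst α ξ * ‖ξ‖ ≤ 2 * Real.sqrt (weightInt d α) * ‖ξ‖ ^ α := by
  have h0 : 0 < α := by linarith [hα.1]
  have hξα : 0 ≤ ‖ξ‖ ^ α := Real.rpow_nonneg (norm_nonneg ξ) _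
  have h1 : ‖ξ‖ ≤ Real.sqrt (‖ξ‖ ^ α) := by
    refine Real.le_sqrt_of_sq_le ?_
    rcases (norm_nonneg ξ).eq_or_lt with h | h
    · rw [← h, Real.zero_rpow h0.ne']; norm_num
    · rw [← Real.rpow_two]
      exact Real.rpow_le_rpow_of_exponent_ge h hξ hα.2.le
  rw [twistConst, Real.sqrt_mul hξα]
  calc 2 * (Real.sqrt (‖ξ‖ ^ α) * Real.sqrt (weightInt d α)) * ‖ξ‖ ≤
      2 * (Real.sqrt (‖ξ‖ ^ α) * Real.sqrt (weightInt d α)) * Real.sqrt (‖ξ‖ ^ α) := by gcongr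
    _ = 2 * Real.sqrt (weightInt d α) * (Real.sqrt (‖ξ‖ ^ α) * Real.sqrt (‖ξ‖ ^ α)) := by ring
    _ = _ := by rw [Real.mul_self_sqrt hξα]

/-- The constant in the bound for `a(ξ)[φ, r]` with mean zero `r`. -/
noncomputable def crossConst (d : ℕ) (α μlo μhi : ℝ) : ℝ :=
  4 * μhi * weightInt d α * poincareConst d α +
    μhi / 2 * (corrConst d α μlo μhi * (2 * Real.sqrt (weightInt d α)) * poincareConst d α +
      poincareConst d α * corrConst d α μlo μhi * (2 * Real.sqrt (weightInt d α)) +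
      4 * weightInt d α * (poincareConst d α * corrConst d α μlo μhi) * poincareConst d α)

lemma crossConst_nonneg (d : ℕ) (α : ℝ) (hlo : 0 < μlo) (hhi : 0 ≤ μhi) :
    0 ≤ crossConst d α μlo μhi := by
  have := corrConst_nonneg d α hlo hhi
  have := poincareConst_nonneg d α
  have := weightInt_nonneg d α
  unfold crossConst
  positivity

/-- The corrector equation cancels the first order term of `a(ξ)[𝟏, r]`. -/
lemma norm_form_corrected_le [NeZero d] (hα : α ∈ Set.Ioo (1 : ℝ) 2)
    (hμ : IsCoefficient μlo μhi μ) (hlo : 0 < μlo) {v : Fin d → L2Cell d}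
    (hv : ∀ k, IsCellSolution μ α k (v k)) {ξ : E d} (hξ : ‖ξ‖ ≤ 1) {r : L2Cell d}
    (hr : r ∈ formDomain d α) (hmean : ∫ x in unitCell d, r x = 0) :
    ‖form μ α ξ (oneCell d + Complex.I • corrector ξ v) r‖ ≤
      crossConst d α μlo μhi * ‖ξ‖ ^ α * seminormH α r := by
  have hhi : 0 ≤ μhi := hlo.le.trans hμ.lo_le_hi
  have hV := corrector_mem hv ξ
  have h1V := oneCell_mem_formDomain d α
  have hK := weightInt_nonneg d α
  have hp := poincareConst_nonneg d α
  have hC := corrConst_nonneg d α hlo hhi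
  have hξα : 0 ≤ ‖ξ‖ ^ α := Real.rpow_nonneg (norm_nonneg ξ) _
  have hS := seminormH_nonneg α r
  have h1 := norm_form_one_sub_dipole_le hα hμ hlo ξ hr
  have h2 := norm_form_sub_form_zero_le hα hμ hlo ξ hV hr
  rw [form_zero_corrector hα hμ hlo hv ξ hr] at h2
  have h3 := norm_corrector_le hα hμ hlo hv ξ
  have h4 := seminormH_corrector_le hα hμ hlo hv ξ
  have h5 := norm_le_poincareConst_mul hα hr hmean
  have hT := twistConst_nonneg α ξ
  have hT1 := twistConst_mul_norm_le hα hξ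
  have hT2 := sq_twistConst α ξ
  rw [form_add_left hα hμ ξ h1V (Submodule.smul_mem _ _ hV) hr, form_smul_left]
  set a := form μ α ξ (oneCell d) r
  set b := form μ α ξ (corrector ξ v) r
  set D := dipole μ α ξ r
  set T := twistConst α ξ
  set K := weightInt d α
  set p := poincareConst d α
  set c := corrConst d α μlo μhi
  set S := seminormH α r
  set t := ‖ξ‖ with ht
  have ht0 : 0 ≤ t := norm_nonneg ξ
  have e : a + Complex.I * b = (a - Complex.I * D) + Complex.I * (b - -D) := by ring
  rw [e]
  refine (norm_add_le _ _).trans ?_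
  rw [norm_mul, Complex.norm_I, one_mul]
  have g1 : seminormH α (corrector ξ v) * (T * ‖r‖) ≤
      c * (2 * Real.sqrt K) * p * t ^ α * S := by
    calc _ ≤ c * t * (T * (p * S)) := by gcongr
      _ = c * (T * t) * p * S := by ring
      _ ≤ c * (2 * Real.sqrt K * t ^ α) * p * S := by gcongr
      _ = _ := by ring
  have g2 : T * ‖corrector ξ v‖ * S ≤ p * c * (2 * Real.sqrt K) * t ^ α * S := by
    calc _ ≤ T * (p * c * t) * S := by gcongr
      _ = p * c * (T * t) * S := by ring
      _ ≤ p * c * (2 * Real.sqrt K * t ^ α) * S := by gcongr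
      _ = _ := by ring
  have g3 : T * ‖corrector ξ v‖ * (T * ‖r‖) ≤ 4 * K * (p * c) * p * t ^ α * S := by
    calc _ = T ^ 2 * (‖corrector ξ v‖ * ‖r‖) := by ring
      _ ≤ T ^ 2 * (p * c * t * (p * S)) := by gcongr
      _ ≤ T ^ 2 * (p * c * 1 * (p * S)) := by gcongr
      _ = _ := by rw [hT2]; ring
  calc _ ≤ 4 * μhi * K * t ^ α * ‖r‖ + μhi / 2 * (c * (2 * Real.sqrt K) * p * t ^ α * S +
        p * c * (2 * Real.sqrt K) * t ^ α * S + 4 * K * (p * c) * p * t ^ α * S) :=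
        add_le_add h1 (h2.trans (mul_le_mul_of_nonneg_left
          (add_le_add (add_le_add g1 g2) g3) (by positivity)))
    _ ≤ 4 * μhi * K * t ^ α * (p * S) + μhi / 2 * (c * (2 * Real.sqrt K) * p * t ^ α * S +
        p * c * (2 * Real.sqrt K) * t ^ α * S + 4 * K * (p * c) * p * t ^ α * S) := by gcongr
    _ = _ := by rw [crossConst]; ring

/-- The constant in the bound for `a(ξ)[𝟏, r]` with mean zero `r`. -/
noncomputable def oneConst (d : ℕ) (α μhi : ℝ) : ℝ :=
  dipoleConst d α μhi + 4 * μhi * weightInt d α * poincareConst d α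

lemma norm_form_one_le [NeZero d] (hα : α ∈ Set.Ioo (1 : ℝ) 2)
    (hμ : IsCoefficient μlo μhi μ) (hlo : 0 < μlo) {ξ : E d} (hξ : ‖ξ‖ ≤ 1) {r : L2Cell d}
    (hr : r ∈ formDomain d α) (hmean : ∫ x in unitCell d, r x = 0) :
    ‖form μ α ξ (oneCell d) r‖ ≤ oneConst d α μhi * ‖ξ‖ * seminormH α r := by
  have hhi : 0 ≤ μhi := hlo.le.trans hμ.lo_le_hi
  have hK := weightInt_nonneg d α
  have h1 := norm_form_one_sub_dipole_le hα hμ hlo ξ hr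
  have h2 := norm_dipole_le hα hμ hlo ξ hr hmean
  have h5 := norm_le_poincareConst_mul hα hr hmean
  have hS := seminormH_nonneg α r
  have ht : ‖ξ‖ ^ α ≤ ‖ξ‖ := by
    rcases (norm_nonneg ξ).eq_or_lt with h | h
    · rw [← h, Real.zero_rpow (by linarith [hα.1])]
    · exact (Real.rpow_le_rpow_of_exponent_ge h hξ hα.1.le).trans_eq (Real.rpow_one _)
  have hξ0 := norm_nonneg ξ
  have e : form μ α ξ (oneCell d) r = (form μ α ξ (oneCell d) r - Complex.I * dipole μ α ξ r) +
      Complex.I * dipole μ α ξ r := by ring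
  rw [e]
  refine (norm_add_le _ _).trans ?_
  rw [norm_mul, Complex.norm_I, one_mul]
  calc _ ≤ 4 * μhi * weightInt d α * ‖ξ‖ * (poincareConst d α * seminormH α r) +
        dipoleConst d α μhi * ‖ξ‖ * seminormH α r := by
        refine add_le_add (h1.trans ?_) h2
        have hp := poincareConst_nonneg d α
        gcongr
    _ = _ := by rw [oneConst]; ring

/-- Coercivity of `a(ξ)` on mean zero functions, for small `ξ`. -/
lemma re_form_self_ge_seminormH [NeZero d] (hα : α ∈ Set.Ioo (1 : ℝ) 2)
    (hμ : IsCoefficient μlo μhi μ) (hlo : 0 < μlo) {ξ : E d}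
    (hξ : twistConst α ξ * poincareConst d α ≤ 1 / 2) {r : L2Cell d}
    (hr : r ∈ formDomain d α) (hmean : ∫ x in unitCell d, r x = 0) :
    μlo / 8 * seminormH α r ^ 2 ≤ (form μ α ξ r r).re := by
  refine le_trans ?_ (re_form_self_ge hα hμ ξ hr)
  have h1 := seminormH_le_lpNorm_twistDiff hα ξ hr
  have h2 := norm_le_poincareConst_mul hα hr hmean
  have hS := seminormH_nonneg α r
  have h3 : twistConst α ξ * ‖r‖ ≤ 1 / 2 * seminormH α r := by
    calc _ ≤ twistConst α ξ * (poincareConst d α * seminormH α r) :=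
          mul_le_mul_of_nonneg_left h2 (twistConst_nonneg α ξ)
      _ = twistConst α ξ * poincareConst d α * seminormH α r := by ring
      _ ≤ _ := mul_le_mul_of_nonneg_right hξ hS
  have h4 : (1 / 2 * seminormH α r) ^ 2 ≤ lpNorm (twistDiff ξ r) 2 (jumpMeasure d α) ^ 2 :=
    pow_le_pow_left₀ (by positivity) (by linarith) 2
  calc μlo / 8 * seminormH α r ^ 2 = μlo / 2 * (1 / 2 * seminormH α r) ^ 2 := by ring
    _ ≤ _ := mul_le_mul_of_nonneg_left h4 (by positivity)

end

/-! ### Approximation of the resolvent by the effective symbol -/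

section

variable {d : ℕ} {α μlo μhi : ℝ} {μ : E d → E d → ℝ}

lemma norm_P_apply_le (d : ℕ) (f : L2Cell d) : ‖P d f‖ ≤ ‖f‖ := by
  have h : P d f = inner ℂ (oneCell d) f • oneCell d := rfl
  rw [h, norm_smul, norm_oneCell, mul_one]
  refine (norm_inner_le_norm _ _).trans ?_
  rw [norm_oneCell, one_mul]

lemma norm_P_le (d : ℕ) : ‖P d‖ ≤ 1 :=
  ContinuousLinearMap.opNorm_le_bound _ zero_le_one fun f => by
    rw [one_mul]; exact norm_P_apply_le d f

/-- The remainder of the geometric series for `(S + G)⁻¹`. -/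
lemma inv_add_sub_sum (S G : ℂ) (hS : S ≠ 0) (hSG : S + G ≠ 0) (N : ℕ) :
    (S + G)⁻¹ - S⁻¹ - ∑ m ∈ Finset.Icc 1 N, (-1) ^ m * G ^ m * S⁻¹ ^ (m + 1) =
      (-G) ^ (N + 1) * S⁻¹ ^ (N + 1) * (S + G)⁻¹ := by
  have key : (S + G)⁻¹ - S⁻¹ = -G * S⁻¹ * (S + G)⁻¹ := by
    field_simp
    ring
  induction N with
  | zero => simpa using key
  | succ n ih =>
    rw [Finset.sum_Icc_succ_top (by omega), ← sub_sub, ih]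
    have e : (-G) ^ (n + 1) * S⁻¹ ^ (n + 1) * (S + G)⁻¹ -
        (-1) ^ (n + 1) * G ^ (n + 1) * S⁻¹ ^ (n + 1 + 1) =
        (-G) ^ (n + 1) * S⁻¹ ^ (n + 1) * ((S + G)⁻¹ - S⁻¹) := by
      rw [neg_pow G, pow_succ S⁻¹ (n + 1)]
      ring
    rw [e, key]
    ring

lemma norm_inv_add_sub_sum_le {S : ℝ} {G : ℂ} (hS : 0 < S) (hG : ‖G‖ ≤ S / 2) (N : ℕ) :
    ‖((S : ℂ) + G)⁻¹‖ ≤ 2 / S ∧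
    ‖((S : ℂ) + G)⁻¹ - (S : ℂ)⁻¹ - ∑ m ∈ Finset.Icc 1 N,
      (-1) ^ m * G ^ m * (S : ℂ)⁻¹ ^ (m + 1)‖ ≤ 2 * (‖G‖ / S) ^ (N + 1) / S := by
  have h1 : S / 2 ≤ ‖(S : ℂ) + G‖ := by
    have h := norm_sub_le ((S : ℂ) + G) G
    rw [add_sub_cancel_right, Complex.norm_real, Real.norm_of_nonneg hS.le] at h
    linarith
  have h2 : (S : ℂ) + G ≠ 0 := norm_pos_iff.1 ((half_pos hS).trans_le h1)
  have h3 : ‖((S : ℂ) + G)⁻¹‖ ≤ 2 / S := by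
    rw [norm_inv, ← inv_div]
    exact inv_anti₀ (half_pos hS) h1
  refine ⟨h3, ?_⟩
  rw [inv_add_sub_sum _ _ (by exact_mod_cast hS.ne') h2, norm_mul, norm_mul, norm_pow, norm_pow,
    norm_neg, norm_inv, Complex.norm_real, Real.norm_of_nonneg hS.le, ← mul_pow, ← div_eq_mul_inv]
  calc _ ≤ (‖G‖ / S) ^ (N + 1) * (2 / S) := mul_le_mul_of_nonneg_left h3 (by positivity)
    _ = _ := by ring

/-- The size of the mean value of the solution, and the error in the equation it satisfies,
follow from the two energy estimates by absorbing the terms that contain `t`. -/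
lemma absorb_estimates {M t τ s S F e c X : ℝ} (hM : 1 ≤ M) (ht : 0 ≤ t)
    (hτ0 : 0 ≤ τ) (hτ : τ ≤ t) (hτS : τ ≤ M * S) (hs : 0 ≤ s) (hs1 : s ≤ 1) (hsS : s ≤ S)
    (hF : 0 ≤ F) (he0 : 0 ≤ e) (hc : 0 ≤ c) (hsmall : 12 * M ^ 4 * t ≤ 1)
    (h1 : e ^ 2 ≤ M * (M * e * F + c * (M * t * e)))
    (h2 : X ≤ M * t * F + M * τ * e + s * (M * t * (M * e)) + c * (M * (τ * t)))
    (h3 : c * (S / 2) ≤ F + X) :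
    e ≤ M ^ 2 * (F + c * t) ∧ c * S ≤ 5 * F ∧ X ≤ 18 * M ^ 4 * t * F := by
  have hS : 0 ≤ S := hs.trans hsS
  have hM0 : 0 ≤ M := by linarith
  have he : e ≤ M ^ 2 * (F + c * t) := by
    rcases he0.eq_or_lt with h | h
    · rw [← h]; positivity
    · refine le_of_mul_le_mul_right ?_ h
      calc e * e = e ^ 2 := by ring
        _ ≤ M * (M * e * F + c * (M * t * e)) := h1
        _ = _ := by ring
  have ht1 : t ≤ 1 := by
    have : t ≤ M ^ 4 * t := le_mul_of_one_le_left ht (one_le_pow₀ hM)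
    linarith
  have hM12 : M ≤ M ^ 4 := by simpa using pow_le_pow_right₀ hM (show 1 ≤ 4 by norm_num)
  have hM32 : M ^ 3 ≤ M ^ 4 := pow_le_pow_right₀ hM (by norm_num)
  have hM22 : M ^ 2 ≤ M ^ 4 := pow_le_pow_right₀ hM (by norm_num)
  have b1 : M * t * F ≤ M ^ 4 * (t * F) := by
    rw [mul_assoc]; exact mul_le_mul_of_nonneg_right hM12 (by positivity)
  have b2 : M * τ * e ≤ M ^ 4 * (t * F) + M ^ 4 * (t * (S * c)) := by
    calc _ ≤ M * τ * (M ^ 2 * (F + c * t)) := by gcongr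
      _ = M ^ 3 * (τ * F) + M ^ 3 * (τ * (c * t)) := by ring
      _ ≤ M ^ 3 * (t * F) + M ^ 3 * (M * S * (c * t)) := by gcongr
      _ = M ^ 3 * (t * F) + M ^ 4 * (t * (S * c)) := by ring
      _ ≤ _ := by gcongr
  have b3 : s * (M * t * (M * e)) ≤ M ^ 4 * (t * F) + M ^ 4 * (t * (S * c)) := by
    calc _ ≤ s * (M * t * (M * (M ^ 2 * (F + c * t)))) := by gcongr
      _ = M ^ 4 * (s * (t * F)) + M ^ 4 * (s * t * (t * c)) := by ring
      _ ≤ M ^ 4 * (1 * (t * F)) + M ^ 4 * (S * t * (1 * c)) := by gcongr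
      _ = _ := by ring
  have b4 : c * (M * (τ * t)) ≤ M ^ 4 * (t * (S * c)) := by
    calc _ ≤ c * (M * (M * S * t)) := by gcongr
      _ = M ^ 2 * (t * (S * c)) := by ring
      _ ≤ _ := by gcongr
  have hX : X ≤ 3 * M ^ 4 * t * (F + S * c) := by
    calc X ≤ _ := h2
      _ ≤ M ^ 4 * (t * F) + (M ^ 4 * (t * F) + M ^ 4 * (t * (S * c))) +
          (M ^ 4 * (t * F) + M ^ 4 * (t * (S * c))) + M ^ 4 * (t * (S * c)) := by gcongr
      _ = _ := by ring
  have hcS : c * S ≤ 5 * F := by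
    have : 3 * M ^ 4 * t * (F + S * c) ≤ 1 / 4 * (F + S * c) :=
      mul_le_mul_of_nonneg_right (by linarith) (by positivity)
    linarith
  refine ⟨he, hcS, hX.trans ?_⟩
  calc _ ≤ 3 * M ^ 4 * t * (F + 5 * F) := by
        refine mul_le_mul_of_nonneg_left ?_ (by positivity)
        linarith
    _ = _ := by ring

set_option maxHeartbeats 1000000 in
/-- The effective symbol, corrected by `⟨g⁰ξ,ξ⟩`, describes the resolvent on small quasimomenta up
to an error of order `1 + |ξ| / (μ⁰c₀|ξ|^α + s)`. Test functions: the mean zero part of the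
solution, and the corrected constant `𝟏 + i ∑ ξ_k v_k`. -/
lemma norm_resolvent_sub_le [NeZero d] (hα : α ∈ Set.Ioo (1 : ℝ) 2)
    (hμ : IsCoefficient μlo μhi μ) (hlo : 0 < μlo) {v : Fin d → L2Cell d}
    (hv : ∀ k, IsCellSolution μ α k (v k)) {ξ : E d} {M s : ℝ} (hM : 1 ≤ M)
    (hM1 : poincareConst d α ≤ M) (hM2 : poincareConst d α * corrConst d α μlo μhi ≤ M)
    (hM3 : oneConst d α μhi ≤ M) (hM4 : crossConst d α μlo μhi ≤ M)
    (hM5 : expandConst d α μlo μhi ≤ M) (hM6 : 8 / μlo ≤ M)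
    (hM7 : ‖ξ‖ ^ α ≤ M * (muZero μ * c0 d α * ‖ξ‖ ^ α + s))
    (hM8 : ‖matForm (gZero μ α v) ξ‖ ≤ (muZero μ * c0 d α * ‖ξ‖ ^ α + s) / 2)
    (hM9 : twistConst α ξ * poincareConst d α ≤ 1 / 2)
    (hsmall : 12 * M ^ 4 * ‖ξ‖ ≤ 1) (hs : 0 < s) (hs1 : s ≤ 1) {u f : L2Cell d}
    (hu : u ∈ formDomain d α)
    (hweak : ∀ η ∈ formDomain d α, form μ α ξ u η + s * inner ℂ η u = inner ℂ η f) :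
    ‖u - (((muZero μ * c0 d α * ‖ξ‖ ^ α + s : ℝ) : ℂ) + matForm (gZero μ α v) ξ)⁻¹ • P d f‖ ≤
      41 * M ^ 4 * (1 + ‖ξ‖ / (muZero μ * c0 d α * ‖ξ‖ ^ α + s)) * ‖f‖ := by
  have hhi : 0 ≤ μhi := hlo.le.trans hμ.lo_le_hi
  have hM0 : 0 ≤ M := by linarith
  have h1V := oneCell_mem_formDomain d α
  have hψV := corrector_mem hv ξ
  have ht := norm_nonneg ξ
  have hc0 := c0_pos (d := d) hα
  have hμ0 := muZero_bounds hμ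
  have hξ1 : ‖ξ‖ ≤ 1 := by
    have : ‖ξ‖ ≤ M ^ 4 * ‖ξ‖ := le_mul_of_one_le_left ht (one_le_pow₀ hM)
    linarith
  have hτt : ‖ξ‖ ^ α ≤ ‖ξ‖ := by
    rcases ht.eq_or_lt with h | h
    · rw [← h, Real.zero_rpow (by linarith [hα.1])]
    · exact (Real.rpow_le_rpow_of_exponent_ge h hξ1 hα.1.le).trans_eq (Real.rpow_one _)
  have hτ0 : 0 ≤ ‖ξ‖ ^ α := Real.rpow_nonneg ht _
  have hsS : s ≤ muZero μ * c0 d α * ‖ξ‖ ^ α + s := by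
    have : 0 ≤ muZero μ * c0 d α * ‖ξ‖ ^ α :=
      mul_nonneg (mul_nonneg (hlo.le.trans hμ0.1) hc0.le) hτ0
    linarith
  set S := muZero μ * c0 d α * ‖ξ‖ ^ α + s with hS
  have hS0 : 0 < S := hs.trans_le hsS
  set G := matForm (gZero μ α v) ξ with hG
  set ψ := corrector ξ v with hψ
  set one := oneCell d with hone
  have h11 : inner ℂ one one = 1 := by
    rw [inner_self_eq_norm_sq_to_K, hone, norm_oneCell]; simp
  set c : ℂ := inner ℂ one u with hc
  set r := u + (-c) • one with hr
  have hur : u = c • one + r := by rw [hr, neg_smul]; abel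
  have hrV : r ∈ formDomain d α := Submodule.add_mem _ hu (Submodule.smul_mem _ _ h1V)
  have h1r : inner ℂ one r = 0 := by
    rw [hr, inner_add_right, inner_smul_right, h11, ← hc]; ring
  have hrm : ∫ x in unitCell d, r x = 0 := by rw [← inner_oneCell]; exact h1r
  have hr1 : inner ℂ r one = 0 := by rw [← inner_conj_symm, h1r, map_zero]
  set φ := one + Complex.I • ψ with hφ
  have hφV : φ ∈ formDomain d α := Submodule.add_mem _ h1V (Submodule.smul_mem _ _ hψV)
  have hψ1 : inner ℂ ψ one = 0 := by
    rw [← inner_conj_symm, hψ, hone, inner_oneCell_corrector hv, map_zero]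
  set e := seminormH α r with he
  have he0 : 0 ≤ e := seminormH_nonneg α r
  have hre : ‖r‖ ≤ M * e :=
    (norm_le_poincareConst_mul hα hrV hrm).trans (mul_le_mul_of_nonneg_right hM1 he0)
  have hψt : ‖ψ‖ ≤ M * ‖ξ‖ :=
    (norm_corrector_le hα hμ hlo hv ξ).trans (mul_le_mul_of_nonneg_right hM2 ht)
  -- Testing with the mean zero part.
  have t1 : c * form μ α ξ one r + form μ α ξ r r + s * ((‖r‖ ^ 2 : ℝ) : ℂ) = inner ℂ r f := by
    have h := hweak r hrV
    rw [hur, form_add_left hα hμ ξ (Submodule.smul_mem _ _ h1V) hrV hrV, form_smul_left,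
      inner_add_right, inner_smul_right, hr1, inner_self_eq_norm_sq_to_K] at h
    rw [← h]
    push_cast
    simp
  have e1 : e ^ 2 ≤ M * (M * e * ‖f‖ + ‖c‖ * (M * ‖ξ‖ * e)) := by
    have g1 := re_form_self_ge_seminormH hα hμ hlo hM9 hrV hrm
    have g2 : (form μ α ξ r r).re ≤ M * e * ‖f‖ + ‖c‖ * (M * ‖ξ‖ * e) := by
      have k1 : form μ α ξ r r = inner ℂ r f - c * form μ α ξ one r - ((s * ‖r‖ ^ 2 : ℝ) : ℂ) := by
        rw [← t1]; push_cast; ring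
      have k2 : (form μ α ξ r r).re = (inner ℂ r f - c * form μ α ξ one r).re - s * ‖r‖ ^ 2 := by
        rw [k1, Complex.sub_re, Complex.ofReal_re]
      have k3 : ‖inner ℂ r f - c * form μ α ξ one r‖ ≤ M * e * ‖f‖ + ‖c‖ * (M * ‖ξ‖ * e) := by
        refine (norm_sub_le _ _).trans (add_le_add ?_ ?_)
        · exact (norm_inner_le_norm _ _).trans (mul_le_mul_of_nonneg_right hre (norm_nonneg f))
        · rw [norm_mul]
          refine mul_le_mul_of_nonneg_left
            ((norm_form_one_le hα hμ hlo hξ1 hrV hrm).trans ?_) (norm_nonneg c)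
          gcongr
      rw [k2]
      have k4 := (Complex.re_le_norm _).trans k3
      have k5 : 0 ≤ s * ‖r‖ ^ 2 := by positivity
      linarith
    calc e ^ 2 = 8 / μlo * (μlo / 8 * e ^ 2) := by field_simp
      _ ≤ 8 / μlo * (M * e * ‖f‖ + ‖c‖ * (M * ‖ξ‖ * e)) :=
          mul_le_mul_of_nonneg_left (g1.trans g2) (by positivity)
      _ ≤ _ := mul_le_mul_of_nonneg_right hM6 (by positivity)
  -- Testing with the corrected constant.
  have t2 : c * (((S : ℝ) : ℂ) + G) - inner ℂ one f =
      inner ℂ (Complex.I • ψ) f - form μ α ξ r φ - s * inner ℂ (Complex.I • ψ) r -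
        c * (form μ α ξ one φ - ((muZero μ * c0 d α * ‖ξ‖ ^ α : ℝ) + G)) := by
    have h := hweak φ hφV
    rw [hur, form_add_left hα hμ ξ (Submodule.smul_mem _ _ h1V) hrV hφV, form_smul_left, hφ,
      inner_add_left, inner_add_left, inner_add_right, inner_smul_right, h11, h1r,
      inner_add_right, inner_smul_right, inner_smul_left, hψ1, ← hφ] at h
    rw [hS]
    push_cast
    linear_combination h
  have e2 : ‖c * (((S : ℝ) : ℂ) + G) - inner ℂ one f‖ ≤ M * ‖ξ‖ * ‖f‖ + M * ‖ξ‖ ^ α * e +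
      s * (M * ‖ξ‖ * (M * e)) + ‖c‖ * (M * (‖ξ‖ ^ α * ‖ξ‖)) := by
    have hIψ : ‖Complex.I • ψ‖ ≤ M * ‖ξ‖ := by
      rw [norm_smul, Complex.norm_I, one_mul]; exact hψt
    rw [t2]
    refine (norm_sub_le _ _).trans (add_le_add ((norm_sub_le _ _).trans (add_le_add
      ((norm_sub_le _ _).trans (add_le_add ?_ ?_)) ?_)) ?_)
    · exact (norm_inner_le_norm _ _).trans (mul_le_mul_of_nonneg_right hIψ (norm_nonneg f))
    · rw [form_conj, RCLike.norm_conj]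
      refine (norm_form_corrected_le hα hμ hlo hv hξ1 hrV hrm).trans ?_
      gcongr
    · rw [norm_mul, Complex.norm_real, Real.norm_of_nonneg hs.le]
      refine mul_le_mul_of_nonneg_left ((norm_inner_le_norm _ _).trans ?_) hs.le
      gcongr
    · rw [norm_mul]
      refine mul_le_mul_of_nonneg_left
        ((norm_form_oneCell_corrected_sub_le hα hμ hlo hv ξ).trans ?_) (norm_nonneg c)
      gcongr
  have hinner : ‖(inner ℂ one f : ℂ)‖ ≤ ‖f‖ := by
    refine (norm_inner_le_norm _ _).trans ?_
    rw [hone, norm_oneCell, one_mul]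
  have hSG : S / 2 ≤ ‖(S : ℂ) + G‖ := by
    have h := norm_sub_le ((S : ℂ) + G) G
    rw [add_sub_cancel_right, Complex.norm_real, Real.norm_of_nonneg hS0.le] at h
    linarith
  have hSG0 : (S : ℂ) + G ≠ 0 := norm_pos_iff.1 ((half_pos hS0).trans_le hSG)
  have e3 : ‖c‖ * (S / 2) ≤ ‖f‖ + ‖c * (((S : ℝ) : ℂ) + G) - inner ℂ one f‖ := by
    calc ‖c‖ * (S / 2) ≤ ‖c‖ * ‖(S : ℂ) + G‖ := mul_le_mul_of_nonneg_left hSG (norm_nonneg c)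
      _ = ‖inner ℂ one f + (c * (((S : ℝ) : ℂ) + G) - inner ℂ one f)‖ := by
          rw [← norm_mul]; congr 1; ring
      _ ≤ _ := (norm_add_le _ _).trans (by gcongr)
  obtain ⟨a1, a2, a3⟩ := absorb_estimates hM ht hτ0 hτt hM7 hs.le hs1 hsS (norm_nonneg f) he0
    (norm_nonneg c) hsmall e1 e2 e3
  have hcS : ‖c‖ ≤ 5 * ‖f‖ / S := by rwa [le_div_iff₀ hS0]
  have hPf : P d f = inner ℂ one f • one := rfl
  have hdec : u - ((S : ℂ) + G)⁻¹ • P d f =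
      (((S : ℂ) + G)⁻¹ * (c * (((S : ℝ) : ℂ) + G) - inner ℂ one f)) • one + r := by
    have k : ((S : ℂ) + G)⁻¹ * (c * (((S : ℝ) : ℂ) + G) - inner ℂ one f) =
        c - ((S : ℂ) + G)⁻¹ * inner ℂ one f := by
      field_simp
    rw [k, sub_smul, hPf, smul_smul]
    conv_lhs => rw [hur]
    abel
  rw [hdec]
  refine (norm_add_le _ _).trans ?_
  rw [norm_smul, norm_mul, hone, norm_oneCell, mul_one]
  have hinv := (norm_inv_add_sub_sum_le hS0 hM8 0).1
  have hM34 : M ^ 3 ≤ M ^ 4 := pow_le_pow_right₀ hM (by norm_num)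
  have hM4 : 0 ≤ M ^ 4 := by positivity
  calc _ ≤ 2 / S * (18 * M ^ 4 * ‖ξ‖ * ‖f‖) + M * (M ^ 2 * (‖f‖ + 5 * ‖f‖ / S * ‖ξ‖)) := by
        refine add_le_add (mul_le_mul hinv a3 (norm_nonneg _) (by positivity)) (hre.trans ?_)
        refine mul_le_mul_of_nonneg_left (a1.trans ?_) hM0
        gcongr
    _ = 36 * M ^ 4 * (‖ξ‖ / S) * ‖f‖ + M ^ 3 * ((1 + 5 * (‖ξ‖ / S)) * ‖f‖) := by
        field_simp
        ring
    _ ≤ 36 * M ^ 4 * (‖ξ‖ / S) * ‖f‖ + M ^ 4 * ((1 + 5 * (‖ξ‖ / S)) * ‖f‖) := by gcongr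
    _ ≤ _ := by
        have : 0 ≤ M ^ 4 * ‖f‖ := by positivity
        nlinarith

end

/-! ### Uniform estimates in the quasimomentum and the shift -/

section

variable {d : ℕ} {α μlo μhi : ℝ} {μ : E d → E d → ℝ}

/-- Interpolation between the regimes `t ≤ ε` and `t ≥ ε`. -/
lemma rpow_div_le {t ε S M β : ℝ} (ht : 0 ≤ t) (hε : 0 < ε) (hM : 1 ≤ M)
    (hβ : 0 < β) (hβα : β ≤ α) (h1 : t ^ α ≤ M * S) (h2 : ε ^ α ≤ S) :
    t ^ β / S ≤ M * ε ^ (β - α) := by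
  have hM0 : 0 ≤ M := by linarith
  have hεα := Real.rpow_pos_of_pos hε α
  rcases le_total t ε with h | h
  · calc t ^ β / S ≤ ε ^ β / ε ^ α :=
          div_le_div₀ (Real.rpow_nonneg hε.le _) (Real.rpow_le_rpow ht h hβ.le) hεα h2
      _ = 1 * ε ^ (β - α) := by rw [Real.rpow_sub hε, one_mul]
      _ ≤ _ := mul_le_mul_of_nonneg_right hM (Real.rpow_nonneg hε.le _)
  · have ht0 : 0 < t := hε.trans_le h
    have htα := Real.rpow_pos_of_pos ht0 α
    calc t ^ β / S ≤ t ^ β / (t ^ α / M) := by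
          refine div_le_div_of_nonneg_left (Real.rpow_nonneg ht _) (by positivity) ?_
          rw [div_le_iff₀ (by linarith)]
          linarith
      _ = M * t ^ (β - α) := by
          rw [Real.rpow_sub ht0]
          field_simp
      _ ≤ M * ε ^ (β - α) := by
          refine mul_le_mul_of_nonneg_left ?_ hM0
          exact Real.rpow_le_rpow_of_nonpos hε h (by linarith)

lemma norm_resolvent_le {ξ : E d} {κ s : ℝ} (hκs : 0 < κ + s) {u f : L2Cell d}
    (hκ : κ * ‖u‖ ^ 2 ≤ (form μ α ξ u u).re)
    (hweak : form μ α ξ u u + s * inner ℂ u u = inner ℂ u f) : ‖u‖ ≤ (κ + s)⁻¹ * ‖f‖ := by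
  have h1 : (form μ α ξ u u).re + s * ‖u‖ ^ 2 = (inner ℂ u f : ℂ).re := by
    have hin : inner ℂ u u = ((‖u‖ ^ 2 : ℝ) : ℂ) := by
      rw [inner_self_eq_norm_sq_to_K]; simp
    rw [← hweak, hin, ← Complex.ofReal_mul, Complex.add_re, Complex.ofReal_re]
  have h2 : (inner ℂ u f : ℂ).re ≤ ‖u‖ * ‖f‖ :=
    (Complex.re_le_norm _).trans (norm_inner_le_norm _ _)
  rw [← div_eq_inv_mul, le_div_iff₀ hκs]
  rcases (norm_nonneg u).eq_or_lt with h | h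
  · rw [← h, zero_mul]; exact norm_nonneg f
  · refine le_of_mul_le_mul_left ?_ h
    calc ‖u‖ * (‖u‖ * (κ + s)) = κ * ‖u‖ ^ 2 + s * ‖u‖ ^ 2 := by ring
      _ ≤ ‖u‖ * ‖f‖ := by linarith

/-- The bound by the triangle inequality, for parameters away from the singularity at zero. -/
lemma norm_sub_sub_sum_le {R : L2Cell d →L[ℂ] L2Cell d} {S B B₀ g : ℝ} {G : ℂ} (hS : 0 < S)
    (hR : ‖R‖ ≤ B) (hSB : S⁻¹ ≤ B) (hB : B ≤ B₀) (hG : ‖G‖ ≤ g) (N : ℕ) :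
    ‖R - (S : ℂ)⁻¹ • P d - ∑ m ∈ Finset.Icc 1 N,
      ((-1) ^ m * G ^ m * (S : ℂ)⁻¹ ^ (m + 1)) • P d‖ ≤
      (2 + ∑ m ∈ Finset.Icc 1 N, (g * B₀) ^ m) * B := by
  have hg : 0 ≤ g := (norm_nonneg G).trans hG
  have hS' : 0 ≤ S⁻¹ := (inv_pos.2 hS).le
  have hB0 : 0 ≤ B := hS'.trans hSB
  have hn : ‖(S : ℂ)⁻¹‖ = S⁻¹ := by rw [norm_inv, Complex.norm_real, Real.norm_of_nonneg hS.le]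
  have hP := norm_P_le d
  have h1 : ‖(S : ℂ)⁻¹ • P d‖ ≤ B := by
    rw [norm_smul, hn]
    calc S⁻¹ * ‖P d‖ ≤ B * 1 := mul_le_mul hSB hP (norm_nonneg _) hB0
      _ = B := mul_one B
  have h2 : ∀ m, ‖((-1) ^ m * G ^ m * (S : ℂ)⁻¹ ^ (m + 1)) • P d‖ ≤ (g * B₀) ^ m * B := by
    intro m
    rw [norm_smul, norm_mul, norm_mul, norm_pow, norm_pow, norm_pow, norm_neg, norm_one, one_pow,
      one_mul, hn]
    calc ‖G‖ ^ m * S⁻¹ ^ (m + 1) * ‖P d‖ ≤ g ^ m * B ^ (m + 1) * 1 := by gcongr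
      _ = g ^ m * (B ^ m * B) := by ring
      _ ≤ g ^ m * (B₀ ^ m * B) := by gcongr
      _ = _ := by rw [mul_pow]; ring
  refine (norm_sub_le _ _).trans ?_
  refine (add_le_add ((norm_sub_le _ _).trans (add_le_add hR h1))
    ((norm_sum_le _ _).trans (Finset.sum_le_sum fun m _ => h2 m))).trans (le_of_eq ?_)
  rw [← Finset.sum_mul]
  ring

lemma deltaStar_le_pi [NeZero d] (h0 : 0 < α) (hμ : IsCoefficient μlo μhi μ) (hlo : 0 < μlo) :
    deltaStar α μlo μhi μ ≤ Real.pi := by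
  have hlh := hμ.lo_le_hi
  have hhi : 0 < μhi := hlo.trans_le hlh
  refine (min_le_left _ _).trans ?_
  have h : (μlo / (3 * μhi)) ^ (1 / α) ≤ 1 := by
    refine Real.rpow_le_one (by positivity) ?_ (by positivity)
    rw [div_le_one (by linarith)]
    linarith
  calc delta0 α μlo μhi ≤ Real.pi * 1 := mul_le_mul_of_nonneg_left h Real.pi_pos.le
    _ = _ := mul_one _

/-- One constant that dominates all the constants of the perturbation argument. -/
lemma exists_dominating_const [NeZero d] (hα : α ∈ Set.Ioo (1 : ℝ) 2) (hlo : 0 < μlo)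
    (hhi : 0 ≤ μhi) :
    ∃ M : ℝ, 1 ≤ M ∧ poincareConst d α ≤ M ∧ poincareConst d α * corrConst d α μlo μhi ≤ M ∧
      oneConst d α μhi ≤ M ∧ crossConst d α μlo μhi ≤ M ∧ expandConst d α μlo μhi ≤ M ∧
      8 / μlo ≤ M ∧ (μlo * c0 d α)⁻¹ ≤ M ∧ matConst d α μlo μhi ≤ M ∧
      16 * weightInt d α * poincareConst d α ^ 2 ≤ M := by
  have h1 := poincareConst_nonneg d α
  have h2 := mul_nonneg h1 (corrConst_nonneg d α hlo hhi)
  have h4 := crossConst_nonneg d α hlo hhi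
  have h6 : 0 ≤ 8 / μlo := by positivity
  have h7 := (inv_pos.2 (mul_pos hlo (c0_pos (d := d) hα))).le
  have hK := weightInt_nonneg d α
  have h9 : 0 ≤ 16 * weightInt d α * poincareConst d α ^ 2 := by positivity
  have a3 := abs_nonneg (oneConst d α μhi)
  have a5 := abs_nonneg (expandConst d α μlo μhi)
  have a8 := abs_nonneg (matConst d α μlo μhi)
  have b3 := le_abs_self (oneConst d α μhi)
  have b5 := le_abs_self (expandConst d α μlo μhi)
  have b8 := le_abs_self (matConst d α μlo μhi)
  refine ⟨1 + poincareConst d α + poincareConst d α * corrConst d α μlo μhi +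
    |oneConst d α μhi| + crossConst d α μlo μhi + |expandConst d α μlo μhi| + 8 / μlo +
    (μlo * c0 d α)⁻¹ + |matConst d α μlo μhi| + 16 * weightInt d α * poincareConst d α ^ 2,
    ?_, ?_, ?_, ?_, ?_, ?_, ?_, ?_, ?_, ?_⟩ <;> linarith

/-- The asymptotic regime of small `ξ` and small `ε`. -/
lemma norm_sub_sub_sum_le_of_small [NeZero d] (hα : α ∈ Set.Ioo (1 : ℝ) 2)
    (hμ : IsCoefficient μlo μhi μ) (hlo : 0 < μlo) {v : Fin d → L2Cell d}
    (hv : ∀ k, IsCellSolution μ α k (v k)) {ξ : E d} {M ε β : ℝ} (hM : 1 ≤ M)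
    (hM1 : poincareConst d α ≤ M) (hM2 : poincareConst d α * corrConst d α μlo μhi ≤ M)
    (hM3 : oneConst d α μhi ≤ M) (hM4 : crossConst d α μlo μhi ≤ M)
    (hM5 : expandConst d α μlo μhi ≤ M) (hM6 : 8 / μlo ≤ M) (hM7 : (μlo * c0 d α)⁻¹ ≤ M)
    (hM8 : matConst d α μlo μhi ≤ M) (hM9 : 16 * weightInt d α * poincareConst d α ^ 2 ≤ M)
    (hξ1 : 12 * M ^ 4 * ‖ξ‖ ≤ 1) (hξ2 : 2 * M ^ 2 * ‖ξ‖ ^ (2 - α) ≤ 1)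
    (hε : 0 < ε) (hε1 : ε ≤ 1) (N : ℕ) (hβ : 0 < β) (hβ1 : β ≤ 1)
    (hβN : β ≤ ((N : ℝ) + 1) * (2 - α))
    {R : L2Cell d →L[ℂ] L2Cell d} (hR : ∀ f, R f ∈ formDomain d α ∧ ∀ η ∈ formDomain d α,
      form μ α ξ (R f) η + (ε ^ α : ℝ) * inner ℂ η (R f) = inner ℂ η f) :
    ‖R - (effSymbol μ α ξ ε : ℂ)⁻¹ • P d - ∑ m ∈ Finset.Icc 1 N,
      corrK μ α (gZero μ α v) m ξ ε • P d‖ ≤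
      (41 * M ^ 4 * (1 + M) + 2 * M ^ (2 * N + 3)) * ε ^ (β - α) := by
  have hM0 : 0 < M := by linarith
  have hα0 : 0 < α := by linarith [hα.1]
  have hc0 := c0_pos (d := d) hα
  have hμ0 := muZero_bounds hμ
  have ht := norm_nonneg ξ
  set t := ‖ξ‖ with htdef
  have htα : 0 ≤ t ^ α := Real.rpow_nonneg ht _
  have ht2 : 0 ≤ t ^ (2 - α) := Real.rpow_nonneg ht _
  have hMt : M * t ≤ 1 / 12 := by
    have : M * t ≤ M ^ 4 * t :=
      mul_le_mul_of_nonneg_right (by simpa using pow_le_pow_right₀ hM (show 1 ≤ 4 by norm_num)) ht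
    linarith
  have ht1 : t ≤ 1 := by nlinarith
  have htαt : t ^ α ≤ t := by
    rcases ht.eq_or_lt with h | h
    · rw [← h, Real.zero_rpow hα0.ne']
    · exact (Real.rpow_le_rpow_of_exponent_ge h ht1 hα.1.le).trans_eq (Real.rpow_one _)
  have htt : t ^ 2 = t ^ (2 - α) * t ^ α := by
    rcases ht.eq_or_lt with h | h
    · rw [← h, Real.zero_rpow hα0.ne']; norm_num
    · rw [← Real.rpow_add h, sub_add_cancel, Real.rpow_two]
  have hs := Real.rpow_pos_of_pos hε α
  have hs1 : ε ^ α ≤ 1 := Real.rpow_le_one hε.le hε1 hα0.le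
  have hlead : μlo * c0 d α * t ^ α ≤ muZero μ * c0 d α * t ^ α := by
    have := hμ0.1
    gcongr
  set S := effSymbol μ α ξ ε with hS
  have hSdef : S = muZero μ * c0 d α * t ^ α + ε ^ α := rfl
  have hlead0 : 0 ≤ μlo * c0 d α * t ^ α := by positivity
  have hsS : ε ^ α ≤ S := by linarith
  have hS0 : 0 < S := hs.trans_le hsS
  have hτS : t ^ α ≤ M * S := by
    calc t ^ α = (μlo * c0 d α)⁻¹ * (μlo * c0 d α * t ^ α) := by field_simp
      _ ≤ M * S := mul_le_mul hM7 (by linarith) hlead0 hM0.le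
  set G := matForm (gZero μ α v) ξ with hG
  have hGS : ‖G‖ ≤ M ^ 2 * t ^ (2 - α) * S := by
    calc ‖G‖ ≤ matConst d α μlo μhi * t ^ 2 := norm_matForm_le hα hμ hlo hv ξ
      _ ≤ M * t ^ 2 := by gcongr
      _ = M * t ^ (2 - α) * t ^ α := by rw [htt]; ring
      _ ≤ M * t ^ (2 - α) * (M * S) := by gcongr
      _ = _ := by ring
  have hGS2 : ‖G‖ ≤ S / 2 := by
    refine hGS.trans ?_
    calc _ = (2 * M ^ 2 * t ^ (2 - α)) * (S / 2) := by ring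
      _ ≤ 1 * (S / 2) := mul_le_mul_of_nonneg_right hξ2 (by positivity)
      _ = _ := one_mul _
  have hK := weightInt_nonneg d α
  have hp := poincareConst_nonneg d α
  have htw : twistConst α ξ * poincareConst d α ≤ 1 / 2 := by
    refine le_of_sq_le_sq ?_ (by norm_num)
    rw [mul_pow, sq_twistConst]
    calc 4 * (t ^ α * weightInt d α) * poincareConst d α ^ 2 =
          1 / 4 * (16 * weightInt d α * poincareConst d α ^ 2) * t ^ α := by ring
      _ ≤ 1 / 4 * M * t := by gcongr
      _ ≤ (1 / 2) ^ 2 := by linarith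
  set X := ε ^ (β - α) with hX
  have hX1 : 1 ≤ X := Real.one_le_rpow_of_pos_of_le_one_of_nonpos hε hε1 (by linarith [hα.1])
  have hX2 : t ^ β / S ≤ M * X :=
    rpow_div_le ht hε hM hβ (by linarith [hα.1]) hτS hsS
  have htβ : 0 ≤ t ^ β := Real.rpow_nonneg ht _
  have htS : t / S ≤ M * X := by
    refine le_trans (div_le_div_of_nonneg_right ?_ hS0.le) hX2
    rcases ht.eq_or_lt with h | h
    · rw [← h, Real.zero_rpow hβ.ne']
    · exact (Real.rpow_one t).symm.trans_le (Real.rpow_le_rpow_of_exponent_ge h ht1 hβ1)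
  have hgeo := norm_inv_add_sub_sum_le hS0 hGS2 N
  have hrem : 2 * (‖G‖ / S) ^ (N + 1) / S ≤ 2 * M ^ (2 * N + 3) * X := by
    have h1 : ‖G‖ / S ≤ M ^ 2 * t ^ (2 - α) := by rwa [div_le_iff₀ hS0]
    have h2 : (t ^ (2 - α)) ^ (N + 1) ≤ t ^ β := by
      rcases ht.eq_or_lt with h | h
      · rw [← h, Real.zero_rpow hβ.ne', Real.zero_rpow (by linarith [hα.2])]
        simp
      · rw [← Real.rpow_natCast, ← Real.rpow_mul ht]
        refine Real.rpow_le_rpow_of_exponent_ge h ht1 ?_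
        push_cast
        linarith
    calc 2 * (‖G‖ / S) ^ (N + 1) / S ≤ 2 * (M ^ 2 * t ^ (2 - α)) ^ (N + 1) / S := by gcongr
      _ = 2 * M ^ (2 * N + 2) * ((t ^ (2 - α)) ^ (N + 1) / S) := by
          rw [mul_pow, ← pow_mul]; ring_nf
      _ ≤ 2 * M ^ (2 * N + 2) * (M * X) := by
          refine mul_le_mul_of_nonneg_left (le_trans ?_ hX2) (by positivity)
          gcongr
      _ = _ := by ring
  refine ContinuousLinearMap.opNorm_le_bound _ (by positivity) fun f => ?_
  obtain ⟨hu, hweak⟩ := hR f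
  have hmain := norm_resolvent_sub_le hα hμ hlo hv hM hM1 hM2 hM3 hM4 hM5 hM6 hτS hGS2 htw
    hξ1 hs hs1 hu hweak
  rw [← htdef, ← hSdef, ← hG] at hmain
  have hsplit : (R - (S : ℂ)⁻¹ • P d - ∑ m ∈ Finset.Icc 1 N,
      corrK μ α (gZero μ α v) m ξ ε • P d) f =
      (R f - ((S : ℂ) + G)⁻¹ • P d f) + (((S : ℂ) + G)⁻¹ - (S : ℂ)⁻¹ -
        ∑ m ∈ Finset.Icc 1 N, (-1) ^ m * G ^ m * (S : ℂ)⁻¹ ^ (m + 1)) • P d f := by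
    rw [← Finset.sum_smul]
    simp only [corrK, ← hS, ← hG, sub_apply, smul_apply,
      sub_smul]
    abel
  rw [hsplit]
  refine (norm_add_le _ _).trans ?_
  rw [norm_smul]
  have hf := norm_nonneg f
  calc _ ≤ 41 * M ^ 4 * (1 + t / S) * ‖f‖ + 2 * M ^ (2 * N + 3) * X * ‖f‖ :=
        add_le_add hmain (mul_le_mul (hgeo.2.trans hrem) (norm_P_apply_le d f) (norm_nonneg _)
          (by positivity))
    _ ≤ 41 * M ^ 4 * (X + M * X) * ‖f‖ + 2 * M ^ (2 * N + 3) * X * ‖f‖ := by gcongr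
    _ = _ := by ring

end

end LevyHomog

theorem theorem4p4 (d : ℕ) [NeZero d] (α : ℝ) (hα : α ∈ Set.Ioo (1 : ℝ) 2)
    (μlo μhi : ℝ) (hlo : 0 < μlo) (N : ℕ) (hN : 1 ≤ N) (hαN : 2 - 1 / (N : ℝ) < α) :
    ∃ C : ℝ, ∀ (μ : LevyHomog.E d → LevyHomog.E d → ℝ)
      (hμ : LevyHomog.IsCoefficient μlo μhi μ),
      (∀ k : Fin d, ∃! vk : LevyHomog.L2Cell d, LevyHomog.IsCellSolution μ α k vk) ∧
      ∀ v : Fin d → LevyHomog.L2Cell d, (∀ k, LevyHomog.IsCellSolution μ α k (v k)) →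
        ∀ ε : ℝ, 0 < ε → ∀ ξ : LevyHomog.E d, ‖ξ‖ ≤ LevyHomog.deltaStar α μlo μhi μ →
          ∃ R : LevyHomog.L2Cell d →L[ℂ] LevyHomog.L2Cell d,
            LevyHomog.IsInverseOfShift (LevyHomog.levyOperator hα hμ ξ) (ε ^ α) R ∧
            ‖R - ((LevyHomog.effSymbol μ α ξ ε : ℂ)⁻¹) • LevyHomog.P d
              - ∑ m ∈ Finset.Icc 1 N,
                  LevyHomog.corrK μ α (LevyHomog.gZero μ α v) m ξ ε • LevyHomog.P d‖
              ≤ C * (if α ≤ 2 - 1 / ((N : ℝ) + 1) then ε ^ (1 - α)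
                  else ε ^ (((N : ℝ) + 1) * (2 - α) - α)) := by
  open LevyHomog in
  have hα0 : 0 < α := by linarith [hα.1]
  have hα2 : 0 < 2 - α := by linarith [hα.2]
  -- Without `μlo ≤ μhi` there are no coefficients, and nothing to prove.
  by_cases hlh : μlo ≤ μhi
  swap
  · exact ⟨0, fun μ hμ => absurd hμ.lo_le_hi hlh⟩
  have hhi : 0 ≤ μhi := hlo.le.trans hlh
  have hc0 := c0_pos (d := d) hα
  have hd : (0 : ℝ) < d := by exact_mod_cast Nat.pos_of_ne_zero (NeZero.ne d)
  obtain ⟨M, hM, hM1, hM2, hM3, hM4, hM5, hM6, hM7, hM8, hM9⟩ :=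
    exists_dominating_const (d := d) (μlo := μlo) (μhi := μhi) hα hlo hhi
  have hM0 : 0 < M := by linarith
  -- The radius of the asymptotic regime, independent of `δ_*`: it meets the two smallness
  -- conditions of `norm_sub_sub_sum_le_of_small`.
  set δ : ℝ := min (1 / (12 * M ^ 4)) ((1 / (2 * M ^ 2)) ^ (1 / (2 - α))) with hδ
  have hδ0 : 0 < δ := lt_min (by positivity) (by positivity)
  -- The exponent of the error is `β - α`.
  set β : ℝ := if α ≤ 2 - 1 / ((N : ℝ) + 1) then 1 else ((N : ℝ) + 1) * (2 - α) with hβ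
  have hN1 : (0 : ℝ) < (N : ℝ) + 1 := by positivity
  have hβ3 : 0 < β ∧ β ≤ 1 ∧ β ≤ ((N : ℝ) + 1) * (2 - α) := by
    have hmul : ((N : ℝ) + 1) * (1 / ((N : ℝ) + 1)) = 1 := by field_simp
    rw [hβ]
    split_ifs with h
    · refine ⟨one_pos, le_rfl, ?_⟩
      calc 1 = ((N : ℝ) + 1) * (1 / ((N : ℝ) + 1)) := hmul.symm
        _ ≤ _ := mul_le_mul_of_nonneg_left (by linarith) hN1.le
    · refine ⟨by positivity, ?_, le_rfl⟩
      push Not at h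
      calc _ ≤ ((N : ℝ) + 1) * (1 / ((N : ℝ) + 1)) :=
            mul_le_mul_of_nonneg_left (by linarith) hN1.le
        _ = 1 := hmul
  obtain ⟨hβ0, hβ1, hβN⟩ := hβ3
  have hκ0 := kernelLow_pos d α
  -- For `δ ≤ |ξ| ≤ π` the form is bounded below by `κ`; the resolvent and the inverse of the
  -- effective symbol are then bounded by `B`.
  set κ : ℝ := μlo / 2 * (2 * kernelLow d α / (d * Real.pi ^ 2) * δ ^ 2) with hκ
  have hκpos : 0 < κ := by positivity
  set B : ℝ := κ⁻¹ + (μlo * c0 d α * δ ^ α)⁻¹ with hB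
  have hB0 : 0 < B := by positivity
  set g : ℝ := M * Real.pi ^ 2 with hg
  have hg0 : 0 < g := by positivity
  set C₁ := 41 * M ^ 4 * (1 + M) + 2 * M ^ (2 * N + 3) with hC₁
  set C₂ := 2 + ∑ m ∈ Finset.Icc 1 N, (g * 1) ^ m with hC₂
  set C₃ := (2 + ∑ m ∈ Finset.Icc 1 N, (g * B) ^ m) * B with hC₃
  have hC₁0 : 0 ≤ C₁ := by positivity
  have hC₂0 : 0 ≤ C₂ := by positivity
  have hC₃0 : 0 ≤ C₃ := by positivity
  refine ⟨C₁ + C₂ + C₃, fun μ hμ => ⟨existsUnique_isCellSolution hα hμ hlo,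
    fun v hv ε hε ξ hξ => ?_⟩⟩
  have hs := Real.rpow_pos_of_pos hε α
  obtain ⟨R, hR⟩ := exists_weak_resolvent hα hμ hlo ξ hs
  refine ⟨R, isInverseOfShift_levyOperator hα hμ hlo ξ hs hR, ?_⟩
  have hrhs : (if α ≤ 2 - 1 / ((N : ℝ) + 1) then ε ^ (1 - α)
      else ε ^ (((N : ℝ) + 1) * (2 - α) - α)) = ε ^ (β - α) := by
    rw [hβ]; split_ifs <;> rfl
  rw [hrhs]
  have hX0 : 0 ≤ ε ^ (β - α) := Real.rpow_nonneg hε.le _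
  have hξπ : ‖ξ‖ ≤ Real.pi := hξ.trans (deltaStar_le_pi hα0 hμ hlo)
  have hξ0 := norm_nonneg ξ
  have hG : ‖matForm (gZero μ α v) ξ‖ ≤ g := by
    refine (norm_matForm_le hα hμ hlo hv ξ).trans ?_
    have : 0 ≤ ‖ξ‖ ^ 2 := by positivity
    calc _ ≤ M * ‖ξ‖ ^ 2 := mul_le_mul_of_nonneg_right hM8 this
      _ ≤ M * Real.pi ^ 2 := by gcongr
  have hlead : μlo * c0 d α * ‖ξ‖ ^ α ≤ muZero μ * c0 d α * ‖ξ‖ ^ α := by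
    have := (muZero_bounds hμ).1
    gcongr
  have hlead0 : 0 ≤ μlo * c0 d α * ‖ξ‖ ^ α := by positivity
  have hSdef : effSymbol μ α ξ ε = muZero μ * c0 d α * ‖ξ‖ ^ α + ε ^ α := rfl
  have hS0 : 0 < effSymbol μ α ξ ε := by linarith
  have hcrude : ∀ B' B₀ : ℝ, ‖R‖ ≤ B' → (effSymbol μ α ξ ε)⁻¹ ≤ B' → B' ≤ B₀ →
      ‖R - ((effSymbol μ α ξ ε : ℂ)⁻¹) • P d - ∑ m ∈ Finset.Icc 1 N,
        corrK μ α (gZero μ α v) m ξ ε • P d‖ ≤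
        (2 + ∑ m ∈ Finset.Icc 1 N, (g * B₀) ^ m) * B' := fun B' B₀ h1 h2 h3 =>
    norm_sub_sub_sum_le hS0 h1 h2 h3 hG N
  rcases le_or_gt 1 ε with hε1 | hε1
  · -- Large shifts: every term is of order `ε^{-α}`.
    have hre : ∀ u ∈ formDomain d α, 0 ≤ (form μ α ξ u u).re := fun u hu =>
      le_trans (by positivity) (re_form_self_ge hα hμ ξ hu)
    have h1 : ‖R‖ ≤ (ε ^ α)⁻¹ := by
      refine ContinuousLinearMap.opNorm_le_bound _ (by positivity) fun f => ?_
      have h := norm_resolvent_le (κ := 0) (by simpa using hs)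
        (by simpa using hre _ (hR f).1) ((hR f).2 _ (hR f).1)
      rwa [zero_add] at h
    have h2 : (effSymbol μ α ξ ε)⁻¹ ≤ (ε ^ α)⁻¹ := inv_anti₀ hs (by linarith)
    have h3 : (ε ^ α)⁻¹ ≤ 1 := inv_le_one_of_one_le₀ (Real.one_le_rpow hε1 hα0.le)
    have h4 : (ε ^ α)⁻¹ ≤ ε ^ (β - α) := by
      rw [← Real.rpow_neg hε.le]
      exact Real.rpow_le_rpow_of_exponent_le hε1 (by linarith)
    calc _ ≤ C₂ * (ε ^ α)⁻¹ := hcrude _ 1 h1 h2 h3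
      _ ≤ C₂ * ε ^ (β - α) := mul_le_mul_of_nonneg_left h4 hC₂0
      _ ≤ _ := mul_le_mul_of_nonneg_right (by linarith) hX0
  rcases le_or_gt ‖ξ‖ δ with hξδ | hξδ
  · have hξ1 : 12 * M ^ 4 * ‖ξ‖ ≤ 1 := by
      have h := hξδ.trans (min_le_left _ _)
      rw [le_div_iff₀ (by positivity)] at h
      linarith
    have hξ2 : 2 * M ^ 2 * ‖ξ‖ ^ (2 - α) ≤ 1 := by
      have h := Real.rpow_le_rpow hξ0 (hξδ.trans (min_le_right _ _)) hα2.le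
      rw [← Real.rpow_mul (by positivity), one_div_mul_cancel hα2.ne', Real.rpow_one,
        le_div_iff₀ (by positivity)] at h
      linarith
    refine (norm_sub_sub_sum_le_of_small hα hμ hlo hv hM hM1 hM2 hM3 hM4 hM5 hM6 hM7 hM8 hM9
      hξ1 hξ2 hε hε1.le N hβ0 hβ1 hβN hR).trans ?_
    exact mul_le_mul_of_nonneg_right (by linarith) hX0
  · -- Quasimomenta away from zero: the resolvent is bounded, and the right-hand side is not small.
    have hre : ∀ u ∈ formDomain d α, κ * ‖u‖ ^ 2 ≤ (form μ α ξ u u).re := by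
      intro u hu
      refine le_trans ?_ (re_form_self_ge hα hμ ξ hu)
      have h := norm_sq_mul_le_sq_lpNorm_twistDiff hα hξπ hu
      calc κ * ‖u‖ ^ 2 = μlo / 2 * (2 * kernelLow d α / (d * Real.pi ^ 2) * δ ^ 2 * ‖u‖ ^ 2) := by
            rw [hκ]; ring
        _ ≤ μlo / 2 * (2 * kernelLow d α / (d * Real.pi ^ 2) * ‖ξ‖ ^ 2 * ‖u‖ ^ 2) := by gcongr
        _ ≤ _ := mul_le_mul_of_nonneg_left h (by positivity)
    have h1 : ‖R‖ ≤ B := by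
      refine ContinuousLinearMap.opNorm_le_bound _ hB0.le fun f => ?_
      refine (norm_resolvent_le (by positivity) (hre _ (hR f).1)
        ((hR f).2 _ (hR f).1)).trans (mul_le_mul_of_nonneg_right ?_ (norm_nonneg f))
      have k1 : (κ + ε ^ α)⁻¹ ≤ κ⁻¹ := inv_anti₀ hκpos (by linarith)
      have k2 : 0 ≤ (μlo * c0 d α * δ ^ α)⁻¹ := by positivity
      linarith
    have h2 : (effSymbol μ α ξ ε)⁻¹ ≤ B := by
      have k0 : μlo * c0 d α * δ ^ α ≤ μlo * c0 d α * ‖ξ‖ ^ α := by gcongr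
      have k1 : (effSymbol μ α ξ ε)⁻¹ ≤ (μlo * c0 d α * δ ^ α)⁻¹ :=
        inv_anti₀ (by positivity) (by linarith)
      have k2 : 0 ≤ κ⁻¹ := by positivity
      linarith
    have hX1 : 1 ≤ ε ^ (β - α) :=
      Real.one_le_rpow_of_pos_of_le_one_of_nonpos hε hε1.le (by linarith [hα.1])
    calc _ ≤ C₃ := hcrude B B h1 h2 le_rfl
      _ ≤ C₃ * ε ^ (β - α) := le_mul_of_one_le_right hC₃0 hX1
      _ ≤ _ := mul_le_mul_of_nonneg_right (by linarith) hX0
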